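/- Let $\Omega$ be a finite set, and for $n\ge 0$ let $C_n=C_n(\Delta(\Omega),\mathbf Z)$ be the group of integral oriented simplicial $n$-chains of the full simplex $\Delta(\Omega)$ with vertex set $\Omega$. Write $\partial$ for the boundary map and $|M|$ for the $L_1$-norm of a chain $M$, i.e. the sum of the absolute values of its coefficients on the unoriented simplices. An abstract simplicial complex with vertices in $\Omega$ is called a simplicial triangulation of a space if its geometric carrier is homeomorphic to that space. Let $\sigma$ be a simplicial triangulation of $S^2$ with vertices in $\Omega$, and let $X\in C_2$ be a $2$-cycle obtained by orienting the $2$-simplices of $\sigma$ (every $2$-simplex of $\sigma$ has coefficient $\pm1$ in $X$, and every other $2$-simplex of $\Delta(\Omega)$ has coefficient $0$). Let $M\in C_3$ be a taut filling of $X$, that is, $\partial M=X$ and $|M|\le|N|$ for every $N\in C_3$ with $\partial N=X$. Then every coefficient of $M$ is $0$ or $\pm1$, and the simplicial complex $\tau$ generated by the tetrahedra that have nonzero coefficient in $M$ is a freely shellable simplicial triangulation of $B^3$. That is, $\tau$ is a simplicial triangulation of $B^3$, and for every tetrahedron $t$ of $\tau$ there is an ordering $(t_1,\dots,t_m)$ of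 all the tetrahedra of $\tau$, without repetition, with $t_1=t$, such that for each $k=1,\dots,m$ the subcomplex of $\tau$ generated by $\{t_1,\dots,t_k\}$ is a simplicial triangulation of $B^3$. -/

import Mathlib

namespace TautFilling

/-- The group `C_n(Δ(Ω), ℤ)` of integral `n`-chains of the full simplex on the finite vertex set `Ω`.
A chain is recorded by its coefficients on oriented simplices: `c x` is the (signed) multiplicity of
the oriented simplex `[x 0, …, x n]`, so an even permutation of the vertices does not change it and
an odd one changes its sign (in particular `c x = 0` if a vertex is repeated). -/
def Chain (Ω : Type*) (n : ℕ) : AddSubgroup ((Fin (n + 1) → Ω) → ℤ) where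
  carrier := {c | ∀ (x : Fin (n + 1) → Ω) (π : Equiv.Perm (Fin (n + 1))),
    c (x ∘ π) = (Equiv.Perm.sign π : ℤ) * c x}
  zero_mem' := by intro x π; simp
  add_mem' := by intro a b ha hb x π; simp [ha x π, hb x π, mul_add]
  neg_mem' := by intro a ha x π; simp [ha x π]

/-- The boundary map `∂ : C_{n+1} → C_n`,
`∂[x 0, …, x (n+1)] = ∑ i, (-1)^i [x 0, …, omit x i, …, x (n+1)]`. In terms of coefficients: an
oriented simplex with `[x 0, …, x n]` in its boundary can be written `[v, x 0, …, x n]`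
in exactly one way, so the coefficient of `[x 0, …, x n]` in `∂ c` is the sum over `v` of the
coefficients of `[v, x 0, …, x n]` in `c`. -/
def boundary {Ω : Type*} [Fintype Ω] {n : ℕ} : Chain Ω (n + 1) →+ Chain Ω n where
  toFun c := ⟨fun x => ∑ v : Ω, c.1 (Fin.cons v x), by
    intro x π
    rw [Finset.mul_sum]
    refine Finset.sum_congr rfl fun v _ => ?_
    have h := c.2 (Fin.cons v x) (Equiv.Perm.decomposeFin.symm (0, π))
    rw [Equiv.Perm.decomposeFin.symm_sign] at h
    simp only [if_true, one_mul] at h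
    rw [← h]
    refine congrArg c.1 (funext fun i => ?_)
    refine Fin.cases ?_ (fun j => ?_) i <;> simp⟩
  map_zero' := by ext x; simp
  map_add' a b := by ext x; simp [Finset.sum_add_distrib]

/-- The `L₁`-norm of a chain: the sum, over the unoriented `n`-simplices, of the absolute value of
the coefficient. Each unoriented simplex is listed by `(n+1)!` tuples of vertices. -/
noncomputable def norm {Ω : Type*} [Fintype Ω] [DecidableEq Ω] {n : ℕ} (c : Chain Ω n) : ℚ :=
  (∑ x : Fin (n + 1) → Ω, |(c.1 x : ℚ)|) / (n + 1).factorial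

/-- A chain is taut if it is an optimal filling of its boundary. -/
def IsTaut {Ω : Type*} [Fintype Ω] [DecidableEq Ω] {n : ℕ} (M : Chain Ω (n + 1)) : Prop :=
  ∀ N : Chain Ω (n + 1), boundary N = boundary M → norm M ≤ norm N

/-- The subcomplex generated by a collection of simplices: all their nonempty faces. -/
def generatedBy {Ω : Type*} (T : Set (Finset Ω)) : PreAbstractSimplicialComplex Ω where
  faces := {s | s.Nonempty ∧ ∃ t ∈ T, s ⊆ t}
  isRelLowerSet_faces := by
    rintro s ⟨hs, t, ht, hst⟩
    exact ⟨hs, fun u hu hne => ⟨hne, t, ht, hu.trans hst⟩⟩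

/-- The geometric carrier of a finite abstract simplicial complex, in barycentric coordinates. -/
def carrier {Ω : Type*} [Fintype Ω] (K : PreAbstractSimplicialComplex Ω) : Set (Ω → ℝ) :=
  {x | x ∈ stdSimplex ℝ Ω ∧ ∃ s ∈ K, ∀ v, v ∉ s → x v = 0}

/-- `K` is a simplicial triangulation of the sphere `S²`. -/
def IsSphere2 {Ω : Type*} [Fintype Ω] (K : PreAbstractSimplicialComplex Ω) : Prop :=
  Nonempty (carrier K ≃ₜ Metric.sphere (0 : EuclideanSpace ℝ (Fin 3)) 1)

/-- `K` is a simplicial triangulation of the ball `B³`. -/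
def IsBall3 {Ω : Type*} [Fintype Ω] (K : PreAbstractSimplicialComplex Ω) : Prop :=
  Nonempty (carrier K ≃ₜ Metric.closedBall (0 : EuclideanSpace ℝ (Fin 3)) 1)

/-- The `n`-chain `c` arises from `K` by orienting its `n`-simplices: every `n`-simplex of `K` occurs
in `c` exactly once, with one of its two orientations, and no other simplex occurs. -/
def IsOrientation {Ω : Type*} [DecidableEq Ω] {n : ℕ} (K : PreAbstractSimplicialComplex Ω)
    (c : Chain Ω n) : Prop :=
  ∀ x : Fin (n + 1) → Ω, Function.Injective x →
    (Finset.univ.image x ∈ K → |c.1 x| = 1) ∧ (Finset.univ.image x ∉ K → c.1 x = 0)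

/-- The simplicial complex generated by the `n`-simplices that occur in `c`. -/
def supportComplex {Ω : Type*} [DecidableEq Ω] {n : ℕ} (c : Chain Ω n) :
    PreAbstractSimplicialComplex Ω :=
  generatedBy {s | ∃ x : Fin (n + 1) → Ω, c.1 x ≠ 0 ∧ s = Finset.univ.image x}

/-- The set of tetrahedra (`3`-simplices) of a complex. -/
def tets {Ω : Type*} (K : PreAbstractSimplicialComplex Ω) : Set (Finset Ω) :=
  {s | s ∈ K ∧ s.card = 4}

/-- A shelling of `τ`: an ordering `l = (t₁, …, t_m)` of its tetrahedra, each occurring once, such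
that for `k = 1, …, m` the subcomplex generated by `t₁, …, t_k` is a simplicial triangulation of
`B³`. -/
def IsShelling {Ω : Type*} [Fintype Ω] (τ : PreAbstractSimplicialComplex Ω)
    (l : List (Finset Ω)) : Prop :=
  l.Nodup ∧ (∀ s, s ∈ l ↔ s ∈ tets τ) ∧
    ∀ k, 1 ≤ k → k ≤ l.length → IsBall3 (generatedBy {s | s ∈ l.take k})

/-- Any tetrahedron of `τ` can serve as the initial one of a shelling. -/
def IsFreelyShellable {Ω : Type*} [Fintype Ω] (τ : PreAbstractSimplicialComplex Ω) : Prop :=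
  ∀ t ∈ tets τ, ∃ l : List (Finset Ω), IsShelling τ l ∧ l.head? = some t

end TautFilling

/-! ### Alternating coefficient functions, norm and tautness -/

namespace TautFilling

open Finset

variable {Ω : Type*}

/-! The proof is an induction on the norm of the taut filling `M`. The hypothesis on `σ` enters
through `isSph_of_isSphere2`, which turns the homeomorphism with the round sphere into combinatorial
facts (`IsSph`): every edge is on exactly two faces, faces are strongly connected, and `1`-cocycles
are coboundaries. The class `IsSph` is stable under the two surgeries used below, so no topology is
needed during the induction.

Tautness is used in three ways. Parts of taut chains are taut. A vertex outside the boundary could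
be merged into a neighbour at a profit, so it cannot occur (`Taut.eq_zero_of_interior`). Coning from
a boundary vertex `c` bounds the norm by the number of faces missing `c`. As each boundary face lies
on some tetrahedron of `M`, this bound and the pigeonhole principle give an ear, a tetrahedron with
two faces `pqx`, `pqy` on the boundary (`exists_ear`); the count has room to avoid a prescribed
edge.

Suppose that three edges of the sphere form a triangle that is not a face. A discrete Jordan curve
theorem (`IsSph.split`) cuts the sphere into two along this triangle, and comparing `M` with its
images under two retractions shows that `M` splits too (`Taut.splits`, `Taut.exists_parts`). The
shellings of the two pieces are concatenated by `Shells.append`. Otherwise the sphere bounds a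
tetrahedron, or `xy` is not an edge and removing the ear flips the edge `pq` to `xy` (`IsSph.flip`).

For the ear to be glued back to a ball along a disc, the edge `pq` must be absent from the rest of
`M`, including its interior. This is `IsClosing.not_mem`, proved by its own induction with the same
two surgeries; it also makes the coefficient of the ear `±1`. Any tetrahedron can come first: the
ear removed can be chosen different from it (`exists_ear_ne`), and in the split case the second
shelling is free to start on the common triangle.

Finally `exists_isBallMap_cons` shows that each step of a combinatorial shelling preserves balls:
the new tetrahedron makes the ball into a star-shaped body, and radial rescaling makes that round.
-/

/-- Alternating functions of three vertices: the coefficient functions of `2`-chains. -/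
structure IsAlt₃ (X : Ω → Ω → Ω → ℤ) : Prop where
  swap_left : ∀ a b c, X b a c = - X a b c
  swap_right : ∀ a b c, X a c b = - X a b c

/-- Alternating functions of four vertices: the coefficient functions of `3`-chains. -/
structure IsAlt₄ (M : Ω → Ω → Ω → Ω → ℤ) : Prop where
  swap_left : ∀ a b c d, M b a c d = - M a b c d
  swap_mid : ∀ a b c d, M a c b d = - M a b c d
  swap_right : ∀ a b c d, M a b d c = - M a b c d

/-- Pairwise distinct quadruples. -/
def Dist₄ (a b c d : Ω) : Prop := a ≠ b ∧ a ≠ c ∧ a ≠ d ∧ b ≠ c ∧ b ≠ d ∧ c ≠ d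

namespace IsAlt₃

variable {X Y : Ω → Ω → Ω → ℤ}

lemma rot (hX : IsAlt₃ X) (a b c : Ω) : X b c a = X a b c := by
  rw [hX.swap_right b a c, hX.swap_left a b c, neg_neg]

lemma rot' (hX : IsAlt₃ X) (a b c : Ω) : X c a b = X a b c := by
  rw [hX.rot b c a, hX.rot a b c]

lemma swap_out (hX : IsAlt₃ X) (a b c : Ω) : X c b a = - X a b c := by
  rw [hX.swap_left b c a, hX.rot a b c]

lemma self_left (hX : IsAlt₃ X) (a b : Ω) : X a a b = 0 := by
  have := hX.swap_left a a b; omega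

lemma self_right (hX : IsAlt₃ X) (a b : Ω) : X a b b = 0 := by
  have := hX.swap_right a b b; omega

lemma self_out (hX : IsAlt₃ X) (a b : Ω) : X a b a = 0 := by
  have := hX.swap_left a b a; have := hX.self_right b a; omega

lemma dist (hX : IsAlt₃ X) {a b c : Ω} (h : X a b c ≠ 0) : a ≠ b ∧ a ≠ c ∧ b ≠ c := by
  refine ⟨?_, ?_, ?_⟩ <;> rintro rfl <;> apply h
  exacts [hX.self_left _ _, hX.self_out _ _, hX.self_right _ _]

lemma sub (hX : IsAlt₃ X) (hY : IsAlt₃ Y) : IsAlt₃ (X - Y) :=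
  ⟨fun a b c => by simp [hX.swap_left a b c, hY.swap_left a b c]; ring,
    fun a b c => by simp [hX.swap_right a b c, hY.swap_right a b c]; ring⟩

lemma smul (hX : IsAlt₃ X) (k : ℤ) : IsAlt₃ (k • X) :=
  ⟨fun a b c => by simp [hX.swap_left a b c], fun a b c => by simp [hX.swap_right a b c]⟩

end IsAlt₃

namespace IsAlt₄

variable {M N : Ω → Ω → Ω → Ω → ℤ}

lemma add (hM : IsAlt₄ M) (hN : IsAlt₄ N) : IsAlt₄ (M + N) :=
  ⟨fun a b c d => by simp [hM.swap_left a b c d, hN.swap_left a b c d]; ring,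
    fun a b c d => by simp [hM.swap_mid a b c d, hN.swap_mid a b c d]; ring,
    fun a b c d => by simp [hM.swap_right a b c d, hN.swap_right a b c d]; ring⟩

lemma sub (hM : IsAlt₄ M) (hN : IsAlt₄ N) : IsAlt₄ (M - N) :=
  ⟨fun a b c d => by simp [hM.swap_left a b c d, hN.swap_left a b c d]; ring,
    fun a b c d => by simp [hM.swap_mid a b c d, hN.swap_mid a b c d]; ring,
    fun a b c d => by simp [hM.swap_right a b c d, hN.swap_right a b c d]; ring⟩

lemma smul (hM : IsAlt₄ M) (k : ℤ) : IsAlt₄ (k • M) :=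
  ⟨fun a b c d => by simp [hM.swap_left a b c d], fun a b c d => by simp [hM.swap_mid a b c d],
    fun a b c d => by simp [hM.swap_right a b c d]⟩

lemma dist (hM : IsAlt₄ M) {a b c d : Ω} (h : M a b c d ≠ 0) : Dist₄ a b c d := by
  have h1 := hM.swap_left
  have h2 := hM.swap_mid
  have h3 := hM.swap_right
  refine ⟨?_, ?_, ?_, ?_, ?_, ?_⟩ <;> rintro rfl <;> apply h
  · have := h1 a a c d; omega
  · have := h1 a b a d; have := h2 b a a d; omega
  · have := h1 a b c a; have := h2 b a c a; have := h3 b c a a; omega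
  · have := h2 a b b d; omega
  · have := h2 a b c b; have := h3 a c b b; omega
  · have := h3 a b c c; omega

end IsAlt₄

section Part

/-- `N` is a part of `K`: removing `N` from `K` involves no cancellation. -/
def IsPart (N K : Ω → Ω → Ω → Ω → ℤ) : Prop :=
  ∀ a b c d, |K a b c d| = |N a b c d| + |K a b c d - N a b c d|

variable [DecidableEq Ω]

/-- The part of a chain carried by a family of simplices. -/
def restr₄ (S : Finset Ω → Prop) [DecidablePred S] (M : Ω → Ω → Ω → Ω → ℤ) (a b c d : Ω) : ℤ :=
  if S {a, b, c, d} then M a b c d else 0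

/-- The part of a chain carried by a family of simplices. -/
def restr₃ (S : Finset Ω → Prop) [DecidablePred S] (X : Ω → Ω → Ω → ℤ) (a b c : Ω) : ℤ :=
  if S {a, b, c} then X a b c else 0

lemma IsAlt₄.restr {M : Ω → Ω → Ω → Ω → ℤ} (hM : IsAlt₄ M) (S : Finset Ω → Prop)
    [DecidablePred S] : IsAlt₄ (restr₄ S M) := by
  refine ⟨fun a b c d => ?_, fun a b c d => ?_, fun a b c d => ?_⟩
  · simp only [restr₄, hM.swap_left a b c d, Finset.insert_comm b a]; split_ifs <;> simp
  · simp only [restr₄, hM.swap_mid a b c d, Finset.insert_comm c b]; split_ifs <;> simp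
  · simp only [restr₄, hM.swap_right a b c d, Finset.pair_comm d c]; split_ifs <;> simp

lemma IsAlt₃.restr {X : Ω → Ω → Ω → ℤ} (hX : IsAlt₃ X) (S : Finset Ω → Prop)
    [DecidablePred S] : IsAlt₃ (restr₃ S X) := by
  refine ⟨fun a b c => ?_, fun a b c => ?_⟩
  · simp only [restr₃, hX.swap_left a b c, Finset.insert_comm b a]; split_ifs <;> simp
  · simp only [restr₃, hX.swap_right a b c, Finset.pair_comm c b]; split_ifs <;> simp

lemma isPart_restr (S : Finset Ω → Prop) [DecidablePred S] (M : Ω → Ω → Ω → Ω → ℤ) :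
    IsPart (restr₄ S M) M := by
  intro a b c d
  simp only [restr₄]; split_ifs <;> simp

end Part

section Boundary

variable [Fintype Ω]

/-- The boundary of a `3`-chain. -/
def bd₃ (M : Ω → Ω → Ω → Ω → ℤ) (a b c : Ω) : ℤ := ∑ w, M w a b c

/-- The boundary of a `2`-chain. -/
def bd₂ (X : Ω → Ω → Ω → ℤ) (a b : Ω) : ℤ := ∑ w, X w a b

/-- The sum of the absolute values of a coefficient function over all quadruples. -/
def nrm (M : Ω → Ω → Ω → Ω → ℤ) : ℤ := ∑ a, ∑ b, ∑ c, ∑ d, |M a b c d|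

/-- Alternating functions of minimal norm among those with the same boundary. -/
def Taut (M : Ω → Ω → Ω → Ω → ℤ) : Prop :=
  ∀ N, IsAlt₄ N → bd₃ N = bd₃ M → nrm M ≤ nrm N

lemma bd₃_add (M N : Ω → Ω → Ω → Ω → ℤ) : bd₃ (M + N) = bd₃ M + bd₃ N := by
  funext a b c; simp [bd₃, Finset.sum_add_distrib]

lemma bd₃_sub (M N : Ω → Ω → Ω → Ω → ℤ) : bd₃ (M - N) = bd₃ M - bd₃ N := by
  funext a b c; simp [bd₃, Finset.sum_sub_distrib]

lemma bd₃_smul (k : ℤ) (M : Ω → Ω → Ω → Ω → ℤ) : bd₃ (k • M) = k • bd₃ M := by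
  funext a b c; simp [bd₃, Finset.mul_sum]

lemma bd₂_add (M N : Ω → Ω → Ω → ℤ) : bd₂ (M + N) = bd₂ M + bd₂ N := by
  funext a b; simp [bd₂, Finset.sum_add_distrib]

lemma bd₂_sub (M N : Ω → Ω → Ω → ℤ) : bd₂ (M - N) = bd₂ M - bd₂ N := by
  funext a b; simp [bd₂, Finset.sum_sub_distrib]

lemma bd₂_smul (k : ℤ) (M : Ω → Ω → Ω → ℤ) : bd₂ (k • M) = k • bd₂ M := by
  funext a b; simp [bd₂, Finset.mul_sum]

lemma IsAlt₄.bd (M : Ω → Ω → Ω → Ω → ℤ) (hM : IsAlt₄ M) : IsAlt₃ (bd₃ M) :=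
  ⟨fun a b c => by simp [bd₃, hM.swap_mid _ a b c], fun a b c => by
    simp [bd₃, hM.swap_right _ a b c]⟩

lemma eq_zero_of_sum_sum_alt (f : Ω → Ω → ℤ) (h : ∀ a b, f b a = - f a b) :
    ∑ a, ∑ b, f a b = 0 := by
  have : ∑ a, ∑ b, f a b = - ∑ a, ∑ b, f a b := by
    conv_lhs => rw [Finset.sum_comm]
    simp_rw [← Finset.sum_neg_distrib]
    exact Finset.sum_congr rfl fun a _ => Finset.sum_congr rfl fun b _ => h _ _
  omega

lemma IsAlt₄.bd₂_bd₃ {M : Ω → Ω → Ω → Ω → ℤ} (hM : IsAlt₄ M) : bd₂ (bd₃ M) = 0 := by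
  funext a b
  exact eq_zero_of_sum_sum_alt _ fun _ _ => hM.swap_left _ _ _ _

lemma IsAlt₃.sum_bd₂ {X : Ω → Ω → Ω → ℤ} (hX : IsAlt₃ X) (b : Ω) : ∑ a, bd₂ X a b = 0 :=
  eq_zero_of_sum_sum_alt _ fun _ _ => hX.swap_left _ _ _

lemma nrm_nonneg (M : Ω → Ω → Ω → Ω → ℤ) : 0 ≤ nrm M :=
  Finset.sum_nonneg fun _ _ => Finset.sum_nonneg fun _ _ => Finset.sum_nonneg fun _ _ =>
    Finset.sum_nonneg fun _ _ => abs_nonneg _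

lemma nrm_add_le (M N : Ω → Ω → Ω → Ω → ℤ) : nrm (M + N) ≤ nrm M + nrm N := by
  simp only [nrm, ← Finset.sum_add_distrib]
  exact Finset.sum_le_sum fun a _ => Finset.sum_le_sum fun b _ => Finset.sum_le_sum fun c _ =>
    Finset.sum_le_sum fun d _ => abs_add_le _ _

lemma sum_lt_sum₄ {f g : Ω → Ω → Ω → Ω → ℤ} (h : ∀ a b c d, f a b c d ≤ g a b c d)
    {a b c d : Ω} (hlt : f a b c d < g a b c d) :
    ∑ a, ∑ b, ∑ c, ∑ d, f a b c d < ∑ a, ∑ b, ∑ c, ∑ d, g a b c d := by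
  have e1 : ∀ a b c, ∑ d, f a b c d ≤ ∑ d, g a b c d := fun a b c =>
    Finset.sum_le_sum fun d _ => h a b c d
  have e2 : ∀ a b, ∑ c, ∑ d, f a b c d ≤ ∑ c, ∑ d, g a b c d := fun a b =>
    Finset.sum_le_sum fun d _ => e1 a b d
  have e3 : ∀ a, ∑ b, ∑ c, ∑ d, f a b c d ≤ ∑ b, ∑ c, ∑ d, g a b c d := fun a =>
    Finset.sum_le_sum fun d _ => e2 a d
  refine Finset.sum_lt_sum (fun a _ => e3 a) ⟨a, mem_univ _, ?_⟩
  refine Finset.sum_lt_sum (fun b _ => e2 a b) ⟨b, mem_univ _, ?_⟩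
  refine Finset.sum_lt_sum (fun c _ => e1 a b c) ⟨c, mem_univ _, ?_⟩
  exact Finset.sum_lt_sum (fun d _ => h a b c d) ⟨d, mem_univ _, hlt⟩

lemma IsPart.nrm_eq {N K : Ω → Ω → Ω → Ω → ℤ} (h : IsPart N K) :
    nrm K = nrm N + nrm (K - N) := by
  simp only [nrm, ← Finset.sum_add_distrib]
  exact Finset.sum_congr rfl fun a _ => Finset.sum_congr rfl fun b _ =>
    Finset.sum_congr rfl fun c _ => Finset.sum_congr rfl fun d _ => h a b c d

/-- A cheaper filling of the boundary of `N`, put in place of `N` inside `K`, would also make `K`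
cheaper, because the norm is additive when nothing cancels. -/
lemma Taut.of_isPart {N K : Ω → Ω → Ω → Ω → ℤ} (hK : Taut K) (hKa : IsAlt₄ K) (hNa : IsAlt₄ N)
    (h : IsPart N K) : Taut N := by
  intro L hL hb
  have h1 := hK (K - N + L) ((hKa.sub hNa).add hL) (by rw [bd₃_add, bd₃_sub, hb]; simp)
  have h2 := nrm_add_le (K - N) L
  have h3 := h.nrm_eq
  omega

lemma sum₄_comm (f : Ω × Ω × Ω × Ω → Ω × Ω × Ω × Ω → ℤ) :
    ∑ a, ∑ b, ∑ c, ∑ d, ∑ x, ∑ y, ∑ z, ∑ w, f (a, b, c, d) (x, y, z, w) =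
      ∑ x, ∑ y, ∑ z, ∑ w, ∑ a, ∑ b, ∑ c, ∑ d, f (a, b, c, d) (x, y, z, w) := by
  have h : ∀ g : Ω × Ω × Ω × Ω → ℤ, ∑ a, ∑ b, ∑ c, ∑ d, g (a, b, c, d) = ∑ p, g p := by
    intro g
    simp only [Fintype.sum_prod_type]
  simp_rw [fun p => h (f p), fun q => h (fun p => f p q)]
  rw [h (fun p => ∑ q, f p q), h (fun q => ∑ p, f p q)]
  exact Finset.sum_comm

end Boundary

/-! ### Images of chains under vertex maps -/

section Push

variable [Fintype Ω] [DecidableEq Ω]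

/-- The image of a `3`-chain under a map of vertices. -/
def push₄ (r : Ω → Ω) (M : Ω → Ω → Ω → Ω → ℤ) (a b c d : Ω) : ℤ :=
  ∑ x, ∑ y, ∑ z, ∑ w, if r x = a ∧ r y = b ∧ r z = c ∧ r w = d then M x y z w else 0

/-- The image of a `2`-chain under a map of vertices. -/
def push₃ (r : Ω → Ω) (X : Ω → Ω → Ω → ℤ) (a b c : Ω) : ℤ :=
  ∑ x, ∑ y, ∑ z, if r x = a ∧ r y = b ∧ r z = c then X x y z else 0

lemma IsAlt₄.push {M : Ω → Ω → Ω → Ω → ℤ} (hM : IsAlt₄ M) (r : Ω → Ω) : IsAlt₄ (push₄ r M) := by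
  refine ⟨fun a b c d => ?_, fun a b c d => ?_, fun a b c d => ?_⟩
  · simp only [push₄]
    rw [Finset.sum_comm]
    simp_rw [← Finset.sum_neg_distrib]
    refine sum_congr rfl fun x _ => sum_congr rfl fun y _ => sum_congr rfl fun z _ =>
      sum_congr rfl fun w _ => ?_
    rw [hM.swap_left x y z w]
    split_ifs <;> first | rfl | (exfalso; tauto)
  · simp only [push₄]
    simp_rw [← Finset.sum_neg_distrib]
    refine sum_congr rfl fun x _ => ?_
    rw [Finset.sum_comm]
    refine sum_congr rfl fun y _ => sum_congr rfl fun z _ =>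
      sum_congr rfl fun w _ => ?_
    rw [hM.swap_mid x y z w]
    split_ifs <;> first | rfl | (exfalso; tauto)
  · simp only [push₄]
    simp_rw [← Finset.sum_neg_distrib]
    refine sum_congr rfl fun x _ => sum_congr rfl fun y _ => ?_
    rw [Finset.sum_comm]
    refine sum_congr rfl fun z _ => sum_congr rfl fun w _ => ?_
    rw [hM.swap_right x y z w]
    split_ifs <;> first | rfl | (exfalso; tauto)

lemma IsAlt₃.push {X : Ω → Ω → Ω → ℤ} (hX : IsAlt₃ X) (r : Ω → Ω) : IsAlt₃ (push₃ r X) := by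
  refine ⟨fun a b c => ?_, fun a b c => ?_⟩
  · simp only [push₃]
    rw [Finset.sum_comm]
    simp_rw [← Finset.sum_neg_distrib]
    refine sum_congr rfl fun x _ => sum_congr rfl fun y _ => sum_congr rfl fun z _ => ?_
    rw [hX.swap_left x y z]
    split_ifs <;> first | rfl | (exfalso; tauto)
  · simp only [push₃]
    simp_rw [← Finset.sum_neg_distrib]
    refine sum_congr rfl fun x _ => ?_
    rw [Finset.sum_comm]
    refine sum_congr rfl fun y _ => sum_congr rfl fun z _ => ?_
    rw [hX.swap_right x y z]
    split_ifs <;> first | rfl | (exfalso; tauto)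

lemma sum_ite_and_eq (r : Ω → Ω) (x : Ω) (p : Prop) [Decidable p] (m : ℤ) :
    (∑ a, if r x = a ∧ p then m else 0) = if p then m else 0 := by
  by_cases hp : p <;> simp [hp]

lemma bd₃_push (r : Ω → Ω) (M : Ω → Ω → Ω → Ω → ℤ) : bd₃ (push₄ r M) = push₃ r (bd₃ M) := by
  funext a b c
  simp only [bd₃, push₄, push₃]
  rw [Finset.sum_comm]
  have : ∀ x, ∑ v, ∑ y, ∑ z, ∑ w,
      (if r x = v ∧ r y = a ∧ r z = b ∧ r w = c then M x y z w else 0) =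
      ∑ y, ∑ z, ∑ w, if r y = a ∧ r z = b ∧ r w = c then M x y z w else 0 := by
    intro x
    rw [Finset.sum_comm]
    refine sum_congr rfl fun y _ => ?_
    rw [Finset.sum_comm]
    refine sum_congr rfl fun z _ => ?_
    rw [Finset.sum_comm]
    refine sum_congr rfl fun w _ => ?_
    exact sum_ite_and_eq r x _ _
  simp_rw [this]
  rw [Finset.sum_comm]
  refine sum_congr rfl fun y _ => ?_
  rw [Finset.sum_comm]
  refine sum_congr rfl fun z _ => ?_
  rw [Finset.sum_comm]
  refine sum_congr rfl fun w _ => ?_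
  split_ifs <;> simp

lemma bd₂_push (r : Ω → Ω) (X : Ω → Ω → Ω → ℤ) (h : bd₂ X = 0) : bd₂ (push₃ r X) = 0 := by
  funext a b
  have h' : ∀ a b, ∑ w, X w a b = 0 := fun a b => congrFun (congrFun h a) b
  simp only [bd₂, push₃, Pi.zero_apply]
  rw [Finset.sum_comm]
  have : ∀ x, ∑ v, ∑ y, ∑ z, (if r x = v ∧ r y = a ∧ r z = b then X x y z else 0) =
      ∑ y, ∑ z, if r y = a ∧ r z = b then X x y z else 0 := by
    intro x
    rw [Finset.sum_comm]
    refine sum_congr rfl fun y _ => ?_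
    rw [Finset.sum_comm]
    refine sum_congr rfl fun z _ => ?_
    exact sum_ite_and_eq r x _ _
  simp_rw [this]
  rw [Finset.sum_comm]
  refine sum_eq_zero fun y _ => ?_
  rw [Finset.sum_comm]
  refine sum_eq_zero fun z _ => ?_
  split_ifs <;> simp [h']

lemma push₃_add (r : Ω → Ω) (X Y : Ω → Ω → Ω → ℤ) :
    push₃ r (X + Y) = push₃ r X + push₃ r Y := by
  funext a b c
  simp only [push₃, Pi.add_apply, ← Finset.sum_add_distrib]
  refine sum_congr rfl fun x _ => sum_congr rfl fun y _ => sum_congr rfl fun z _ => ?_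
  split_ifs <;> simp

lemma push₃_eq_self (r : Ω → Ω) (X : Ω → Ω → Ω → ℤ)
    (h : ∀ a b c, X a b c ≠ 0 → r a = a ∧ r b = b ∧ r c = c) : push₃ r X = X := by
  funext a b c
  simp only [push₃]
  rw [Finset.sum_eq_single a, Finset.sum_eq_single b, Finset.sum_eq_single c]
  · by_cases hX : X a b c = 0
    · simp [hX]
    · rw [if_pos (h _ _ _ hX)]
  all_goals try (simp; done)
  · intro z _ hz
    simp only [ite_eq_right_iff]
    rintro ⟨h1, h2, h3⟩
    by_contra h0
    have := h _ _ _ h0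
    exact hz (this.2.2.symm.trans h3)
  · intro y _ hy
    refine sum_eq_zero fun z _ => ?_
    simp only [ite_eq_right_iff]
    rintro ⟨h1, h2, h3⟩
    by_contra h0
    exact hy ((h _ _ _ h0).2.1.symm.trans h2)
  · intro y _ hy
    refine sum_eq_zero fun z _ => sum_eq_zero fun w _ => ?_
    simp only [ite_eq_right_iff]
    rintro ⟨h1, h2, h3⟩
    by_contra h0
    exact hy ((h _ _ _ h0).1.symm.trans h1)

lemma push₃_support (r : Ω → Ω) (X : Ω → Ω → Ω → ℤ) (a b c : Ω) (h : push₃ r X a b c ≠ 0) :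
    ∃ x y z, X x y z ≠ 0 ∧ r x = a ∧ r y = b ∧ r z = c := by
  obtain ⟨x, -, h⟩ := Finset.exists_ne_zero_of_sum_ne_zero h
  obtain ⟨y, -, h⟩ := Finset.exists_ne_zero_of_sum_ne_zero h
  obtain ⟨z, -, h⟩ := Finset.exists_ne_zero_of_sum_ne_zero h
  exact ⟨x, y, z, by grind⟩

instance (a b c d : Ω) : Decidable (Dist₄ a b c d) := by unfold Dist₄; infer_instance

/-- Only the simplices whose image is nondegenerate contribute to the norm of the image. -/
lemma nrm_push_le {M : Ω → Ω → Ω → Ω → ℤ} (hM : IsAlt₄ M) (r : Ω → Ω) :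
    nrm (push₄ r M) ≤ ∑ x, ∑ y, ∑ z, ∑ w,
      if Dist₄ (r x) (r y) (r z) (r w) then |M x y z w| else 0 := by
  have h1 : nrm (push₄ r M) ≤ ∑ a, ∑ b, ∑ c, ∑ d, ∑ x, ∑ y, ∑ z, ∑ w,
      if Dist₄ a b c d ∧ r x = a ∧ r y = b ∧ r z = c ∧ r w = d then |M x y z w| else 0 := by
    refine sum_le_sum fun a _ => sum_le_sum fun b _ => sum_le_sum fun c _ =>
      sum_le_sum fun d _ => ?_
    by_cases hd : Dist₄ a b c d
    · simp only [hd, true_and, push₄]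
      refine (abs_sum_le_sum_abs _ _).trans (sum_le_sum fun x _ => ?_)
      refine (abs_sum_le_sum_abs _ _).trans (sum_le_sum fun y _ => ?_)
      refine (abs_sum_le_sum_abs _ _).trans (sum_le_sum fun z _ => ?_)
      refine (abs_sum_le_sum_abs _ _).trans (sum_le_sum fun w _ => ?_)
      split_ifs <;> simp
    · have : push₄ r M a b c d = 0 := by
        by_contra h0
        exact hd ((hM.push r).dist h0)
      simp [this, hd]
  refine h1.trans (le_of_eq ?_)
  rw [sum₄_comm (fun p q => if Dist₄ p.1 p.2.1 p.2.2.1 p.2.2.2 ∧ r q.1 = p.1 ∧ r q.2.1 = p.2.1 ∧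
    r q.2.2.1 = p.2.2.1 ∧ r q.2.2.2 = p.2.2.2 then |M q.1 q.2.1 q.2.2.1 q.2.2.2| else 0)]
  refine sum_congr rfl fun x _ => sum_congr rfl fun y _ => sum_congr rfl fun z _ =>
    sum_congr rfl fun w _ => ?_
  simp only
  rw [Finset.sum_eq_single (r x), Finset.sum_eq_single (r y), Finset.sum_eq_single (r z),
    Finset.sum_eq_single (r w)]
  · simp
  all_goals try (simp; done)
  · intro b _ h1
    rw [if_neg]; rintro ⟨-, -, -, -, h3⟩; exact h1 h3.symm
  · intro b _ h1
    refine sum_eq_zero fun c _ => ?_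
    rw [if_neg]; rintro ⟨-, -, -, h3, -⟩; exact h1 h3.symm
  · intro b _ h1
    refine sum_eq_zero fun c _ => sum_eq_zero fun d _ => ?_
    rw [if_neg]; rintro ⟨-, -, h3, -, -⟩; exact h1 h3.symm
  · intro b _ h1
    refine sum_eq_zero fun c _ => sum_eq_zero fun d _ => sum_eq_zero fun d _ => ?_
    rw [if_neg]; rintro ⟨-, h3, -, -, -⟩; exact h1 h3.symm

/-- A taut chain has no vertices outside its boundary. -/
lemma Taut.eq_zero_of_interior {M : Ω → Ω → Ω → Ω → ℤ} (hT : Taut M) (hM : IsAlt₄ M) {v : Ω}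
    (hv : ∀ b c, bd₃ M v b c = 0) (b c d : Ω) : M v b c d = 0 := by
  by_contra h0
  have hd := hM.dist h0
  -- Contracting the edge `vb` to `b` fixes the boundary, which does not see `v`, but kills the
  -- tetrahedron `vbcd`, so the norm drops strictly.
  let r : Ω → Ω := Function.update id v b
  have hrv : r v = b := by simp [r]
  have hr : ∀ x, x ≠ v → r x = x := fun x hx => by simp [r, hx]
  have hX := hM.bd
  have hb : bd₃ (push₄ r M) = bd₃ M := by
    rw [bd₃_push]
    refine push₃_eq_self _ _ fun x y z h => ⟨hr x ?_, hr y ?_, hr z ?_⟩ <;> rintro rfl <;> apply h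
    · exact hv _ _
    · rw [hX.swap_left, hv, neg_zero]
    · rw [hX.rot, hv]
  have h1 := hT _ (hM.push r) hb
  have h2 := nrm_push_le hM r
  have h3 : (∑ x, ∑ y, ∑ z, ∑ w,
      if Dist₄ (r x) (r y) (r z) (r w) then |M x y z w| else 0) < nrm M := by
    refine sum_lt_sum₄ (a := v) (b := b) (c := c) (d := d) (fun x y z w => ?_) ?_
    · split_ifs <;> simp
    · rw [if_neg]
      · exact abs_pos.mpr h0
      · rintro ⟨h, -⟩
        exact h (by rw [hrv, hr b hd.1.symm])
  omega

end Push

end TautFilling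

/-! ### Orientation signs, oriented simplices and cones -/

namespace TautFilling

open Finset

variable {Ω : Type*}

lemma IsPart.symm {N K : Ω → Ω → Ω → Ω → ℤ} (h : IsPart N K) : IsPart (K - N) K := by
  intro a b c d
  have := h a b c d
  simp only [Pi.sub_apply, sub_sub_cancel]
  omega

section Sign

variable [DecidableEq Ω]

/-- The sign depends only on the two orderings, not on `M`, so values of different alternating
functions can be compared through it. The relation `R` is generated by adjacent transpositions;
`bring` moves `a` to the front and leaves three vertices to sort. -/
lemma exists_sign₄ {a b c d a' b' c' d' : Ω} (h : Dist₄ a b c d)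
    (h' : ({a', b', c', d'} : Finset Ω) = {a, b, c, d}) :
    ∃ s : ℤ, (s = 1 ∨ s = -1) ∧ ∀ M : Ω → Ω → Ω → Ω → ℤ, IsAlt₄ M →
      M a' b' c' d' = s * M a b c d := by
  obtain ⟨h1, h2, h3, h4, h5, h6⟩ := h
  let R : Ω × Ω × Ω × Ω → Ω × Ω × Ω × Ω → Prop := fun p q => ∃ s : ℤ, (s = 1 ∨ s = -1) ∧
    ∀ M : Ω → Ω → Ω → Ω → ℤ, IsAlt₄ M →
      M p.1 p.2.1 p.2.2.1 p.2.2.2 = s * M q.1 q.2.1 q.2.2.1 q.2.2.2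
  have tr : ∀ {p q r}, R p q → R q r → R p r := by
    rintro p q r ⟨s, hs, hM⟩ ⟨s', hs', hM'⟩
    refine ⟨s * s', by rcases hs with rfl | rfl <;> rcases hs' with rfl | rfl <;> simp,
      fun M h => ?_⟩
    rw [hM M h, hM' M h, mul_assoc]
  have e0 : ∀ p, R p p := fun p => ⟨1, by simp, by simp⟩
  have e1 : ∀ a b c d, R (b, a, c, d) (a, b, c, d) := fun a b c d =>
    ⟨-1, by simp, fun M hM => by simp [hM.swap_left a b c d]⟩
  have e2 : ∀ a b c d, R (a, c, b, d) (a, b, c, d) := fun a b c d =>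
    ⟨-1, by simp, fun M hM => by simp [hM.swap_mid a b c d]⟩
  have e3 : ∀ a b c d, R (a, b, d, c) (a, b, c, d) := fun a b c d =>
    ⟨-1, by simp, fun M hM => by simp [hM.swap_right a b c d]⟩
  have ha : a ∈ ({a', b', c', d'} : Finset Ω) := by rw [h']; simp
  have hb : b ∈ ({a', b', c', d'} : Finset Ω) := by rw [h']; simp
  have hc : c ∈ ({a', b', c', d'} : Finset Ω) := by rw [h']; simp
  have hd : d ∈ ({a', b', c', d'} : Finset Ω) := by rw [h']; simp
  simp only [mem_insert, mem_singleton] at ha hb hc hd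
  have bring : ∀ a b c d x, (x = a ∨ x = b ∨ x = c ∨ x = d) → ∃ p q r,
      R (a, b, c, d) (x, p, q, r) ∧ ∀ y, y ≠ x → (y = a ∨ y = b ∨ y = c ∨ y = d) →
        (y = p ∨ y = q ∨ y = r) := by
    rintro a b c d x (rfl | rfl | rfl | rfl)
    · exact ⟨b, c, d, e0 _, by grind⟩
    · exact ⟨a, c, d, e1 _ _ _ _, by grind⟩
    · exact ⟨a, b, d, tr (e2 _ _ _ _) (e1 _ _ _ _), by grind⟩
    · exact ⟨a, b, c, tr (e3 _ _ _ _) (tr (e2 _ _ _ _) (e1 _ _ _ _)), by grind⟩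
  obtain ⟨p, q, r, hx, hy⟩ := bring a' b' c' d' a ha
  refine tr hx (?_ : R _ (a, b, c, d))
  have hb := hy b h1.symm hb
  have hc := hy c h2.symm hc
  have hd := hy d h3.symm hd
  rcases hb with rfl | rfl | rfl <;> rcases hc with rfl | rfl | rfl <;>
    rcases hd with rfl | rfl | rfl <;>
    first
      | exact absurd rfl h4
      | exact absurd rfl h5
      | exact absurd rfl h6
      | exact e0 _
      | exact e3 _ _ _ _
      | exact e2 _ _ _ _
      | exact tr (e2 _ _ _ _) (e3 _ _ _ _)
      | exact tr (e3 _ _ _ _) (e2 _ _ _ _)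
      | exact tr (e2 _ _ _ _) (tr (e3 _ _ _ _) (e2 _ _ _ _))

lemma exists_sign₃ {a b c a' b' c' : Ω} (h1 : a ≠ b) (h2 : a ≠ c) (h3 : b ≠ c)
    (h' : ({a', b', c'} : Finset Ω) = {a, b, c}) :
    ∃ s : ℤ, (s = 1 ∨ s = -1) ∧ ∀ X : Ω → Ω → Ω → ℤ, IsAlt₃ X → X a' b' c' = s * X a b c := by
  have ha : a ∈ ({a', b', c'} : Finset Ω) := by rw [h']; simp
  have hb : b ∈ ({a', b', c'} : Finset Ω) := by rw [h']; simp
  have hc : c ∈ ({a', b', c'} : Finset Ω) := by rw [h']; simp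
  simp only [mem_insert, mem_singleton] at ha hb hc
  rcases ha with rfl | rfl | rfl <;> rcases hb with rfl | rfl | rfl <;>
    rcases hc with rfl | rfl | rfl <;>
    first
      | exact absurd rfl h1
      | exact absurd rfl h2
      | exact absurd rfl h3
      | (refine ⟨1, by simp, fun X hX => ?_⟩; rw [one_mul]; done)
      | (refine ⟨-1, by simp, fun X hX => ?_⟩; rw [neg_one_mul]; exact hX.swap_left _ _ _)
      | (refine ⟨-1, by simp, fun X hX => ?_⟩; rw [neg_one_mul]; exact hX.swap_right _ _ _)
      | (refine ⟨-1, by simp, fun X hX => ?_⟩; rw [neg_one_mul]; exact hX.swap_out _ _ _)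
      | (refine ⟨1, by simp, fun X hX => ?_⟩; rw [one_mul]; exact hX.rot _ _ _)
      | (refine ⟨1, by simp, fun X hX => ?_⟩; rw [one_mul]; exact hX.rot' _ _ _)

lemma IsAlt₄.abs_eq {M : Ω → Ω → Ω → Ω → ℤ} (hM : IsAlt₄ M) {a b c d a' b' c' d' : Ω}
    (h : Dist₄ a b c d) (h' : ({a', b', c', d'} : Finset Ω) = {a, b, c, d}) :
    |M a' b' c' d'| = |M a b c d| := by
  obtain ⟨s, hs, h⟩ := exists_sign₄ h h'
  rw [h M hM]
  rcases hs with rfl | rfl <;> simp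

lemma IsAlt₄.ne_zero {M : Ω → Ω → Ω → Ω → ℤ} (hM : IsAlt₄ M) {a b c d a' b' c' d' : Ω}
    (h : M a b c d ≠ 0) (h' : ({a', b', c', d'} : Finset Ω) = {a, b, c, d}) :
    M a' b' c' d' ≠ 0 := by
  have := hM.abs_eq (hM.dist h) h'
  intro h0
  rw [h0, abs_zero] at this
  exact h (abs_eq_zero.mp this.symm)

lemma IsAlt₃.abs_eq {X : Ω → Ω → Ω → ℤ} (hX : IsAlt₃ X) {a b c a' b' c' : Ω}
    (h1 : a ≠ b) (h2 : a ≠ c) (h3 : b ≠ c)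
    (h' : ({a', b', c'} : Finset Ω) = {a, b, c}) : |X a' b' c'| = |X a b c| := by
  obtain ⟨s, hs, h⟩ := exists_sign₃ h1 h2 h3 h'
  rw [h X hX]
  rcases hs with rfl | rfl <;> simp

lemma IsAlt₃.ne_zero {X : Ω → Ω → Ω → ℤ} (hX : IsAlt₃ X) {a b c a' b' c' : Ω}
    (h : X a b c ≠ 0) (h' : ({a', b', c'} : Finset Ω) = {a, b, c}) : X a' b' c' ≠ 0 := by
  have hd := hX.dist h
  have := hX.abs_eq hd.1 hd.2.1 hd.2.2 h'
  intro h0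
  rw [h0, abs_zero] at this
  exact h (abs_eq_zero.mp this.symm)

end Sign

section Cone

variable [DecidableEq Ω]

/-- The cone over a `2`-chain. -/
def cone₄ (v : Ω) (X : Ω → Ω → Ω → ℤ) (x y z w : Ω) : ℤ :=
  (if x = v then X y z w else 0) - (if y = v then X x z w else 0) +
    (if z = v then X x y w else 0) - (if w = v then X x y z else 0)

/-- The cone over a `1`-chain. -/
def cone₃ (v : Ω) (Z : Ω → Ω → ℤ) (x y z : Ω) : ℤ :=
  (if x = v then Z y z else 0) - (if y = v then Z x z else 0) + (if z = v then Z x y else 0)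

/-- The oriented edge `[c, d]`. -/
def seg (c d x y : Ω) : ℤ :=
  (if x = c ∧ y = d then 1 else 0) - (if x = d ∧ y = c then 1 else 0)

/-- The oriented triangle `[b, c, d]`. -/
def tri (b c d : Ω) : Ω → Ω → Ω → ℤ := cone₃ b (seg c d)

/-- The oriented tetrahedron `[a, b, c, d]`. -/
def tet (a b c d : Ω) : Ω → Ω → Ω → Ω → ℤ := cone₄ a (tri b c d)

lemma IsAlt₃.cone {X : Ω → Ω → Ω → ℤ} (hX : IsAlt₃ X) (v : Ω) : IsAlt₄ (cone₄ v X) := by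
  refine ⟨fun a b c d => ?_, fun a b c d => ?_, fun a b c d => ?_⟩
  · simp only [cone₄, hX.swap_left a b c, hX.swap_left a b d]; split_ifs <;> ring
  · simp only [cone₄, hX.swap_left b c d, hX.swap_right a b c]; split_ifs <;> ring
  · simp only [cone₄, hX.swap_right b c d, hX.swap_right a c d]; split_ifs <;> ring

lemma isAlt₃_cone {Z : Ω → Ω → ℤ} (hZ : ∀ a b, Z b a = - Z a b) (v : Ω) :
    IsAlt₃ (cone₃ v Z) := by
  refine ⟨fun a b c => ?_, fun a b c => ?_⟩
  · simp only [cone₃, hZ a b]; split_ifs <;> ring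
  · simp only [cone₃, hZ b c]; split_ifs <;> ring

lemma seg_swap (c d a b : Ω) : seg c d b a = - seg c d a b := by
  simp only [seg]; split_ifs <;> grind

lemma isAlt₃_tri (b c d : Ω) : IsAlt₃ (tri b c d) := isAlt₃_cone (seg_swap c d) b

lemma isAlt₄_tet (a b c d : Ω) : IsAlt₄ (tet a b c d) := (isAlt₃_tri b c d).cone a

lemma tri_self {a b c : Ω} (h1 : a ≠ b) (h2 : a ≠ c) (h3 : b ≠ c) : tri a b c a b c = 1 := by
  simp [tri, cone₃, seg, h1.symm, h2.symm, h3]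

lemma tet_self {a b c d : Ω} (h : Dist₄ a b c d) : tet a b c d a b c d = 1 := by
  obtain ⟨h1, h2, h3, h4, h5, h6⟩ := h
  simp [tet, cone₄, h1.symm, h2.symm, h3.symm, tri_self h4 h5 h6]

lemma seg_support {c d x y : Ω} (h : seg c d x y ≠ 0) : (x = c ∧ y = d) ∨ (x = d ∧ y = c) := by
  simp only [seg] at h; grind

lemma tri_support {a b c x y z : Ω} (h : tri a b c x y z ≠ 0) :
    ({x, y, z} : Finset Ω) = {a, b, c} := by
  have : (x = a ∧ seg b c y z ≠ 0) ∨ (y = a ∧ seg b c x z ≠ 0) ∨ (z = a ∧ seg b c x y ≠ 0) := by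
    simp only [tri, cone₃] at h; grind
  clear h
  rcases this with ⟨rfl, h⟩ | ⟨rfl, h⟩ | ⟨rfl, h⟩ <;>
    rcases seg_support h with ⟨rfl, rfl⟩ | ⟨rfl, rfl⟩ <;> ext u <;> simp <;> tauto

lemma tet_support {a b c d x y z w : Ω} (h : tet a b c d x y z w ≠ 0) :
    ({x, y, z, w} : Finset Ω) = {a, b, c, d} := by
  have : (x = a ∧ tri b c d y z w ≠ 0) ∨ (y = a ∧ tri b c d x z w ≠ 0) ∨
      (z = a ∧ tri b c d x y w ≠ 0) ∨ (w = a ∧ tri b c d x y z ≠ 0) := by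
    simp only [tet, cone₄] at h; grind
  clear h
  rcases this with ⟨rfl, h⟩ | ⟨rfl, h⟩ | ⟨rfl, h⟩ | ⟨rfl, h⟩ <;> rw [← tri_support h] <;>
    ext u <;> simp <;> tauto

/-- Comparison with the oriented tetrahedron: on its vertices an alternating function is a
multiple of it. -/
lemma IsAlt₄.eq_mul_tet {M : Ω → Ω → Ω → Ω → ℤ} (hM : IsAlt₄ M) {a b c d x y z w : Ω}
    (h : Dist₄ a b c d) (h' : ({x, y, z, w} : Finset Ω) = {a, b, c, d}) :
    M x y z w = tet a b c d x y z w * M a b c d := by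
  obtain ⟨s, -, hs⟩ := exists_sign₄ h h'
  rw [hs M hM, hs _ (isAlt₄_tet a b c d), tet_self h, mul_one]

lemma abs_tet {a b c d x y z w : Ω} (h : Dist₄ a b c d)
    (h' : ({x, y, z, w} : Finset Ω) = {a, b, c, d}) : |tet a b c d x y z w| = 1 := by
  rw [(isAlt₄_tet a b c d).abs_eq h h', tet_self h, abs_one]

lemma abs_tri {a b c x y z : Ω} (h1 : a ≠ b) (h2 : a ≠ c) (h3 : b ≠ c)
    (h' : ({x, y, z} : Finset Ω) = {a, b, c}) : |tri a b c x y z| = 1 := by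
  rw [(isAlt₃_tri a b c).abs_eq h1 h2 h3 h', tri_self h1 h2 h3, abs_one]

/-- An oriented tetrahedron occurring in `M` is a part of `M`. -/
lemma isPart_tet {M : Ω → Ω → Ω → Ω → ℤ} (hM : IsAlt₄ M) {a b c d : Ω} {ε : ℤ}
    (hε : ε = 1 ∨ ε = -1) (h : 1 ≤ ε * M a b c d) : IsPart (ε • tet a b c d) M := by
  intro x y z w
  have h0 : M a b c d ≠ 0 := by intro h0; simp [h0] at h
  have hd := hM.dist h0
  by_cases ht : tet a b c d x y z w = 0
  · simp [ht]
  · have h' := tet_support ht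
    have h1 := hM.eq_mul_tet hd h'
    have h2 := abs_tet hd h'
    simp only [Pi.smul_apply, smul_eq_mul]
    rw [h1]
    rcases abs_eq (zero_le_one) |>.mp h2 with h2 | h2 <;> rcases hε with rfl | rfl <;>
      rw [h2] <;> simp only [abs_eq_max_neg] <;> omega

lemma cone₃_add (v : Ω) (Z W : Ω → Ω → ℤ) : cone₃ v (Z + W) = cone₃ v Z + cone₃ v W := by
  funext x y z
  simp only [cone₃, Pi.add_apply]; split_ifs <;> ring

lemma cone₃_sub (v : Ω) (Z W : Ω → Ω → ℤ) : cone₃ v (Z - W) = cone₃ v Z - cone₃ v W := by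
  funext x y z
  simp only [cone₃, Pi.sub_apply]; split_ifs <;> ring

variable [Fintype Ω]

lemma bd₃_cone (v : Ω) (X : Ω → Ω → Ω → ℤ) : bd₃ (cone₄ v X) = X - cone₃ v (bd₂ X) := by
  funext a b c
  simp only [bd₃, cone₄, cone₃, bd₂, sum_sub_distrib, sum_add_distrib, Pi.sub_apply]
  have h : ∀ (p : Prop) [Decidable p] (f : Ω → ℤ),
      (∑ w, if p then f w else 0) = if p then ∑ w, f w else 0 := by
    intro p _ f; split_ifs <;> simp
  simp only [h, Finset.sum_ite_eq', mem_univ, if_true]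
  ring

lemma bd₂_tri (a b c : Ω) : bd₂ (tri a b c) = seg b c - seg a c + seg a b := by
  funext x y
  simp only [bd₂, tri, cone₃, sum_sub_distrib, sum_add_distrib, Pi.sub_apply, Pi.add_apply]
  simp only [Finset.sum_ite_eq', mem_univ, if_true]
  have h1 : ∀ y, ∑ w, seg b c w y = (if y = c then 1 else 0) - (if y = b then 1 else 0) := by
    intro y
    simp only [seg, sum_sub_distrib]
    have e : ∀ u v : Ω, (∑ w, if w = u ∧ y = v then (1 : ℤ) else 0) = if y = v then 1 else 0 := by
      intro u v
      by_cases hy : y = v <;> simp [hy]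
    rw [e, e]
  have h : ∀ (p : Prop) [Decidable p] (f : Ω → ℤ),
      (∑ w, if p then f w else 0) = if p then ∑ w, f w else 0 := by
    intro p _ f; split_ifs <;> simp
  have hs : ∀ c d x y : Ω, seg c d x y =
      (if x = c then 1 else 0) * (if y = d then 1 else 0) -
        (if x = d then 1 else 0) * (if y = c then 1 else 0) := by
    intro c d x y
    simp only [seg, ite_and, ite_mul, one_mul, zero_mul]
  have hm : ∀ (p : Prop) [Decidable p] (m : ℤ), (if p then m else 0) = (if p then 1 else 0) * m := by
    intro p _ m; split_ifs <;> simp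
  rw [h, h, h1, h1, hm (x = a), hm (y = a), hs, hs, hs]
  ring

lemma bd₃_tet (a b c d : Ω) :
    bd₃ (tet a b c d) = tri b c d - tri a c d + tri a b d - tri a b c := by
  rw [tet, bd₃_cone, bd₂_tri, cone₃_add, cone₃_sub]
  simp only [tri]
  abel

/-- Coning from a vertex bounds the norm of a taut filling. -/
lemma Taut.nrm_le_cone {M : Ω → Ω → Ω → Ω → ℤ} (hM : Taut M) (hMa : IsAlt₄ M) (v : Ω) :
    nrm M ≤ 4 * ∑ x, ∑ y, ∑ z,
      if x ≠ v ∧ y ≠ v ∧ z ≠ v then |bd₃ M x y z| else 0 := by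
  have hX := hMa.bd
  set X := bd₃ M
  have hb : bd₃ (cone₄ v X) = X := by
    rw [bd₃_cone, hMa.bd₂_bd₃]
    funext x y z
    simp [cone₃]
  refine (hM _ (hX.cone v) hb).trans ?_
  set k : Ω → Ω → Ω → ℤ := fun x y z => if x ≠ v ∧ y ≠ v ∧ z ≠ v then |X x y z| else 0 with hk
  have hk0 : ∀ x y z, 0 ≤ k x y z := fun x y z => by simp only [hk]; split_ifs <;> simp
  -- Only faces missing `v` survive in the cone: if `v` occurs twice among the entries, the terms
  -- cancel by alternation. The four possible positions of `v` account for the factor `4`.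
  have hpt : ∀ x y z w, |cone₄ v X x y z w| ≤ (if x = v then k y z w else 0) +
      (if y = v then k x z w else 0) + (if z = v then k x y w else 0) +
      (if w = v then k x y z else 0) := by
    intro x y z w
    have l := hX.self_left v
    have r := fun a => hX.self_right a v
    have o := hX.self_out v
    by_cases h1 : x = v <;> by_cases h2 : y = v <;> by_cases h3 : z = v <;> by_cases h4 : w = v <;>
      simp [cone₄, hk, h1, h2, h3, h4, l, r, o]
    · rw [hX.swap_left v y w, neg_add_cancel]
    · rw [hX.rot v y z, sub_self]
    · rw [hX.swap_right x z v]; ring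
  calc nrm (cone₄ v X) ≤ ∑ x, ∑ y, ∑ z, ∑ w, ((if x = v then k y z w else 0) +
      (if y = v then k x z w else 0) + (if z = v then k x y w else 0) +
      (if w = v then k x y z else 0)) := sum_le_sum fun x _ => sum_le_sum fun y _ =>
        sum_le_sum fun z _ => sum_le_sum fun w _ => hpt x y z w
    _ = 4 * ∑ x, ∑ y, ∑ z, k x y z := by
      have h : ∀ (p : Prop) [Decidable p] (f : Ω → ℤ),
          (∑ w, if p then f w else 0) = if p then ∑ w, f w else 0 := by
        intro p _ f; split_ifs <;> simp
      simp only [sum_add_distrib, h, Finset.sum_ite_eq', mem_univ, if_true]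
      ring

end Cone

end TautFilling

/-! ### Splitting a taut filling along a triangle -/

namespace TautFilling

open Finset

variable {Ω : Type*}


/-- With only three vertices available, an edge lies on at most one triangle, so the cycle condition
at that edge is the vanishing of a single coefficient. -/
lemma IsAlt₃.eq_zero_of_three [Fintype Ω] {X : Ω → Ω → Ω → ℤ} (hX : IsAlt₃ X) (hb : bd₂ X = 0) {p q t : Ω}
    (h : ∀ a b c, X a b c ≠ 0 → (a = p ∨ a = q ∨ a = t) ∧ (b = p ∨ b = q ∨ b = t) ∧
      (c = p ∨ c = q ∨ c = t)) : X = 0 := by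
  funext a b c
  by_contra h0
  change X a b c ≠ 0 at h0
  have hd := hX.dist h0
  have h1 : bd₂ X b c = 0 := by rw [hb]; rfl
  have h2 : bd₂ X b c = X a b c := by
    refine Finset.sum_eq_single a (fun w _ hw => ?_) (by simp)
    by_contra h3
    have hd' := hX.dist h3
    have e1 := h _ _ _ h0
    have e2 := h _ _ _ h3
    grind
  exact h0 (h2.symm.trans h1)

/-- Here `r` retracts onto one side and sends the rest to `P`, while `s` retracts onto the other and
sends the rest to `P'`. If both are injective on the four vertices, at most one vertex is strictly
on each side. The remaining vertices are in the overlap, must avoid `P` when a vertex is sent there,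
and must avoid `P'` likewise; the overlap of at most three points is too small for this. -/
lemma not_dist₄_of_retract {p q t P P' x y z w : Ω} (hPP : P ≠ P')
    (hP : P = p ∨ P = q ∨ P = t) (hP' : P' = p ∨ P' = q ∨ P' = t) {r s : Ω → Ω}
    (c : ∀ x, (r x = x ∧ s x = P') ∨ (r x = P ∧ s x = x) ∨
      ((x = p ∨ x = q ∨ x = t) ∧ r x = x ∧ s x = x))
    (hr : Dist₄ (r x) (r y) (r z) (r w)) (hs : Dist₄ (s x) (s y) (s z) (s w)) : False := by
  obtain ⟨r1, r2, r3, r4, r5, r6⟩ := hr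
  obtain ⟨s1, s2, s3, s4, s5, s6⟩ := hs
  have c1 := c x
  have c2 := c y
  have c3 := c z
  have c4 := c w
  clear c
  generalize r x = rx at *
  generalize r y = ry at *
  generalize r z = rz at *
  generalize r w = rw at *
  generalize s x = sx at *
  generalize s y = sy at *
  generalize s z = sz at *
  generalize s w = sw at *
  rcases c1 with ⟨rfl, rfl⟩ | ⟨rfl, rfl⟩ | ⟨c1, rfl, rfl⟩ <;>
  rcases c2 with ⟨rfl, h2⟩ | ⟨h2, rfl⟩ | ⟨c2, rfl, rfl⟩ <;>
  try (first | exact absurd h2.symm s1 | exact absurd h2.symm r1)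
  all_goals
  rcases c3 with ⟨rfl, h3⟩ | ⟨h3, rfl⟩ | ⟨c3, rfl, rfl⟩ <;>
  rcases c4 with ⟨rfl, h4⟩ | ⟨h4, rfl⟩ | ⟨c4, rfl, rfl⟩ <;>
  grind (splits := 20)
/-- A taut filling of a sum of two cycles whose vertex sets overlap in three vertices splits. -/
theorem Taut.splits [Fintype Ω] [DecidableEq Ω] {M : Ω → Ω → Ω → Ω → ℤ} (hT : Taut M) (hM : IsAlt₄ M)
    {Y Z : Ω → Ω → Ω → ℤ} (hY : IsAlt₃ Y) (hZ : IsAlt₃ Z) (hYb : bd₂ Y = 0) (hZb : bd₂ Z = 0)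
    (hMYZ : bd₃ M = Y + Z) {A B : Ω → Prop} (hAB : ∀ x, A x ∨ B x) {p q t : Ω}
    (hpq : p ≠ q) (hs : ∀ x, (A x ∧ B x) ↔ (x = p ∨ x = q ∨ x = t))
    (hYA : ∀ a b c, Y a b c ≠ 0 → A a ∧ A b ∧ A c)
    (hZB : ∀ a b c, Z a b c ≠ 0 → B a ∧ B b ∧ B c) {a b c d : Ω} (h : M a b c d ≠ 0) :
    (A a ∧ A b ∧ A c ∧ A d) ∨ (B a ∧ B b ∧ B c ∧ B d) := by
  classical
  -- The two retracted copies of `M` fill `Y` and `Z`, so their sum competes with `M`. No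
  -- tetrahedron stays nondegenerate under both retractions; by tautness none may degenerate under
  -- both.
  have key : ∀ P P' : Ω, A P ∧ B P → A P' ∧ B P' → P ≠ P' → ∀ x y z w, M x y z w ≠ 0 →
      ∀ rA rB : Ω → Ω, rA = (fun x => if A x then x else P) → rB = (fun x => if B x then x else P') →
      Dist₄ (rA x) (rA y) (rA z) (rA w) ∨ Dist₄ (rB x) (rB y) (rB z) (rB w) := by
    intro P P' hP hP' hPP x y z w h0 rA rB hrA hrB
    by_contra hcon
    push Not at hcon
    have hA : ∀ x, A x → rA x = x := fun x hx => by simp [hrA, hx]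
    have hA' : ∀ x, ¬ A x → rA x = P := fun x hx => by simp [hrA, hx]
    have hB : ∀ x, B x → rB x = x := fun x hx => by simp [hrB, hx]
    have hB' : ∀ x, ¬ B x → rB x = P' := fun x hx => by simp [hrB, hx]
    have eA : bd₃ (push₄ rA M) = Y := by
      rw [bd₃_push, hMYZ, push₃_add, push₃_eq_self rA Y fun a b c h =>
        ⟨hA _ (hYA _ _ _ h).1, hA _ (hYA _ _ _ h).2.1, hA _ (hYA _ _ _ h).2.2⟩]
      -- The retraction throws all of `Z` into the overlap, where a `2`-cycle vanishes.
      have : push₃ rA Z = 0 := by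
        refine (hZ.push rA).eq_zero_of_three (bd₂_push _ _ hZb) (p := p) (q := q) (t := t) ?_
        intro a b c h
        obtain ⟨x, y, z, hx, rfl, rfl, rfl⟩ := push₃_support _ _ _ _ _ h
        obtain ⟨h1, h2, h3⟩ := hZB _ _ _ hx
        have : ∀ x, B x → (rA x = p ∨ rA x = q ∨ rA x = t) := by
          intro x hx
          by_cases hx' : A x
          · rw [hA x hx']; exact (hs x).1 ⟨hx', hx⟩
          · rw [hA' x hx']; exact (hs P).1 hP
        exact ⟨this _ h1, this _ h2, this _ h3⟩
      rw [this, add_zero]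
    have eB : bd₃ (push₄ rB M) = Z := by
      rw [bd₃_push, hMYZ, push₃_add, push₃_eq_self rB Z fun a b c h =>
        ⟨hB _ (hZB _ _ _ h).1, hB _ (hZB _ _ _ h).2.1, hB _ (hZB _ _ _ h).2.2⟩]
      have : push₃ rB Y = 0 := by
        refine (hY.push rB).eq_zero_of_three (bd₂_push _ _ hYb) (p := p) (q := q) (t := t) ?_
        intro a b c h
        obtain ⟨x, y, z, hx, rfl, rfl, rfl⟩ := push₃_support _ _ _ _ _ h
        obtain ⟨h1, h2, h3⟩ := hYA _ _ _ hx
        have : ∀ x, A x → (rB x = p ∨ rB x = q ∨ rB x = t) := by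
          intro x hx
          by_cases hx' : B x
          · rw [hB x hx']; exact (hs x).1 ⟨hx, hx'⟩
          · rw [hB' x hx']; exact (hs P').1 hP'
        exact ⟨this _ h1, this _ h2, this _ h3⟩
      rw [this, zero_add]
    have h1 := hT (push₄ rA M + push₄ rB M) ((hM.push _).add (hM.push _))
      (by rw [bd₃_add, eA, eB, hMYZ])
    have h2 := nrm_add_le (push₄ rA M) (push₄ rB M)
    have h3 := nrm_push_le hM rA
    have h4 := nrm_push_le hM rB
    have h5 : ∑ x, ∑ y, ∑ z, ∑ w,
        ((if Dist₄ (rA x) (rA y) (rA z) (rA w) then |M x y z w| else 0) +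
        (if Dist₄ (rB x) (rB y) (rB z) (rB w) then |M x y z w| else 0)) < nrm M := by
      refine sum_lt_sum₄ (a := x) (b := y) (c := z) (d := w) (fun x y z w => ?_) ?_
      · by_cases h0 : M x y z w = 0
        · simp [h0]
        have hd := hM.dist h0
        have : ¬ (Dist₄ (rA x) (rA y) (rA z) (rA w) ∧ Dist₄ (rB x) (rB y) (rB z) (rB w)) := by
          rintro ⟨k1, k2⟩
          refine not_dist₄_of_retract hPP ((hs P).1 hP) ((hs P').1 hP') (fun x => ?_) k1 k2
          by_cases hx : A x
          · by_cases hx' : B x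
            · exact Or.inr (Or.inr ⟨(hs x).1 ⟨hx, hx'⟩, hA x hx, hB x hx'⟩)
            · exact Or.inl ⟨hA x hx, hB' x hx'⟩
          · exact Or.inr (Or.inl ⟨hA' x hx, hB x ((hAB x).resolve_left hx)⟩)
        by_cases k1 : Dist₄ (rA x) (rA y) (rA z) (rA w)
        · rw [if_pos k1, if_neg (fun k2 => this ⟨k1, k2⟩), add_zero]
        · rw [if_neg k1, zero_add]
          split_ifs <;> simp
      · rw [if_neg hcon.1, if_neg hcon.2]
        simpa using h0
    simp only [sum_add_distrib] at h5
    omega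
  have hp := (hs p).2 (by simp)
  have hq := (hs q).2 (by simp)
  have ht := (hs t).2 (by simp)
  -- a mixed tetrahedron meets one side in a single vertex and misses the overlap
  have other : ∀ e, ∃ e', A e' ∧ B e' ∧ e' ≠ e := by
    intro e
    by_cases h : p = e
    · exact ⟨q, hq.1, hq.2, by rw [← h]; exact hpq.symm⟩
    · exact ⟨p, hp.1, hp.2, h⟩
  -- The points `P` and `P'` are chosen so that both retractions degenerate: one of them is `z`,
  -- onto which the vertex from one strict side falls, and the other is `w` if `w` is in the
  -- overlap, or any other overlap point onto which two vertices are collapsed together.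
  have mid : ∀ x y z w, M x y z w ≠ 0 → ¬ B x → ¬ A y → ¬ (A z ∧ B z) := by
    rintro x y z w h0 hx hy ⟨hz, hz'⟩
    have hx' := (hAB x).resolve_right hx
    have hy' := (hAB y).resolve_left hy
    have hd := hM.dist h0
    by_cases hw : A w
    · by_cases hw' : B w
      · rcases key z w ⟨hz, hz'⟩ ⟨hw, hw'⟩ hd.2.2.2.2.2 x y z w h0 _ _ rfl rfl with hk | hk <;>
          simp [Dist₄, hx, hx', hy, hy', hz, hz', hw, hw'] at hk
      · obtain ⟨e, he, he', hne⟩ := other z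
        rcases key z e ⟨hz, hz'⟩ ⟨he, he'⟩ hne.symm x y z w h0 _ _ rfl rfl with hk | hk <;>
          simp [Dist₄, hx, hx', hy, hy', hz, hz', hw, hw'] at hk
    · have hw' := (hAB w).resolve_left hw
      obtain ⟨e, he, he', hne⟩ := other z
      rcases key e z ⟨he, he'⟩ ⟨hz, hz'⟩ hne x y z w h0 _ _ rfl rfl with hk | hk <;>
          simp [Dist₄, hx, hx', hy, hy', hz, hz', hw, hw'] at hk
  have two : ∀ x y z w, M x y z w ≠ 0 → ¬ B x → ¬ A y → ¬ B z → A w → ¬ B w := by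
    intro x y z w h0 hx hy hz hw hw'
    exact mid x y w z (by rw [hM.swap_right]; simpa using h0) hx hy ⟨hw, hw'⟩
  -- Two vertices strictly on each side cannot occur, since each retraction would identify a pair.
  -- Mixed tetrahedra are therefore of type three plus one.
  have tt : ∀ x y z w, M x y z w ≠ 0 → ¬ B x → ¬ A y → ¬ B z → A w := by
    intro x y z w h0 hx hy hz
    by_contra hw
    have hx' := (hAB x).resolve_right hx
    have hy' := (hAB y).resolve_left hy
    have hz' := (hAB z).resolve_right hz
    have hw' := (hAB w).resolve_left hw
    rcases key p q hp hq hpq x y z w h0 _ _ rfl rfl with hk | hk <;>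
      simp [Dist₄, hx, hx', hy, hy', hz, hz', hw, hw'] at hk
  have tt' : ∀ x y z w, M x y z w ≠ 0 → ¬ B x → ¬ A y → ¬ A z → B w := by
    intro x y z w h0 hx hy hz
    by_contra hw
    exact hz (tt x y w z (by rw [hM.swap_right]; simpa using h0) hx hy hw)
  have two' : ∀ x y z w, M x y z w ≠ 0 → ¬ B x → ¬ A y → ¬ A z → ¬ A w := by
    intro x y z w h0 hx hy hz hw
    exact mid x y w z (by rw [hM.swap_right]; simpa using h0) hx hy ⟨hw, tt' x y z w h0 hx hy hz⟩
  have noX : ∀ x y z, ¬ B x → ¬ A y → bd₃ M y x z = 0 := by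
    intro x y z hx hy
    rw [hMYZ]
    have h1 : Y y x z = 0 := by by_contra h; exact hy (hYA _ _ _ h).1
    have h2 : Z y x z = 0 := by by_contra h; exact hx (hZB _ _ _ h).2.1
    simp [h1, h2]
  -- The tetrahedra joining `y` to three vertices outside `B` form a taut part of `M`. A face of its
  -- boundary at `y` would be a mixed face of `Y + Z`, and there are none. So `y` is interior to
  -- this part, which is impossible.
  have fin : ∀ x y z w, M x y z w ≠ 0 → ¬ B x → ¬ A y → ¬ B z → False := by
    intro x y z w h0 hx hy hz
    let S : Finset Ω → Prop := fun u => y ∈ u ∧ ∀ e ∈ u, e ≠ y → ¬ B e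
    have hN := hM.restr S
    have hTN := hT.of_isPart hM hN (isPart_restr S M)
    have hd := hM.dist h0
    have hb : ∀ u v, bd₃ (restr₄ S M) y u v = 0 := by
      intro u v
      by_cases huv : ¬ B u ∧ ¬ B v
      · have : bd₃ (restr₄ S M) y u v = bd₃ M y u v := by
          refine sum_congr rfl fun e _ => ?_
          simp only [restr₄]
          by_cases he : M e y u v = 0
          · simp [he]
          · rw [if_pos]
            have he' : M u y v e ≠ 0 := hM.ne_zero he (by ext; simp; grind)
            have h1 := two u y v e he' huv.1 hy huv.2 (tt u y v e he' huv.1 hy huv.2)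
            simp only [S, mem_insert, mem_singleton]
            refine ⟨by simp, ?_⟩
            rintro f (rfl | rfl | rfl | rfl) hf
            exacts [h1, absurd rfl hf, huv.1, huv.2]
        rw [this]
        exact noX _ _ _ huv.1 hy
      · refine sum_eq_zero fun e _ => ?_
        simp only [restr₄]
        by_cases hS : S {e, y, u, v}
        · rw [if_pos hS]
          by_contra he
          have hd := hM.dist he
          exact huv ⟨hS.2 u (by simp) hd.2.2.2.1.symm, hS.2 v (by simp) hd.2.2.2.2.1.symm⟩
        · rw [if_neg hS]
    have h1 := hTN.eq_zero_of_interior hN hb x z w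
    have hw := two x y z w h0 hx hy hz (tt x y z w h0 hx hy hz)
    have h2 : restr₄ S M y x z w = M y x z w := by
      simp only [restr₄]
      rw [if_pos]
      simp only [S, mem_insert, mem_singleton]
      refine ⟨by simp, ?_⟩
      rintro f (rfl | rfl | rfl | rfl) hf
      exacts [absurd rfl hf, hx, hz, hw]
    rw [h2, hM.swap_left] at h1
    exact h0 (neg_eq_zero.mp h1)
  have fin' : ∀ x y z w, M x y z w ≠ 0 → ¬ B x → ¬ A y → ¬ A z → False := by
    intro x y z w h0 hx hy hz
    let S : Finset Ω → Prop := fun u => x ∈ u ∧ ∀ e ∈ u, e ≠ x → ¬ A e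
    have hN := hM.restr S
    have hTN := hT.of_isPart hM hN (isPart_restr S M)
    have hd := hM.dist h0
    have hb : ∀ u v, bd₃ (restr₄ S M) x u v = 0 := by
      intro u v
      by_cases huv : ¬ A u ∧ ¬ A v
      · have : bd₃ (restr₄ S M) x u v = bd₃ M x u v := by
          refine sum_congr rfl fun e _ => ?_
          simp only [restr₄]
          by_cases he : M e x u v = 0
          · simp [he]
          · rw [if_pos]
            have he' : M x u v e ≠ 0 := hM.ne_zero he (by ext; simp; grind)
            have h1 := two' x u v e he' hx huv.1 huv.2
            simp only [S, mem_insert, mem_singleton]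
            refine ⟨by simp, ?_⟩
            rintro f (rfl | rfl | rfl | rfl) hf
            exacts [h1, absurd rfl hf, huv.1, huv.2]
        rw [this, hM.bd.swap_left, noX _ _ _ hx huv.1, neg_zero]
      · refine sum_eq_zero fun e _ => ?_
        simp only [restr₄]
        by_cases hS : S {e, x, u, v}
        · rw [if_pos hS]
          by_contra he
          have hd := hM.dist he
          exact huv ⟨hS.2 u (by simp) hd.2.2.2.1.symm, hS.2 v (by simp) hd.2.2.2.2.1.symm⟩
        · rw [if_neg hS]
    have h1 := hTN.eq_zero_of_interior hN hb y z w
    have hw := two' x y z w h0 hx hy hz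
    have h2 : restr₄ S M x y z w = M x y z w := by
      simp only [restr₄]
      rw [if_pos]
      simp only [S, mem_insert, mem_singleton]
      refine ⟨by simp, ?_⟩
      rintro f (rfl | rfl | rfl | rfl) hf
      exacts [absurd rfl hf, hy, hz, hw]
    rw [h2] at h1
    exact h0 h1
  have mixed : ∀ x y z w, M x y z w ≠ 0 → ¬ B x → ¬ A y → False := by
    intro x y z w h0 hx hy
    have hz := mid x y z w h0 hx hy
    by_cases hzB : B z
    · exact fin' x y z w h0 hx hy fun hzA => hz ⟨hzA, hzB⟩
    · exact fin x y z w h0 hx hy hzB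
  by_contra hcon
  have hall : ∀ x ∈ ({a, b, c, d} : Finset Ω), ∀ y ∈ ({a, b, c, d} : Finset Ω), ¬ B x → A y := by
    intro x hx y hy hBx
    by_contra hAy
    have hxy : x ≠ y := by
      rintro rfl
      rcases hAB x with h | h
      exacts [hAy h, hBx h]
    have hcard : ({a, b, c, d} : Finset Ω).card = 4 := by
      have hd := hM.dist h
      simp only [Dist₄] at hd
      rw [card_insert_of_notMem, card_insert_of_notMem, card_insert_of_notMem, card_singleton] <;>
        simp [hd]
    have : ((({a, b, c, d} : Finset Ω).erase x).erase y).card = 2 := by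
      rw [card_erase_of_mem (by simp [hy, hxy.symm] : y ∈ ({a, b, c, d} : Finset Ω).erase x),
        card_erase_of_mem hx, hcard]
    obtain ⟨z, w, hzw, he⟩ := card_eq_two.mp this
    have hset : ({x, y, z, w} : Finset Ω) = {a, b, c, d} := by
      rw [← insert_erase hx, ← insert_erase
        (by simp [hy, hxy.symm] : y ∈ ({a, b, c, d} : Finset Ω).erase x), he]
    exact mixed x y z w (hM.ne_zero h hset) hBx hAy
  have hB : ∀ y ∈ ({a, b, c, d} : Finset Ω), A y := by
    by_contra hA
    push Not at hA
    obtain ⟨y, hy, hAy⟩ := hA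
    have hx : ∀ x ∈ ({a, b, c, d} : Finset Ω), B x := fun x hx => by
      by_contra hBx
      exact hAy (hall x hx y hy hBx)
    exact hcon (Or.inr ⟨hx a (by simp), hx b (by simp), hx c (by simp), hx d (by simp)⟩)
  exact hcon (Or.inl ⟨hB a (by simp), hB b (by simp), hB c (by simp), hB d (by simp)⟩)

end TautFilling

/-! ### Combinatorial spheres, links and capped sides -/

namespace TautFilling

open Finset

variable {Ω : Type*}

/-- The coboundary of a `1`-cochain is alternating. -/
lemma isAlt₃_coboundary {g : Ω → Ω → ℤ} (hg : ∀ u v, g v u = - g u v) :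
    IsAlt₃ (fun u v t => g u v + g v t + g t u) := by
  refine ⟨fun a b c => ?_, fun a b c => ?_⟩
  · rw [hg a b, hg c a, hg b c]; ring
  · rw [hg c a, hg b c, hg a b]; ring

section Triples

variable [DecidableEq Ω]

lemma mem_of_triple_eq {u v w p q x : Ω} (h : ({u, v, w} : Finset Ω) = {p, q, x}) :
    (u = p ∨ u = q ∨ u = x) ∧ (v = p ∨ v = q ∨ v = x) ∧ (w = p ∨ w = q ∨ w = x) := by
  have hu : u ∈ ({p, q, x} : Finset Ω) := by rw [← h]; simp
  have hv : v ∈ ({p, q, x} : Finset Ω) := by rw [← h]; simp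
  have hw : w ∈ ({p, q, x} : Finset Ω) := by rw [← h]; simp
  simp only [mem_insert, mem_singleton] at hu hv hw
  exact ⟨hu, hv, hw⟩

lemma triple_eq_of_mem {u v w p q x : Ω} (h1 : u ≠ v) (h2 : u ≠ w) (h3 : v ≠ w)
    (h : (u = p ∨ u = q ∨ u = x) ∧ (v = p ∨ v = q ∨ v = x) ∧ (w = p ∨ w = q ∨ w = x)) :
    ({u, v, w} : Finset Ω) = {p, q, x} := by
  refine Finset.eq_of_subset_of_card_le ?_ ?_
  · intro y hy
    simp only [mem_insert, mem_singleton] at hy ⊢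
    rcases hy with rfl | rfl | rfl
    exacts [h.1, h.2.1, h.2.2]
  · rw [card_eq_three.mpr ⟨u, v, w, h1, h2, h3, rfl⟩]
    exact card_le_three

lemma triple_rot (x y z : Ω) : ({y, z, x} : Finset Ω) = {x, y, z} := by
  rw [pair_comm z x, insert_comm]

lemma triple_rot' (x y z : Ω) : ({z, x, y} : Finset Ω) = {x, y, z} := by
  rw [insert_comm, pair_comm z y]

lemma tri_swap_right (a b c : Ω) : tri a c b = - tri a b c := by
  have h : ∀ x y, seg c b x y = - seg b c x y := fun x y => by simp only [seg]; ring
  funext x y z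
  simp only [tri, cone₃, h, Pi.neg_apply]
  split_ifs <;> ring

end Triples

variable [Fintype Ω] [DecidableEq Ω]

/-- Oriented combinatorial `2`-spheres, described by the coefficient function of the fundamental
cycle: closed strongly connected surfaces with vanishing first cohomology. -/
structure IsSph (X : Ω → Ω → Ω → ℤ) : Prop where
  alt : IsAlt₃ X
  le_one : ∀ a b c, |X a b c| ≤ 1
  cycle : bd₂ X = 0
  two : ∀ a b c d e, X a b c ≠ 0 → X a b d ≠ 0 → X a b e ≠ 0 → c = d ∨ c = e ∨ d = e
  conn : ∀ S : Finset Ω → Prop, (∃ a b c, X a b c ≠ 0 ∧ S {a, b, c}) →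
    (∀ a b c d, X a b c ≠ 0 → X a b d ≠ 0 → S {a, b, c} → S {a, b, d}) →
    ∀ a b c, X a b c ≠ 0 → S {a, b, c}
  nonzero : ∃ a b c, X a b c ≠ 0
  cohom : ∀ g : Ω → Ω → ℤ, (∀ a b, g b a = - g a b) →
    (∀ a b c, X a b c ≠ 0 → g a b + g b c + g c a = 0) →
    ∃ h : Ω → ℤ, ∀ a b c, X a b c ≠ 0 → g a b = h b - h a

namespace IsSph

variable {X : Ω → Ω → Ω → ℤ}

lemma eq_or (hX : IsSph X) {a b c : Ω} (h : X a b c ≠ 0) : X a b c = 1 ∨ X a b c = -1 := by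
  have := hX.le_one a b c
  rw [abs_le] at this
  omega

lemma sum_right (hX : IsSph X) (a b : Ω) : ∑ w, X a b w = 0 := by
  have h : bd₂ X a b = 0 := by rw [hX.cycle]; rfl
  rw [← h]
  exact sum_congr rfl fun w _ => hX.alt.rot w a b

/-- The face on the other side of an edge. -/
lemma exists_other (hX : IsSph X) {a b c : Ω} (h : X a b c ≠ 0) :
    ∃ d, d ≠ c ∧ X a b d = - X a b c ∧ ∀ e, X a b e ≠ 0 → e = c ∨ e = d := by
  have hs := hX.sum_right a b
  have : ∃ d, d ≠ c ∧ X a b d ≠ 0 := by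
    by_contra hcon
    push Not at hcon
    rw [Finset.sum_eq_single c (fun d _ hd => hcon d hd) (by simp)] at hs
    exact h hs
  obtain ⟨d, hdc, hd⟩ := this
  have hall : ∀ e, X a b e ≠ 0 → e = c ∨ e = d := by
    intro e he
    rcases hX.two a b c d e h hd he with h | h | h
    exacts [absurd h.symm hdc, Or.inl h.symm, Or.inr h.symm]
  refine ⟨d, hdc, ?_, hall⟩
  rw [Finset.sum_eq_add c d hdc.symm (fun e _ he => ?_) (by simp) (by simp)] at hs
  · omega
  · by_contra h0
    rcases hall e h0 with h | h
    exacts [he.1 h, he.2 h]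

lemma eq_neg (hX : IsSph X) {a b c d : Ω} (hc : X a b c ≠ 0) (hd : X a b d ≠ 0) (hcd : c ≠ d) :
    X a b d = - X a b c := by
  obtain ⟨e, -, he, hall⟩ := hX.exists_other hc
  rcases hall d hd with h | h
  · exact absurd h.symm hcd
  · rw [h, he]

/-- The faces at a vertex are connected through edges at that vertex. -/
lemma link_conn (hX : IsSph X) {v : Ω} (S : Finset Ω → Prop)
    (hcl : ∀ a b c, X v a b ≠ 0 → X v a c ≠ 0 → S {v, a, b} → S {v, a, c})
    {a b : Ω} (hab : X v a b ≠ 0) (hS : S {v, a, b}) {c d : Ω} (hcd : X v c d ≠ 0) :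
    S {v, c, d} := by
  classical
  -- `T` is a union of components of the link of `v`. The cochain `g` below, equal to `1` on edges
  -- from `v` to `T` and to `0` on other edges, is a cocycle because link edges do not leave `T`,
  -- and hence has a potential `h`.
  let T : Ω → Prop := fun x => ∃ y, X v x y ≠ 0 ∧ S {v, x, y}
  have hTv : ¬ T v := by
    rintro ⟨y, hy, -⟩
    exact hy (hX.alt.self_left v y)
  have hsw : ∀ {x y}, X v x y ≠ 0 → X v y x ≠ 0 := fun {x y} h => by
    rw [hX.alt.swap_right]; simpa using h
  have hT : ∀ {x y}, X v x y ≠ 0 → T x → T y := by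
    rintro x y hxy ⟨z, hz, hSz⟩
    refine ⟨x, hsw hxy, ?_⟩
    rw [pair_comm]
    exact hcl x z y hz hxy hSz
  have hTi : ∀ {x y}, X v x y ≠ 0 → (T x ↔ T y) := fun h => ⟨hT h, hT (hsw h)⟩
  let g : Ω → Ω → ℤ := fun x y => (if x = v ∧ T y then 1 else 0) - (if y = v ∧ T x then 1 else 0)
  have hg : ∀ x y, g y x = - g x y := fun x y => by simp only [g]; ring
  have hg0 : ∀ {x y}, x ≠ v → y ≠ v → g x y = 0 := fun hx hy => by simp [g, hx, hy]
  have hgv : ∀ {x}, x ≠ v → g v x = if T x then 1 else 0 := fun hx => by simp [g, hx]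
  have hface : ∀ x y z, X x y z ≠ 0 → g x y + g y z + g z x = 0 := by
    intro x y z h
    have key : ∀ y z, X v y z ≠ 0 → g v y + g y z + g z v = 0 := by
      intro y z h
      have hd := hX.alt.dist h
      rw [hg v z, hg0 hd.1.symm hd.2.1.symm, hgv hd.1.symm, hgv hd.2.1.symm]
      simp only [hTi h]
      ring
    by_cases hx : x = v
    · subst hx; exact key y z h
    by_cases hy : y = v
    · subst hy
      have := key z x (by rw [hX.alt.rot]; exact h)
      linarith
    by_cases hz : z = v
    · subst hz
      have := key x y (by rw [hX.alt.rot']; exact h)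
      linarith
    rw [hg0 hx hy, hg0 hy hz, hg0 hz hx]; rfl
  obtain ⟨h, hh⟩ := hX.cohom g hg hface
  -- As `g` vanishes on edges avoiding `v`, the value `h v + 1` taken on `T` spreads through strong
  -- connectivity to all other vertices. Then `g` is `1` on every edge at `v`, so `T` is the whole
  -- link.
  have hU := hX.conn (fun f => ∀ x ∈ f, x ≠ v → h x = h v + 1) ?_ ?_ v c d hcd
  · have hd := hX.alt.dist hcd
    have h1 := hU c (by simp) hd.1.symm
    have h2 := hh v c d hcd
    rw [hgv hd.1.symm] at h2
    have hTc : T c := by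
      by_contra hTc
      rw [if_neg hTc] at h2
      omega
    obtain ⟨y, hy, hSy⟩ := hTc
    exact hcl c y d hy hcd hSy
  · refine ⟨v, a, b, hab, ?_⟩
    have hd := hX.alt.dist hab
    have hTa : T a := ⟨b, hab, hS⟩
    have hTb : T b := hT hab hTa
    have h1 := hh v a b hab
    have h2 := hh v b a (hsw hab)
    rw [hgv hd.1.symm, if_pos hTa] at h1
    rw [hgv hd.2.1.symm, if_pos hTb] at h2
    intro x hx hxv
    simp only [mem_insert, mem_singleton] at hx
    rcases hx with rfl | rfl | rfl
    · exact absurd rfl hxv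
    · omega
    · omega
  · intro x y z w h1 h2 hS u hu huv
    simp only [mem_insert, mem_singleton] at hu
    have hd := hX.alt.dist h2
    rcases hu with rfl | rfl | rfl
    · exact hS _ (by simp) huv
    · exact hS _ (by simp) huv
    · by_cases hx : x = v
      · have hy : y ≠ v := fun hy => hd.1 (hx.trans hy.symm)
        have h3 := hh y u x (by rw [hX.alt.rot]; exact h2)
        rw [hg0 hy huv] at h3
        have := hS y (by simp) hy
        omega
      · have h3 := hh x u y (by rw [hX.alt.swap_right]; simpa using h2)
        rw [hg0 hx huv] at h3
        have := hS x (by simp) hx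
        omega

/-- The indicator of an edge has coboundary the difference of the two adjacent faces. -/
lemma edge_coboundary (hX : IsSph X) {x y z w : Ω} (hz : X x y z ≠ 0) (hw : X x y w ≠ 0)
    (hzw : z ≠ w) {u v t : Ω} (h : X u v t ≠ 0) :
    - X x y z * (seg x y u v + seg x y v t + seg x y t u) =
      X u v t * ((if ({u, v, t} : Finset Ω) = {x, y, w} then 1 else 0) -
        (if ({u, v, t} : Finset Ω) = {x, y, z} then 1 else 0)) := by
  have hdz := hX.alt.dist hz
  have hdw := hX.alt.dist hw
  have hd := hX.alt.dist h
  have hne : ({x, y, z} : Finset Ω) ≠ {x, y, w} := by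
    intro he
    have := (mem_of_triple_eq he).2.2
    grind
  have hD := isAlt₃_coboundary (seg_swap x y)
  have hval : ∀ r, x ≠ r → y ≠ r → seg x y x y + seg x y y r + seg x y r x = 1 := by
    intro r h1 h2
    simp [seg, hdz.1, h1.symm, h2.symm]
  by_cases h1 : ({u, v, t} : Finset Ω) = {x, y, w}
  · obtain ⟨s, hs, hs'⟩ := exists_sign₃ hdw.1 hdw.2.1 hdw.2.2 h1
    have e1 := hs' _ hD
    rw [e1, hs' X hX.alt, hval w hdw.2.1 hdw.2.2, if_pos h1, h1, if_neg hne.symm,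
      hX.eq_neg hz hw hzw]
    ring
  by_cases h2 : ({u, v, t} : Finset Ω) = {x, y, z}
  · obtain ⟨s, hs, hs'⟩ := exists_sign₃ hdz.1 hdz.2.1 hdz.2.2 h2
    have e1 := hs' _ hD
    rw [e1, hs' X hX.alt, hval z hdz.2.1 hdz.2.2, if_pos h2, if_neg h1]
    ring
  rw [if_neg h1, if_neg h2]
  have key : ∀ u v t, X u v t ≠ 0 → ({u, v, t} : Finset Ω) ≠ {x, y, w} →
      ({u, v, t} : Finset Ω) ≠ {x, y, z} → seg x y u v = 0 := by
    intro u v t h h1 h2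
    by_contra h0
    rcases seg_support h0 with ⟨rfl, rfl⟩ | ⟨rfl, rfl⟩
    · rcases hX.two _ _ _ _ _ hz hw h with h' | h' | h'
      · exact hzw h'
      · exact h2 (by rw [h'])
      · exact h1 (by rw [h'])
    · rw [hX.alt.swap_left] at h
      rcases hX.two _ _ _ _ _ hz hw (neg_ne_zero.mp h) with h' | h' | h'
      · exact hzw h'
      · exact h2 (by rw [h', insert_comm])
      · exact h1 (by rw [h', insert_comm])
  rw [key u v t h h1 h2, key v t u (by rw [hX.alt.rot]; exact h) (by rw [triple_rot]; exact h1)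
    (by rw [triple_rot]; exact h2), key t u v (by rw [hX.alt.rot']; exact h) (by rw [triple_rot']; exact h1)
    (by rw [triple_rot']; exact h2)]
  ring

end IsSph

lemma bd₂_tri_ne_zero {a b c : Ω} (h1 : a ≠ b) (h2 : a ≠ c) (h3 : b ≠ c) {x y : Ω}
    (hx : x = a ∨ x = b ∨ x = c) (hy : y = a ∨ y = b ∨ y = c) (hxy : x ≠ y) :
    bd₂ (tri a b c) x y ≠ 0 := by
  rw [bd₂_tri]
  rcases hx with rfl | rfl | rfl <;> rcases hy with rfl | rfl | rfl <;>
    simp_all [seg, Ne.symm]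

set_option maxHeartbeats 800000 in
/-- The part of a sphere on one side of a triangle, closed up by that triangle. -/
theorem IsSph.side {X : Ω → Ω → Ω → ℤ} (hX : IsSph X) {a b c : Ω} (h1 : a ≠ b) (h2 : a ≠ c)
    (h3 : b ≠ c) (h0 : X a b c = 0) (S : Finset Ω → Prop) [DecidablePred S]
    (hcl : ∀ x y z w, X x y z ≠ 0 → X x y w ≠ 0 →
      ¬ ((x = a ∨ x = b ∨ x = c) ∧ (y = a ∨ y = b ∨ y = c)) → S {x, y, z} → S {x, y, w})
    (hb : bd₂ (restr₃ S X) = bd₂ (tri a b c)) (hS : ∃ x y z, X x y z ≠ 0 ∧ ¬ S {x, y, z}) :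
    IsSph (restr₃ S X - tri a b c) := by
  set Y := restr₃ S X with hYdef
  have hYa : IsAlt₃ Y := hX.alt.restr S
  have hYX : ∀ {x y z}, Y x y z ≠ 0 → X x y z ≠ 0 ∧ S {x, y, z} := by
    intro x y z h
    simp only [hYdef, restr₃] at h
    by_cases hs : S {x, y, z}
    · rw [if_pos hs] at h; exact ⟨h, hs⟩
    · rw [if_neg hs] at h; exact absurd rfl h
  have hXY : ∀ {x y z}, X x y z ≠ 0 → S {x, y, z} → Y x y z = X x y z := by
    intro x y z h hs
    simp only [hYdef, restr₃]
    rw [if_pos hs]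
  have hXabc : ∀ {x y z}, ({x, y, z} : Finset Ω) = {a, b, c} → X x y z = 0 := by
    intro x y z h
    have := hX.alt.abs_eq h1 h2 h3 h
    rwa [h0, abs_zero, abs_eq_zero] at this
  have hYabc : ∀ {x y z}, ({x, y, z} : Finset Ω) = {a, b, c} → Y x y z = 0 := by
    intro x y z h
    by_contra h'
    exact (hYX h').1 (hXabc h)
  have htri : ∀ {x y z}, ({x, y, z} : Finset Ω) ≠ {a, b, c} → tri a b c x y z = 0 := by
    intro x y z h
    by_contra h'
    exact h (tri_support h')
  have alt1 : IsAlt₃ (Y - tri a b c) := hYa.sub (isAlt₃_tri a b c)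
  have hcase : ∀ {x y z}, (Y - tri a b c) x y z ≠ 0 →
      Y x y z ≠ 0 ∨ ({x, y, z} : Finset Ω) = {a, b, c} := by
    intro x y z h
    by_cases he : ({x, y, z} : Finset Ω) = {a, b, c}
    · exact Or.inr he
    · left
      simpa [htri he] using h
  have hY1 : ∀ {x y z}, Y x y z ≠ 0 → (Y - tri a b c) x y z ≠ 0 := by
    intro x y z h
    have he : ({x, y, z} : Finset Ω) ≠ {a, b, c} := fun he => h (hYabc he)
    simpa [htri he] using h
  have habc : ∀ {x y z}, ({x, y, z} : Finset Ω) = {a, b, c} → (Y - tri a b c) x y z ≠ 0 := by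
    intro x y z he
    have := abs_tri h1 h2 h3 he
    simp only [Pi.sub_apply, hYabc he]
    intro h
    have : tri a b c x y z = 0 := by omega
    simp_all
  -- Two faces in `S` at an edge of the triangle would have opposite signs, and the boundary of the
  -- part would vanish there, unlike that of the triangle.
  have honly : ∀ {x y u u'}, x ≠ y → (x = a ∨ x = b ∨ x = c) → (y = a ∨ y = b ∨ y = c) →
      Y x y u ≠ 0 → Y x y u' ≠ 0 → u = u' := by
    intro x y u u' hxy hx hy hu hu'
    by_contra huu
    have hne := bd₂_tri_ne_zero h1 h2 h3 hx hy hxy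
    apply hne
    rw [← hb]
    have : bd₂ Y x y = ∑ w, Y x y w := sum_congr rfl fun w _ => (hYa.rot w x y).symm
    rw [this, Finset.sum_eq_add u u' huu (fun e _ he => ?_) (by simp) (by simp)]
    · rw [hXY (hYX hu).1 (hYX hu).2, hXY (hYX hu').1 (hYX hu').2,
        hX.eq_neg (hYX hu).1 (hYX hu').1 huu, add_neg_cancel]
    · by_contra hne
      rcases hX.two _ _ _ _ _ (hYX hu).1 (hYX hu').1 (hYX hne).1 with h | h | h
      exacts [huu h, he.1 h.symm, he.2 h.symm]
  have hex : ∀ {x y}, x ≠ y → (x = a ∨ x = b ∨ x = c) → (y = a ∨ y = b ∨ y = c) →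
      ∃ u, Y x y u ≠ 0 := by
    intro x y hxy hx hy
    have hne := bd₂_tri_ne_zero h1 h2 h3 hx hy hxy
    rw [← hb] at hne
    obtain ⟨u, -, hu⟩ := Finset.exists_ne_zero_of_sum_ne_zero hne
    exact ⟨u, by rw [hYa.rot u x y]; exact hu⟩
  refine ⟨alt1, ?_, ?_, ?_, ?_, ⟨a, b, c, habc rfl⟩, ?_⟩
  · intro x y z
    by_cases he : ({x, y, z} : Finset Ω) = {a, b, c}
    · simp [hYabc he, abs_tri h1 h2 h3 he]
    · simp only [Pi.sub_apply, htri he, sub_zero]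
      by_cases h : Y x y z = 0
      · simp [h]
      · rw [hXY (hYX h).1 (hYX h).2]; exact hX.le_one _ _ _
  · rw [bd₂_sub, hb, sub_self]
  · intro x y p q r hp hq hr
    have hdp := alt1.dist hp
    have hdq := alt1.dist hq
    have hdr := alt1.dist hr
    have third : ∀ {p q}, y ≠ p → x ≠ p → ({x, y, p} : Finset Ω) = {a, b, c} →
        ({x, y, q} : Finset Ω) = {a, b, c} → p = q := by
      intro p q hyp hxp h h'
      rw [← h'] at h
      have := (mem_of_triple_eq h).2.2
      grind
    have gam : ∀ {p}, ({x, y, p} : Finset Ω) = {a, b, c} →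
        (x = a ∨ x = b ∨ x = c) ∧ (y = a ∨ y = b ∨ y = c) := fun h =>
      ⟨(mem_of_triple_eq h).1, (mem_of_triple_eq h).2.1⟩
    rcases hcase hp with hp' | hp' <;> rcases hcase hq with hq' | hq' <;>
      rcases hcase hr with hr' | hr'
    · exact hX.two _ _ _ _ _ (hYX hp').1 (hYX hq').1 (hYX hr').1
    · exact Or.inl (honly hdp.1 (gam hr').1 (gam hr').2 hp' hq')
    · exact Or.inr (Or.inl (honly hdp.1 (gam hq').1 (gam hq').2 hp' hr'))
    · exact Or.inr (Or.inr (third hdq.2.2 hdq.2.1 hq' hr'))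
    · exact Or.inr (Or.inr (honly hdp.1 (gam hp').1 (gam hp').2 hq' hr'))
    · exact Or.inr (Or.inl (third hdp.2.2 hdp.2.1 hp' hr'))
    · exact Or.inl (third hdp.2.2 hdp.2.1 hp' hq')
    · exact Or.inl (third hdp.2.2 hdp.2.1 hp' hq')
  · intro T hT hTcl
    -- If `U` is closed under adjacency and misses the cap, then `U` together with `S` is closed
    -- under adjacency in all of `X`: leaving `S` requires crossing an edge of the triangle, where
    -- `U` would reach the cap. Strong connectivity of `X` would then put every face in `S`.
    have main : ∀ U : Finset Ω → Prop, (∀ x y z w, (Y - tri a b c) x y z ≠ 0 →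
        (Y - tri a b c) x y w ≠ 0 → U {x, y, z} → U {x, y, w}) → ¬ U {a, b, c} →
        ∀ x y z, (Y - tri a b c) x y z ≠ 0 → ¬ U {x, y, z} := by
      intro U hU hUabc x y z hxyz hUx
      rcases hcase hxyz with hy | he
      · obtain ⟨x', y', z', hx', hS'⟩ := hS
        have := hX.conn (fun f => U f ∧ S f) ⟨x, y, z, (hYX hy).1, hUx, (hYX hy).2⟩ ?_ x' y' z' hx'
        · exact hS' this.2
        · rintro p q r s hr hs ⟨hUr, hSr⟩
          have hYr : Y p q r ≠ 0 := by rw [hXY hr hSr]; exact hr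
          have hpq := (hX.alt.dist hr).1
          by_cases hg : (p = a ∨ p = b ∨ p = c) ∧ (q = a ∨ q = b ∨ q = c)
          · exfalso
            have : ∃ t, ({p, q, t} : Finset Ω) = {a, b, c} := by
              rcases hg.1 with rfl | rfl | rfl <;> rcases hg.2 with rfl | rfl | rfl <;>
                first
                  | exact absurd rfl hpq
                  | exact ⟨a, triple_eq_of_mem (by grind) (by grind) (by grind) (by grind)⟩
                  | exact ⟨b, triple_eq_of_mem (by grind) (by grind) (by grind) (by grind)⟩
                  | exact ⟨c, triple_eq_of_mem (by grind) (by grind) (by grind) (by grind)⟩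
            obtain ⟨t, ht⟩ := this
            exact hUabc (ht ▸ hU p q r t (hY1 hYr) (habc ht) hUr)
          · have hSs := hcl p q r s hr hs hg hSr
            refine ⟨hU p q r s (hY1 hYr) (hY1 ?_) hUr, hSs⟩
            rw [hXY hs hSs]; exact hs
      · exact hUabc (he ▸ hUx)
    by_cases hTabc : T {a, b, c}
    · intro x y z hxyz
      by_contra hn
      refine main (fun f => ¬ T f) (fun x y z w hz hw hz' hw' => hz' (hTcl x y w z hw hz hw'))
        (by simpa using hTabc) x y z hxyz hn
    · obtain ⟨x, y, z, hxyz, hTx⟩ := hT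
      exact absurd hTx (main T hTcl hTabc x y z hxyz)
  · intro g hg hgc
    classical
    -- `p` is a potential of `g` on the cap. Continuing `g` by the coboundary of `p` over the other
    -- side gives a cocycle on the whole sphere `X`.
    let p : Ω → ℤ := fun x => if x = b then g a b else if x = c then g a c else 0
    have hpa : p a = 0 := by simp [p, h1, h2]
    have hpb : p b = g a b := by simp [p]
    have hpc : p c = g a c := by simp [p, h3.symm]
    have hgp : ∀ {x y}, x ≠ y → (x = a ∨ x = b ∨ x = c) → (y = a ∨ y = b ∨ y = c) →
        g x y = p y - p x := by
      intro x y hxy hx hy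
      have e := hgc a b c (habc rfl)
      have e1 := hg a b
      have e2 := hg a c
      have e3 := hg b c
      rcases hx with rfl | rfl | rfl <;> rcases hy with rfl | rfl | rfl <;>
        first
          | exact absurd rfl hxy
          | (rw [hpa, hpb]; omega)
          | (rw [hpa, hpc]; omega)
          | (rw [hpb, hpc]; omega)
    let g' : Ω → Ω → ℤ := fun x y => if ∃ z, Y x y z ≠ 0 then g x y else p y - p x
    have hsw : ∀ x y, (∃ z, Y y x z ≠ 0) ↔ ∃ z, Y x y z ≠ 0 := by
      intro x y
      simp only [hYa.swap_left x y, neg_ne_zero]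
    have hg' : ∀ x y, g' y x = - g' x y := by
      intro x y
      simp only [g', hsw x y]
      split_ifs
      · exact hg x y
      · ring
    have hg'S : ∀ {x y z}, Y x y z ≠ 0 → g' x y = g x y := fun {x y z} h => if_pos ⟨z, h⟩
    have hface : ∀ x y z, X x y z ≠ 0 → g' x y + g' y z + g' z x = 0 := by
      intro x y z hxyz
      by_cases hs : S {x, y, z}
      · have hy : Y x y z ≠ 0 := by rw [hXY hxyz hs]; exact hxyz
        rw [hg'S hy, hg'S (x := y) (y := z) (z := x) (by rw [hYa.rot]; exact hy),
          hg'S (x := z) (y := x) (z := y) (by rw [hYa.rot']; exact hy)]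
        exact hgc x y z (hY1 hy)
      · have key : ∀ x y z, X x y z ≠ 0 → ¬ S {x, y, z} → g' x y = p y - p x := by
          intro x y z hxyz hs
          simp only [g']
          split_ifs with hw
          · obtain ⟨w, hw⟩ := hw
            by_cases hgam : (x = a ∨ x = b ∨ x = c) ∧ (y = a ∨ y = b ∨ y = c)
            · exact hgp (hX.alt.dist hxyz).1 hgam.1 hgam.2
            · exact absurd (hcl x y w z (hYX hw).1 hxyz hgam (hYX hw).2) hs
          · rfl
        rw [key x y z hxyz hs, key y z x (by rw [hX.alt.rot]; exact hxyz) (by rw [triple_rot]; exact hs),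
          key z x y (by rw [hX.alt.rot']; exact hxyz) (by rw [triple_rot']; exact hs)]
        ring
    obtain ⟨h, hh⟩ := hX.cohom g' hg' hface
    refine ⟨h, fun x y z hxyz => ?_⟩
    rcases hcase hxyz with hy | he
    · rw [← hg'S hy]; exact hh x y z (hYX hy).1
    · have hm := mem_of_triple_eq he
      obtain ⟨u, hu⟩ := hex (alt1.dist hxyz).1 hm.1 hm.2.1
      rw [← hg'S hu]; exact hh x y u (hYX hu).1

end TautFilling

/-! ### Separating triangles: a discrete Jordan curve theorem -/

namespace TautFilling

open Finset

variable {Ω : Type*} [DecidableEq Ω]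

lemma restr₃_add_not (S : Finset Ω → Prop) [DecidablePred S] (X : Ω → Ω → Ω → ℤ) :
    restr₃ S X + restr₃ (fun f => ¬ S f) X = X := by
  funext x y z
  simp only [restr₃, Pi.add_apply]
  split_ifs <;> simp

variable [Fintype Ω]

set_option maxHeartbeats 800000 in
/-- A triangle in a sphere which is not a face separates the sphere into two spheres. -/
theorem IsSph.split {X : Ω → Ω → Ω → ℤ} (hX : IsSph X) {a b c : Ω} (h0 : X a b c = 0)
    (hab : ∃ d, X a b d ≠ 0) (hbc : ∃ d, X b c d ≠ 0) (hca : ∃ d, X c a d ≠ 0) :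
    ∃ (X₁ X₂ : Ω → Ω → Ω → ℤ) (A B : Ω → Prop), IsSph X₁ ∧ IsSph X₂ ∧ X = X₁ + X₂ ∧
      (∀ x, A x ∨ B x) ∧ (∀ x, (A x ∧ B x) ↔ (x = a ∨ x = b ∨ x = c)) ∧
      (∀ x y z, X₁ x y z ≠ 0 → A x ∧ A y ∧ A z) ∧ (∀ x y z, X₂ x y z ≠ 0 → B x ∧ B y ∧ B z) ∧
      X₁ a b c ≠ 0 ∧ X₂ a b c ≠ 0 := by
  classical
  obtain ⟨d, d', hd, hd'⟩ : ∃ d d', X a b d = 1 ∧ X a b d' = -1 := by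
    obtain ⟨d, hd⟩ := hab
    obtain ⟨d', -, hd', -⟩ := hX.exists_other hd
    rcases hX.eq_or hd with h | h
    · exact ⟨d, d', h, by rw [hd', h]⟩
    · exact ⟨d', d, by rw [hd', h]; rfl, h⟩
  have hd0 : X a b d ≠ 0 := by rw [hd]; decide
  have hd0' : X a b d' ≠ 0 := by rw [hd']; decide
  have hdd : d ≠ d' := by rintro rfl; rw [hd] at hd'; exact absurd hd' (by decide)
  have h1 := (hX.alt.dist hd0).1
  obtain ⟨e, he⟩ := hbc
  obtain ⟨f, hf⟩ := hca
  have h3 := (hX.alt.dist he).1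
  have h2 := (hX.alt.dist hf).1.symm
  let G : Ω → Ω → Prop := fun x y => (x = a ∨ x = b ∨ x = c) ∧ (y = a ∨ y = b ∨ y = c)
  -- The faces on the side of `abd`. A path of faces not crossing the triangle yields such a `g`, by
  -- adding the indicators of the crossed edges; using cochains instead of paths is what makes
  -- non-membership provable.
  let S : Finset Ω → Prop := fun f => ∃ g : Ω → Ω → ℤ, (∀ u v, g v u = - g u v) ∧
    (∀ u v, G u v → g u v = 0) ∧ ∀ u v t, X u v t ≠ 0 → g u v + g v t + g t u =
      X u v t * ((if ({u, v, t} : Finset Ω) = f then 1 else 0) -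
        (if ({u, v, t} : Finset Ω) = {a, b, d} then 1 else 0))
  have hSd : S {a, b, d} := ⟨fun _ _ => 0, by simp, by simp, by simp⟩
  have hcl : ∀ x y z w, X x y z ≠ 0 → X x y w ≠ 0 → ¬ G x y → S {x, y, z} → S {x, y, w} := by
    rintro x y z w hz hw hG ⟨g, hg, hgG, hgδ⟩
    by_cases hzw : z = w
    · rw [← hzw]; exact ⟨g, hg, hgG, hgδ⟩
    refine ⟨fun u v => g u v - X x y z * seg x y u v, ?_, ?_, ?_⟩
    · intro u v
      simp only [hg u v, seg_swap x y u v]; ring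
    · intro u v huv
      have : seg x y u v = 0 := by
        by_contra hs
        rcases seg_support hs with ⟨rfl, rfl⟩ | ⟨rfl, rfl⟩
        exacts [hG huv, hG ⟨huv.2, huv.1⟩]
      simp [this, hgG u v huv]
    · intro u v t huvt
      have e1 := hgδ u v t huvt
      have e2 := hX.edge_coboundary hz hw hzw huvt
      simp only
      linear_combination e1 + e2
  -- A cochain leading from `abd` to `abd'` would be closed up by crossing `ab`, giving a cocycle.
  -- Its potential would sum to zero around the triangle `abc`, while the cocycle itself contributes
  -- exactly one crossing, at `ab`.
  have hSd' : ¬ S {a, b, d'} := by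
    rintro ⟨g, hg, hgG, hgδ⟩
    obtain ⟨h, hh⟩ := hX.cohom (fun u v => g u v - X a b d' * seg a b u v)
      (fun u v => by simp only [hg u v, seg_swap a b u v]; ring) (fun u v t huvt => by
        have e1 := hgδ u v t huvt
        have e2 := hX.edge_coboundary hd0' hd0 hdd.symm huvt
        linear_combination e1 + e2)
    have e1 := hh a b d hd0
    have e2 := hh b c e he
    have e3 := hh c a f hf
    rw [hgG a b ⟨by simp, by simp⟩, hd'] at e1
    rw [hgG b c ⟨by simp, by simp⟩, hd'] at e2
    rw [hgG c a ⟨by simp, by simp⟩, hd'] at e3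
    simp [seg, h1, h1.symm, h2.symm, h3.symm] at e1 e2 e3
    omega
  clear_value S
  have hcl' : ∀ x y z w, X x y z ≠ 0 → X x y w ≠ 0 → ¬ G x y → ¬ S {x, y, z} → ¬ S {x, y, w} :=
    fun x y z w hz hw hG hs hs' => hs (hcl x y w z hw hz hG hs')
  have hYa := hX.alt.restr S
  have hYsum : ∀ x y, bd₂ (restr₃ S X) x y = ∑ w, restr₃ S X x y w := fun x y =>
    sum_congr rfl fun w _ => (hYa.rot w x y).symm
  have hZanti : ∀ x y, bd₂ (restr₃ S X) y x = - bd₂ (restr₃ S X) x y := by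
    intro x y
    simp only [bd₂, ← Finset.sum_neg_distrib]
    exact sum_congr rfl fun w _ => hYa.swap_right w x y
  have hZ0 : ∀ x y, ¬ G x y → bd₂ (restr₃ S X) x y = 0 := by
    intro x y hG
    rw [hYsum]
    by_cases hex : ∃ z, X x y z ≠ 0 ∧ S {x, y, z}
    · obtain ⟨z, hz, hs⟩ := hex
      rw [← hX.sum_right x y]
      refine sum_congr rfl fun w _ => ?_
      by_cases hw : X x y w = 0
      · simp [restr₃, hw]
      · simp [restr₃, hcl x y z w hz hw hG hs]
    · refine sum_eq_zero fun w _ => ?_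
      simp only [restr₃, ite_eq_right_iff]
      intro hs
      by_contra hw
      exact hex ⟨w, hw, hs⟩
  have hZab : bd₂ (restr₃ S X) a b = 1 := by
    rw [hYsum, Finset.sum_eq_single d (fun w _ hw => ?_) (by simp)]
    · simp [restr₃, hSd, hd]
    · simp only [restr₃, ite_eq_right_iff]
      intro hs
      by_contra h
      rcases hX.two _ _ _ _ _ hd0 hd0' h with h' | h' | h'
      · exact hdd h'
      · exact hw h'.symm
      · rw [← h'] at hs; exact hSd' hs
  have hZself : ∀ x, bd₂ (restr₃ S X) x x = 0 := fun x => by have := hZanti x x; omega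
  -- The boundary of the side is a `1`-cycle supported on the three edges of the triangle, so its
  -- value on `ab` determines the other two.
  have hZsum : ∀ y, bd₂ (restr₃ S X) a y + bd₂ (restr₃ S X) b y + bd₂ (restr₃ S X) c y = 0 := by
    intro y
    rw [← hYa.sum_bd₂ y]
    have : ∑ x, bd₂ (restr₃ S X) x y = ∑ x ∈ {a, b, c}, bd₂ (restr₃ S X) x y := by
      symm
      refine Finset.sum_subset (subset_univ _) fun x _ hx => hZ0 x y fun hG => hx ?_
      simpa using hG.1
    rw [this, sum_insert (by simp [h1, h2]), sum_pair h3, add_assoc]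
  have hb : bd₂ (restr₃ S X) = bd₂ (tri a b c) := by
    have eb := hZsum b
    have ec := hZsum c
    rw [hZself] at eb ec
    have nba := hZanti a b
    have ncb := hZanti b c
    have nca := hZanti a c
    funext x y
    rw [bd₂_tri]
    by_cases hG : G x y
    · obtain ⟨hx, hy⟩ := hG
      rcases hx with rfl | rfl | rfl <;> rcases hy with rfl | rfl | rfl <;>
        simp [seg, h1, h1.symm, h2, h2.symm, h3, h3.symm, hZself] <;> omega
    · rw [hZ0 x y hG]
      simp only [G] at hG
      simp only [seg, Pi.add_apply, Pi.sub_apply]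
      grind
  have hb' : bd₂ (restr₃ (fun f => ¬ S f) X) = bd₂ (tri a c b) := by
    have h := congrArg bd₂ (restr₃_add_not S X)
    rw [bd₂_add, hX.cycle, hb] at h
    have : bd₂ (tri a c b) = - bd₂ (tri a b c) := by
      rw [tri_swap_right]; funext x y; simp [bd₂]
    rw [this]
    exact eq_neg_of_add_eq_zero_right h
  have S1 := hX.side h1 h2 h3 h0 S hcl hb ⟨a, b, d', hd0', hSd'⟩
  have S2 := hX.side h2 h1 h3.symm (by rw [hX.alt.swap_right, h0]; rfl) (fun f => ¬ S f)
    (fun x y z w hz hw hG => hcl' x y z w hz hw (by simp only [G]; tauto)) hb'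
    ⟨a, b, d, hd0, by simpa using hSd⟩
  have hout : ∀ {x y z}, x ≠ a → x ≠ b → x ≠ c → ∀ {p q r}, (p = a ∨ p = b ∨ p = c) →
      (q = a ∨ q = b ∨ q = c) → (r = a ∨ r = b ∨ r = c) → tri p q r x y z = 0 := by
    intro x y z ha hb hc p q r hp hq hr
    by_contra h
    have := (mem_of_triple_eq (tri_support h)).1
    rcases this with rfl | rfl | rfl
    · rcases hp with h | h | h; exacts [ha h, hb h, hc h]
    · rcases hq with h | h | h; exacts [ha h, hb h, hc h]
    · rcases hr with h | h | h; exacts [ha h, hb h, hc h]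
  -- A vertex off the triangle cannot be used by both sides, because the faces around it are
  -- connected by steps that do not cross the triangle.
  let B : Ω → Prop := fun x => (x = a ∨ x = b ∨ x = c) ∨
    ∃ y z, (restr₃ (fun f => ¬ S f) X - tri a c b) x y z ≠ 0
  let A : Ω → Prop := fun x => (x = a ∨ x = b ∨ x = c) ∨ ¬ B x
  have hA : ∀ x y z, (restr₃ S X - tri a b c) x y z ≠ 0 → A x := by
    intro x y z h
    by_cases hx : x = a ∨ x = b ∨ x = c
    · exact Or.inl hx
    · right
      have hx' := hx
      push Not at hx'
      obtain ⟨xa, xb, xc⟩ := hx'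
      rintro (hx' | ⟨y', z', h'⟩)
      · exact hx hx'
      · simp only [Pi.sub_apply, hout xa xb xc (Or.inl rfl) (Or.inr (Or.inl rfl))
          (Or.inr (Or.inr rfl)), sub_zero, restr₃] at h
        simp only [Pi.sub_apply, hout xa xb xc (Or.inl rfl) (Or.inr (Or.inr rfl))
          (Or.inr (Or.inl rfl)), sub_zero, restr₃] at h'
        have k1 : S {x, y, z} ∧ X x y z ≠ 0 := by
          by_cases hs : S {x, y, z}
          · rw [if_pos hs] at h; exact ⟨hs, h⟩
          · rw [if_neg hs] at h; exact absurd rfl h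
        have k2 : ¬ S {x, y', z'} ∧ X x y' z' ≠ 0 := by
          by_cases hs : ¬ S {x, y', z'}
          · rw [if_pos hs] at h'; exact ⟨hs, h'⟩
          · rw [if_neg hs] at h'; exact absurd rfl h'
        exact k2.1 (hX.link_conn S (fun p q r hq hr hs => hcl x p q r hq hr (fun hG => hx hG.1) hs)
          k1.2 k1.1 k2.2)
  refine ⟨_, _, A, B, S1, S2, ?_, ?_, ?_, ?_, ?_, ?_, ?_⟩
  · conv_lhs => rw [← restr₃_add_not S X]
    rw [tri_swap_right]
    abel
  · intro x
    by_cases h : B x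
    · exact Or.inr h
    · exact Or.inl (Or.inr h)
  · intro x
    constructor
    · rintro ⟨h | h, hB⟩
      exacts [h, absurd hB h]
    · intro h
      exact ⟨Or.inl h, Or.inl h⟩
  · intro x y z h
    exact ⟨hA x y z h, hA y z x (by rw [S1.alt.rot]; exact h),
      hA z x y (by rw [S1.alt.rot']; exact h)⟩
  · intro x y z h
    exact ⟨Or.inr ⟨y, z, h⟩, Or.inr ⟨z, x, by rw [S2.alt.rot]; exact h⟩,
      Or.inr ⟨x, y, by rw [S2.alt.rot']; exact h⟩⟩
  · simp [restr₃, h0, tri_self h1 h2 h3]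
  · rw [S2.alt.swap_right]
    have h0' : X a c b = 0 := by rw [hX.alt.swap_right, h0]; rfl
    simp [restr₃, h0', tri_self h2 h1 h3.symm]

end TautFilling

/-! ### Flipping an edge of a sphere -/

namespace TautFilling

open Finset

variable {Ω : Type*} [DecidableEq Ω] [Fintype Ω]

/-- The boundary of a tetrahedron is supported on its four faces. -/
lemma bd₃_tet_support {p q x y u v w : Ω} (h : bd₃ (tet y p q x) u v w ≠ 0) :
    ({u, v, w} : Finset Ω) = {p, q, x} ∨ ({u, v, w} : Finset Ω) = {p, q, y} ∨
      ({u, v, w} : Finset Ω) = {p, x, y} ∨ ({u, v, w} : Finset Ω) = {q, x, y} := by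
  by_contra hcon
  push Not at hcon
  obtain ⟨h1, h2, h3, h4⟩ := hcon
  apply h
  have e1 : tri p q x u v w = 0 := by by_contra h; exact h1 (tri_support h)
  have e2 : tri y q x u v w = 0 := by
    by_contra h; exact h4 ((tri_support h).trans (by rw [← triple_rot y q x]))
  have e3 : tri y p x u v w = 0 := by
    by_contra h; exact h3 ((tri_support h).trans (by rw [← triple_rot y p x]))
  have e4 : tri y p q u v w = 0 := by
    by_contra h; exact h2 ((tri_support h).trans (by rw [← triple_rot y p q]))
  rw [bd₃_tet]
  simp [e1, e2, e3, e4]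

/-- The signs at `pqx` and `pqy` are opposite, like those of adjacent faces in a sphere, so one
multiple of the boundary cancels both faces at once. -/
lemma bd₃_tet_values {p q x y : Ω} (hd : Dist₄ y p q x) :
    bd₃ (tet y p q x) p q x = 1 ∧ bd₃ (tet y p q x) p q y = -1 ∧
      bd₃ (tet y p q x) p x y = 1 ∧ bd₃ (tet y p q x) q x y = -1 := by
  obtain ⟨h1, h2, h3, h4, h5, h6⟩ := hd
  simp only [bd₃_tet, Pi.add_apply, Pi.sub_apply]
  have z : ∀ {a b c u v w : Ω} (e : Ω), (e = u ∨ e = v ∨ e = w) → e ≠ a → e ≠ b → e ≠ c →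
      tri a b c u v w = 0 := by
    intro a b c u v w e he ha hb hc
    by_contra h
    have := mem_of_triple_eq (tri_support h)
    grind
  have o1 : tri y q x q x y = 1 := by rw [(isAlt₃_tri y q x).rot, tri_self h2 h3 h6]
  have o2 : tri y p x p x y = 1 := by rw [(isAlt₃_tri y p x).rot, tri_self h1 h3 h5]
  have o3 : tri y p q p q y = 1 := by rw [(isAlt₃_tri y p q).rot, tri_self h1 h2 h4]
  refine ⟨?_, ?_, ?_, ?_⟩
  · rw [tri_self h4 h5 h6, z p, z q, z x] <;> simp [*, Ne.symm]
  · rw [o3, z y, z p, z q] <;> simp [*, Ne.symm]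
  · rw [o2, z y, z p, z x] <;> simp [*, Ne.symm]
  · rw [o1, z y, z q, z x] <;> simp [*, Ne.symm]

/-- The support of the result of flipping the edge `pq` to `xy`. -/
lemma IsSph.flip_support {X : Ω → Ω → Ω → ℤ} (hX : IsSph X) {p q x y : Ω}
    (hx : X p q x ≠ 0) (hy : X p q y ≠ 0) (hxy : x ≠ y) (hno : ∀ z, X x y z = 0) (u v w : Ω) :
    (X - X p q x • bd₃ (tet y p q x)) u v w ≠ 0 ↔
      (X u v w ≠ 0 ∧ ({u, v, w} : Finset Ω) ≠ {p, q, x} ∧ ({u, v, w} : Finset Ω) ≠ {p, q, y}) ∨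
      ({u, v, w} : Finset Ω) = {p, x, y} ∨ ({u, v, w} : Finset Ω) = {q, x, y} := by
  have hdx := hX.alt.dist hx
  have hdy := hX.alt.dist hy
  have hd : Dist₄ y p q x :=
    ⟨hdy.2.1.symm, hdy.2.2.symm, hxy.symm, hdx.1, hdx.2.1, hdx.2.2⟩
  have hneg := hX.eq_neg hx hy hxy
  obtain ⟨v1, v2, v3, v4⟩ := bd₃_tet_values hd
  have hBa : IsAlt₃ (bd₃ (tet y p q x)) := (isAlt₄_tet y p q x).bd
  have hX'a := hX.alt.sub (hBa.smul (X p q x))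
  have z1 : X p x y = 0 := by rw [← hX.alt.rot, hno]
  have z2 : X q x y = 0 := by rw [← hX.alt.rot, hno]
  have ne1 : ({p, x, y} : Finset Ω) ≠ {p, q, x} := fun h => by
    have := (mem_of_triple_eq h).2.2; have := hd.1; have := hd.2.1; have := hd.2.2.1; grind
  have ne2 : ({p, x, y} : Finset Ω) ≠ {p, q, y} := fun h => by
    have := (mem_of_triple_eq h).2.1; grind
  have ne3 : ({q, x, y} : Finset Ω) ≠ {p, q, x} := fun h => by
    have := (mem_of_triple_eq h).2.2; have := hd.1; have := hd.2.1; have := hd.2.2.1; grind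
  have ne4 : ({q, x, y} : Finset Ω) ≠ {p, q, y} := fun h => by
    have := (mem_of_triple_eq h).2.1; grind
  have ne5 : ({p, q, x} : Finset Ω) ≠ {p, x, y} := ne1.symm
  by_cases c1 : ({u, v, w} : Finset Ω) = {p, q, x}
  · obtain ⟨s, hs, hs'⟩ := exists_sign₃ hdx.1 hdx.2.1 hdx.2.2 c1
    rw [hs' _ hX'a, c1]
    simp [v1, ne1.symm, ne3.symm]
  by_cases c2 : ({u, v, w} : Finset Ω) = {p, q, y}
  · obtain ⟨s, hs, hs'⟩ := exists_sign₃ hdy.1 hdy.2.1 hdy.2.2 c2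
    rw [hs' _ hX'a, c2]
    simp [v2, ne2.symm, ne4.symm, hneg]
  by_cases c3 : ({u, v, w} : Finset Ω) = {p, x, y}
  · obtain ⟨s, hs, hs'⟩ := exists_sign₃ hdx.2.1 hdy.2.1 hxy c3
    rw [hs' _ hX'a, c3]
    have : s ≠ 0 := by rcases hs with rfl | rfl <;> decide
    simp [v3, z1, this, hx]
  by_cases c4 : ({u, v, w} : Finset Ω) = {q, x, y}
  · obtain ⟨s, hs, hs'⟩ := exists_sign₃ hdx.2.2 hdy.2.2 hxy c4
    rw [hs' _ hX'a, c4]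
    have : s ≠ 0 := by rcases hs with rfl | rfl <;> decide
    simp [v4, z2, this, hx]
  have : bd₃ (tet y p q x) u v w = 0 := by
    by_contra h
    rcases bd₃_tet_support h with h | h | h | h
    exacts [c1 h, c2 h, c3 h, c4 h]
  simp [this, c1, c2, c3, c4]

set_option maxHeartbeats 1000000 in
/-- Flipping an edge of a sphere gives a sphere, unless the new edge is already present. -/
theorem IsSph.flip {X : Ω → Ω → Ω → ℤ} (hX : IsSph X) {p q x y : Ω}
    (hx : X p q x ≠ 0) (hy : X p q y ≠ 0) (hxy : x ≠ y) (hno : ∀ z, X x y z = 0) :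
    IsSph (X - X p q x • bd₃ (tet y p q x)) := by
  have hsupp := hX.flip_support hx hy hxy hno
  have hdx := hX.alt.dist hx
  have hdy := hX.alt.dist hy
  have hd : Dist₄ y p q x :=
    ⟨hdy.2.1.symm, hdy.2.2.symm, hxy.symm, hdx.1, hdx.2.1, hdx.2.2⟩
  have hBa : IsAlt₃ (bd₃ (tet y p q x)) := (isAlt₄_tet y p q x).bd
  have hX'a := hX.alt.sub (hBa.smul (X p q x))
  set X' := X - X p q x • bd₃ (tet y p q x) with hX'
  have hneg := hX.eq_neg hx hy hxy
  have hpq : ∀ z, X p q z ≠ 0 → z = x ∨ z = y := by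
    intro z hz
    rcases hX.two _ _ _ _ _ hx hy hz with h | h | h
    exacts [absurd h hxy, Or.inl h.symm, Or.inr h.symm]
  -- faces of `X` containing both `p` and `q`
  have hpq' : ∀ u v w, X u v w ≠ 0 → (u = p ∨ v = p ∨ w = p) → (u = q ∨ v = q ∨ w = q) →
      ({u, v, w} : Finset Ω) = {p, q, x} ∨ ({u, v, w} : Finset Ω) = {p, q, y} := by
    intro u v w h h1 h2
    have hduvw := hX.alt.dist h
    have key : ∀ r, ({p, q, r} : Finset Ω) = {u, v, w} →
        ({u, v, w} : Finset Ω) = {p, q, x} ∨ ({u, v, w} : Finset Ω) = {p, q, y} := by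
      intro r hr
      rcases hpq r (hX.alt.ne_zero h hr) with rfl | rfl
      exacts [Or.inl hr.symm, Or.inr hr.symm]
    have hpq0 := hdx.1
    rcases h1 with rfl | rfl | rfl <;> rcases h2 with rfl | rfl | rfl
    · exact absurd rfl hpq0
    · exact key w rfl
    · exact key v (by rw [pair_comm])
    · exact key w (by rw [insert_comm])
    · exact absurd rfl hpq0
    · exact key u (by rw [triple_rot])
    · exact key v (by rw [triple_rot'])
    · exact key u (by rw [pair_comm, triple_rot', insert_comm, pair_comm, triple_rot, insert_comm])
    · exact absurd rfl hpq0
  obtain ⟨d1, d2, d3, d4, d5, d6⟩ := hd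
  have npx : X' p x y ≠ 0 := (hsupp _ _ _).2 (Or.inr (Or.inl rfl))
  have nqx : X' q x y ≠ 0 := (hsupp _ _ _).2 (Or.inr (Or.inr rfl))
  have hxyno : ∀ u v w, X u v w ≠ 0 → (u = x ∨ v = x ∨ w = x) → (u = y ∨ v = y ∨ w = y) →
      False := by
    intro u v w h h1 h2
    have key : ∀ r, ({x, y, r} : Finset Ω) = {u, v, w} → False := fun r hr =>
      hX.alt.ne_zero h hr (hno r)
    rcases h1 with rfl | rfl | rfl <;> rcases h2 with rfl | rfl | rfl
    · exact hxy rfl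
    · exact key w rfl
    · exact key v (by rw [pair_comm])
    · exact key w (by rw [insert_comm])
    · exact hxy rfl
    · exact key u (by rw [triple_rot])
    · exact key v (by rw [triple_rot'])
    · exact key u (by rw [pair_comm, triple_rot', insert_comm, pair_comm, triple_rot, insert_comm])
    · exact hxy rfl
  refine ⟨hX'a, ?_, ?_, ?_, ?_, ⟨p, x, y, npx⟩, ?_⟩
  · intro u v w
    by_cases hB : bd₃ (tet y p q x) u v w = 0
    · simp only [hX', Pi.sub_apply, Pi.smul_apply, hB, smul_zero, sub_zero]
      exact hX.le_one u v w
    · obtain ⟨v1, v2, v3, v4⟩ := bd₃_tet_values ⟨d1, d2, d3, d4, d5, d6⟩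
      have hε := hX.le_one p q x
      have z1 : X p x y = 0 := by rw [← hX.alt.rot, hno]
      have z2 : X q x y = 0 := by rw [← hX.alt.rot, hno]
      rcases bd₃_tet_support hB with h | h | h | h
      · rw [hX'a.abs_eq hdx.1 hdx.2.1 hdx.2.2 h]
        simp [hX', v1]
      · rw [hX'a.abs_eq hdy.1 hdy.2.1 hdy.2.2 h]
        simp [hX', v2, hneg]
      · rw [hX'a.abs_eq hdx.2.1 hdy.2.1 hxy h]
        simpa [hX', v3, z1] using hε
      · rw [hX'a.abs_eq hdx.2.2 hdy.2.2 hxy h]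
        simpa [hX', v4, z2] using hε
  · rw [hX', bd₂_sub, bd₂_smul, (isAlt₄_tet y p q x).bd₂_bd₃, hX.cycle]
    simp
  · have hcl : ∀ u v w, X' u v w ≠ 0 → (u ≠ v ∧ u ≠ w ∧ v ≠ w) ∧
        ((X u v w ≠ 0 ∧ ¬ ((u = p ∨ v = p ∨ w = p) ∧ (u = q ∨ v = q ∨ w = q)) ∧
          ¬ ((u = x ∨ v = x ∨ w = x) ∧ (u = y ∨ v = y ∨ w = y))) ∨
        ((u = p ∨ u = x ∨ u = y) ∧ (v = p ∨ v = x ∨ v = y) ∧ (w = p ∨ w = x ∨ w = y)) ∨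
        ((u = q ∨ u = x ∨ u = y) ∧ (v = q ∨ v = x ∨ v = y) ∧ (w = q ∨ w = x ∨ w = y))) := by
      intro u v w h
      refine ⟨hX'a.dist h, ?_⟩
      rcases (hsupp u v w).1 h with ⟨h1, h2, h3⟩ | h1 | h1
      · refine Or.inl ⟨h1, fun h4 => ?_, fun h4 => hxyno u v w h1 h4.1 h4.2⟩
        rcases hpq' u v w h1 h4.1 h4.2 with h5 | h5
        exacts [h2 h5, h3 h5]
      · exact Or.inr (Or.inl (mem_of_triple_eq h1))
      · exact Or.inr (Or.inr (mem_of_triple_eq h1))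
    have hpx : X p x q ≠ 0 := by rw [hX.alt.swap_right]; simpa using hx
    have hpy : X p y q ≠ 0 := by rw [hX.alt.swap_right]; simpa using hy
    have hqx : X q x p ≠ 0 := by rw [hX.alt.rot]; exact hx
    have hqy : X q y p ≠ 0 := by rw [hX.alt.rot]; exact hy
    have sw : ∀ {u v w}, X u v w ≠ 0 → X v u w ≠ 0 := fun {u v w} h => by
      rw [hX.alt.swap_left]; simpa using h
    -- two distinct old faces at an edge of a new face
    have old2 : ∀ u v c d e, X' u v c ≠ 0 → X' u v d ≠ 0 → X' u v e ≠ 0 →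
        ((u = p ∨ u = x ∨ u = y) ∧ (v = p ∨ v = x ∨ v = y) ∧ (c = p ∨ c = x ∨ c = y)) ∨
        ((u = q ∨ u = x ∨ u = y) ∧ (v = q ∨ v = x ∨ v = y) ∧ (c = q ∨ c = x ∨ c = y)) →
        c = d ∨ c = e ∨ d = e := by
      intro u v c d e hc hd he hnew
      obtain ⟨cd, -⟩ := hcl u v c hc
      obtain ⟨dd, hd'⟩ := hcl u v d hd
      obtain ⟨de, he'⟩ := hcl u v e he
      by_cases huxy : (u = x ∧ v = y) ∨ (u = y ∧ v = x)
      · clear hcl hsupp hpq hpq' hxyno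
        have c1 : c = p ∨ c = q := by grind
        have c2 : d = p ∨ d = q := by grind
        have c3 : e = p ∨ e = q := by grind
        grind
      · have hor : (u = p ∧ v = x) ∨ (u = p ∧ v = y) ∨ (u = x ∧ v = p) ∨ (u = y ∧ v = p) ∨
            (u = q ∧ v = x) ∨ (u = q ∧ v = y) ∨ (u = x ∧ v = q) ∨ (u = y ∧ v = q) := by
          clear hcl hsupp hpq hpq' hxyno hd' he'
          grind
        have fin : ∀ m, X u v m ≠ 0 → (m = p ∨ m = q) → c ≠ d → c ≠ e → d ≠ m → e ≠ m →
            X u v d ≠ 0 → X u v e ≠ 0 → d = e := by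
          intro m hm _ _ _ hdm hem h1 h2
          rcases hX.two _ _ _ _ _ hm h1 h2 with h | h | h
          exacts [absurd h.symm hdm, absurd h.symm hem, h]
        by_cases hcd : c = d
        · exact Or.inl hcd
        by_cases hce : c = e
        · exact Or.inr (Or.inl hce)
        refine Or.inr (Or.inr ?_)
        clear hcl hsupp hpq hpq' hxyno
        rcases hor with ⟨rfl, rfl⟩ | ⟨rfl, rfl⟩ | ⟨rfl, rfl⟩ | ⟨rfl, rfl⟩ | ⟨rfl, rfl⟩ |
          ⟨rfl, rfl⟩ | ⟨rfl, rfl⟩ | ⟨rfl, rfl⟩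
        · exact fin q hpx (Or.inr rfl) hcd hce (by grind) (by grind) (by grind) (by grind)
        · exact fin q hpy (Or.inr rfl) hcd hce (by grind) (by grind) (by grind) (by grind)
        · exact fin q (sw hpx) (Or.inr rfl) hcd hce (by grind) (by grind) (by grind) (by grind)
        · exact fin q (sw hpy) (Or.inr rfl) hcd hce (by grind) (by grind) (by grind) (by grind)
        · exact fin p hqx (Or.inl rfl) hcd hce (by grind) (by grind) (by grind) (by grind)
        · exact fin p hqy (Or.inl rfl) hcd hce (by grind) (by grind) (by grind) (by grind)
        · exact fin p (sw hqx) (Or.inl rfl) hcd hce (by grind) (by grind) (by grind) (by grind)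
        · exact fin p (sw hqy) (Or.inl rfl) hcd hce (by grind) (by grind) (by grind) (by grind)
    intro u v c d e hc hd he
    rcases (hcl u v c hc).2 with h1 | h1
    · rcases (hcl u v d hd).2 with h2 | h2
      · rcases (hcl u v e he).2 with h3 | h3
        · exact hX.two _ _ _ _ _ h1.1 h2.1 h3.1
        · rcases old2 u v e c d he hc hd h3 with h | h | h
          exacts [Or.inr (Or.inl h.symm), Or.inr (Or.inr h.symm), Or.inl h]
      · rcases old2 u v d c e hd hc he h2 with h | h | h
        exacts [Or.inl h.symm, Or.inr (Or.inr h), Or.inr (Or.inl h)]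
    · exact old2 u v c d e hc hd he h1
  · intro T hT hTcl
    have hTpq : T {p, x, y} ↔ T {q, x, y} := by
      have e1 : X' x y p ≠ 0 := by rw [hX'a.rot]; exact npx
      have e2 : X' x y q ≠ 0 := by rw [hX'a.rot]; exact nqx
      have a1 := hTcl x y p q e1 e2
      have a2 := hTcl x y q p e2 e1
      rw [triple_rot p x y, triple_rot q x y] at a1 a2
      exact ⟨a1, a2⟩
    -- `T` is transported back to `X` by giving the two old faces at `pq` its common value on the
    -- two new faces at `xy`.
    let U : Finset Ω → Prop := fun f =>
      ((f = {p, q, x} ∨ f = {p, q, y}) ∧ T {p, x, y}) ∨ (f ≠ {p, q, x} ∧ f ≠ {p, q, y} ∧ T f)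
    -- the new face replacing a flipped one along an outer edge
    have repl : ∀ u v w t, X u v w ≠ 0 → X u v t ≠ 0 →
        (({u, v, w} : Finset Ω) = {p, q, x} ∨ ({u, v, w} : Finset Ω) = {p, q, y}) →
        ¬ (({u, v, t} : Finset Ω) = {p, q, x} ∨ ({u, v, t} : Finset Ω) = {p, q, y}) →
        ∃ m, X' u v m ≠ 0 ∧ (T {u, v, m} ↔ T {p, x, y}) := by
      intro u v w t hw ht h1 h2
      have hdw := hX.alt.dist hw
      have hnpq : ¬ ((u = p ∧ v = q) ∨ (u = q ∧ v = p)) := by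
        rintro (⟨rfl, rfl⟩ | ⟨rfl, rfl⟩)
        · exact h2 (hpq' _ _ _ ht (by simp) (by simp))
        · exact h2 (hpq' _ _ _ ht (by simp) (by simp))
      have mk : ∀ m, (({u, v, m} : Finset Ω) = {p, x, y} ∨ ({u, v, m} : Finset Ω) = {q, x, y}) →
          ∃ m, X' u v m ≠ 0 ∧ (T {u, v, m} ↔ T {p, x, y}) := by
        rintro m (hm | hm)
        · exact ⟨m, (hsupp _ _ _).2 (Or.inr (Or.inl hm)), by rw [hm]⟩
        · exact ⟨m, (hsupp _ _ _).2 (Or.inr (Or.inr hm)), by rw [hm, hTpq]⟩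
      rcases h1 with h1 | h1
      · obtain ⟨hu, hv, -⟩ := mem_of_triple_eq h1
        rcases hu with rfl | rfl | rfl <;> rcases hv with rfl | rfl | rfl
        · exact absurd rfl hdw.1
        · exact absurd (Or.inl ⟨rfl, rfl⟩) hnpq
        · exact mk y (Or.inl rfl)
        · exact absurd (Or.inr ⟨rfl, rfl⟩) hnpq
        · exact absurd rfl hdw.1
        · exact mk y (Or.inr rfl)
        · exact mk y (Or.inl (insert_comm _ _ _))
        · exact mk y (Or.inr (insert_comm _ _ _))
        · exact absurd rfl hdw.1
      · obtain ⟨hu, hv, -⟩ := mem_of_triple_eq h1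
        rcases hu with rfl | rfl | rfl <;> rcases hv with rfl | rfl | rfl
        · exact absurd rfl hdw.1
        · exact absurd (Or.inl ⟨rfl, rfl⟩) hnpq
        · exact mk x (Or.inl (by rw [pair_comm]))
        · exact absurd (Or.inr ⟨rfl, rfl⟩) hnpq
        · exact absurd rfl hdw.1
        · exact mk x (Or.inr (by rw [pair_comm]))
        · exact mk x (Or.inl (triple_rot' _ _ _))
        · exact mk x (Or.inr (triple_rot' _ _ _))
        · exact absurd rfl hdw.1
    have hU := hX.conn U ?_ ?_
    · intro u v w h
      rcases (hsupp u v w).1 h with ⟨h1, h2, h3⟩ | h1 | h1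
      · rcases hU u v w h1 with ⟨h4 | h4, -⟩ | h4
        exacts [absurd h4 h2, absurd h4 h3, h4.2.2]
      · rw [h1]
        rcases hU p q x hx with h4 | h4
        exacts [h4.2, absurd rfl h4.1]
      · rw [h1, ← hTpq]
        rcases hU p q x hx with h4 | h4
        exacts [h4.2, absurd rfl h4.1]
    · obtain ⟨u, v, w, h, hTu⟩ := hT
      rcases (hsupp u v w).1 h with ⟨h1, h2, h3⟩ | h1 | h1
      · exact ⟨u, v, w, h1, Or.inr ⟨h2, h3, hTu⟩⟩
      · exact ⟨p, q, x, hx, Or.inl ⟨Or.inl rfl, h1 ▸ hTu⟩⟩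
      · exact ⟨p, q, x, hx, Or.inl ⟨Or.inl rfl, hTpq.2 (h1 ▸ hTu)⟩⟩
    · intro u v w t hw ht hUw
      by_cases cw : ({u, v, w} : Finset Ω) = {p, q, x} ∨ ({u, v, w} : Finset Ω) = {p, q, y} <;>
        by_cases ct : ({u, v, t} : Finset Ω) = {p, q, x} ∨ ({u, v, t} : Finset Ω) = {p, q, y}
      · rcases hUw with h4 | h4
        · exact Or.inl ⟨ct, h4.2⟩
        · rcases cw with h | h
          exacts [absurd h h4.1, absurd h h4.2.1]
      · rcases hUw with h4 | h4
        · push Not at ct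
          obtain ⟨m, hm, hTm⟩ := repl u v w t hw ht cw (by push Not; exact ct)
          exact Or.inr ⟨ct.1, ct.2, hTcl u v m t hm ((hsupp _ _ _).2 (Or.inl ⟨ht, ct.1, ct.2⟩))
            (hTm.2 h4.2)⟩
        · rcases cw with h | h
          exacts [absurd h h4.1, absurd h h4.2.1]
      · rcases hUw with h4 | h4
        · exact absurd h4.1 cw
        · obtain ⟨m, hm, hTm⟩ := repl u v t w ht hw ct cw
          exact Or.inl ⟨ct, hTm.1 (hTcl u v w m
            ((hsupp _ _ _).2 (Or.inl ⟨hw, h4.1, h4.2.1⟩)) hm h4.2.2)⟩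
      · rcases hUw with h4 | h4
        · exact absurd h4.1 cw
        · push Not at ct
          exact Or.inr ⟨ct.1, ct.2, hTcl u v w t
            ((hsupp _ _ _).2 (Or.inl ⟨hw, h4.1, h4.2.1⟩))
            ((hsupp _ _ _).2 (Or.inl ⟨ht, ct.1, ct.2⟩)) h4.2.2⟩
  · intro g hg hgc
    have epx := hgc p x y npx
    have eqx := hgc q x y nqx
    have sxq := hg x q
    have sxp := hg x p
    have syp := hg y p
    have syq := hg y q
    -- The value on the edge `pq`, possibly absent from the flipped sphere, is forced by the detour
    -- through `x`. The detour through `y` gives the same value by the cocycle condition on the two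
    -- new faces.
    let g' : Ω → Ω → ℤ := fun u v => if u = p ∧ v = q then g p x + g x q else
      if u = q ∧ v = p then g q x + g x p else g u v
    have hg'pq : g' p q = g p x + g x q := by simp [g']
    have hg'o : ∀ {u v}, ¬ ((u = p ∧ v = q) ∨ (u = q ∧ v = p)) → g' u v = g u v := by
      intro u v h
      push Not at h
      simp only [g']
      rw [if_neg (fun h' => h.1 h'.1 h'.2), if_neg (fun h' => h.2 h'.1 h'.2)]
    have hg' : ∀ u v, g' v u = - g' u v := by
      intro u v
      by_cases h1 : u = p ∧ v = q
      · obtain ⟨rfl, rfl⟩ := h1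
        simp only [g', d4, d4.symm]
        simp
        omega
      by_cases h2 : u = q ∧ v = p
      · obtain ⟨rfl, rfl⟩ := h2
        simp only [g', d4, d4.symm]
        simp
        omega
      rw [hg'o (by tauto), hg'o (by tauto), hg]
    have hD := isAlt₃_coboundary hg'
    have hface : ∀ u v w, X u v w ≠ 0 → g' u v + g' v w + g' w u = 0 := by
      intro u v w h
      have hduvw := hX.alt.dist h
      by_cases c1 : ({u, v, w} : Finset Ω) = {p, q, x}
      · obtain ⟨s, hs, hs'⟩ := exists_sign₃ hdx.1 hdx.2.1 hdx.2.2 c1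
        have e := hs' _ hD
        rw [hg'pq, hg'o (u := q) (v := x) (by grind), hg'o (u := x) (v := p) (by grind)] at e
        rw [e, show g p x + g x q + g q x + g x p = 0 by omega, mul_zero]
      by_cases c2 : ({u, v, w} : Finset Ω) = {p, q, y}
      · obtain ⟨s, hs, hs'⟩ := exists_sign₃ hdy.1 hdy.2.1 hdy.2.2 c2
        have e := hs' _ hD
        rw [hg'pq, hg'o (u := q) (v := y) (by grind), hg'o (u := y) (v := p) (by grind)] at e
        rw [e, show g p x + g x q + g q y + g y p = 0 by omega, mul_zero]
      have hn : ¬ ((u = p ∨ v = p ∨ w = p) ∧ (u = q ∨ v = q ∨ w = q)) := by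
        rintro ⟨h1, h2⟩
        rcases hpq' u v w h h1 h2 with h | h
        exacts [c1 h, c2 h]
      rw [hg'o (by tauto), hg'o (by tauto), hg'o (by tauto)]
      exact hgc u v w ((hsupp u v w).2 (Or.inl ⟨h, c1, c2⟩))
    obtain ⟨h, hh⟩ := hX.cohom g' hg' hface
    refine ⟨h, fun u v w huvw => ?_⟩
    have kpx := hh p x q (by rw [hX.alt.swap_right]; simpa using hx)
    have kpy := hh p y q (by rw [hX.alt.swap_right]; simpa using hy)
    have kqx := hh q x p (by rw [hX.alt.rot]; exact hx)
    have kqy := hh q y p (by rw [hX.alt.rot]; exact hy)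
    rw [hg'o (by grind)] at kpx kpy kqx kqy
    have sxy := hg x y
    have hduvw := hX'a.dist huvw
    rcases (hsupp u v w).1 huvw with ⟨h1, h2, h3⟩ | h1 | h1
    · rw [← hh u v w h1, hg'o]
      intro hor
      rcases hpq' u v w h1 (by tauto) (by tauto) with h4 | h4
      exacts [h2 h4, h3 h4]
    · have hm := mem_of_triple_eq h1
      rcases hm.1 with rfl | rfl | rfl <;> rcases hm.2.1 with rfl | rfl | rfl <;>
        first
          | exact absurd rfl hduvw.1
          | omega
    · have hm := mem_of_triple_eq h1
      rcases hm.1 with rfl | rfl | rfl <;> rcases hm.2.1 with rfl | rfl | rfl <;>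
        first
          | exact absurd rfl hduvw.1
          | omega

end TautFilling

/-! ### Decomposing taut fillings and finding ears -/

namespace TautFilling

open Finset

section Parts

variable {Ω : Type*}

lemma IsPart.trans {L M K : Ω → Ω → Ω → Ω → ℤ} (h : IsPart L M) (h' : IsPart M K) :
    IsPart L K := by
  intro a b c d
  have h1 := h a b c d
  have h2 := h' a b c d
  have h3 := abs_add_le (M a b c d - L a b c d) (K a b c d - M a b c d)
  have h4 := abs_add_le (L a b c d) (K a b c d - L a b c d)
  rw [sub_add_sub_cancel'] at h3
  rw [add_sub_cancel] at h4
  linarith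

lemma IsPart.add_compl {L M K : Ω → Ω → Ω → Ω → ℤ} (h : IsPart L M) (h' : IsPart M K) :
    IsPart (L + (K - M)) K := by
  have := (h.symm.trans h').symm
  rwa [show K - (M - L) = L + (K - M) by abel] at this

lemma IsPart.mul_nonneg {L M : Ω → Ω → Ω → Ω → ℤ} (h : IsPart L M) {ε : ℤ} (hε : ε = 1 ∨ ε = -1)
    {a b c d : Ω} (h0 : 0 ≤ ε * M a b c d) : 0 ≤ ε * L a b c d := by
  have h1 := h a b c d
  rcases hε with rfl | rfl
  · rw [one_mul] at *
    rw [abs_of_nonneg h0] at h1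
    have := neg_abs_le (L a b c d)
    have := le_abs_self (M a b c d - L a b c d)
    have := abs_nonneg (L a b c d)
    have := abs_nonneg (M a b c d - L a b c d)
    rcases abs_cases (L a b c d) with h | h <;> omega
  · have : M a b c d ≤ 0 := by linarith
    rw [abs_of_nonpos this] at h1
    rcases abs_cases (L a b c d) with h | h <;>
    rcases abs_cases (M a b c d - L a b c d) with h' | h' <;> omega

lemma IsPart.eq_zero {L M : Ω → Ω → Ω → Ω → ℤ} (h : IsPart L M) {a b c d : Ω}
    (h0 : M a b c d = 0) : L a b c d = 0 := by
  have h1 := h a b c d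
  simp only [h0, abs_zero, zero_sub, abs_neg] at h1
  exact abs_eq_zero.1 (by have := abs_nonneg (L a b c d); omega)

variable [Fintype Ω]

lemma nrm_pos {M : Ω → Ω → Ω → Ω → ℤ} {a b c d : Ω} (h : M a b c d ≠ 0) : 0 < nrm M := by
  have := sum_lt_sum₄ (f := fun _ _ _ _ => 0) (g := fun a b c d => |M a b c d|)
    (fun _ _ _ _ => abs_nonneg _) (abs_pos.2 h)
  simpa [nrm] using this

lemma exists_ne_zero_of_bd₃ {M : Ω → Ω → Ω → Ω → ℤ} {a b c : Ω} (h : bd₃ M a b c ≠ 0) :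
    ∃ w, M w a b c ≠ 0 := by
  by_contra! h'
  exact h (by simp [bd₃, h'])

variable [DecidableEq Ω]

/-- A taut filling of a sum of two spheres glued along a triangle is a sum of two taut fillings. -/
lemma Taut.exists_parts {M : Ω → Ω → Ω → Ω → ℤ} (hT : Taut M) (hM : IsAlt₄ M)
    {X₁ X₂ : Ω → Ω → Ω → ℤ} (h1 : IsSph X₁) (h2 : IsSph X₂) (hMX : bd₃ M = X₁ + X₂)
    {A B : Ω → Prop} (hAB : ∀ x, A x ∨ B x) {a b c : Ω} (hab : a ≠ b)
    (hs : ∀ x, (A x ∧ B x) ↔ (x = a ∨ x = b ∨ x = c))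
    (hA : ∀ x y z, X₁ x y z ≠ 0 → A x ∧ A y ∧ A z)
    (hB : ∀ x y z, X₂ x y z ≠ 0 → B x ∧ B y ∧ B z) :
    ∃ M₁ M₂ : Ω → Ω → Ω → Ω → ℤ, IsAlt₄ M₁ ∧ IsAlt₄ M₂ ∧ Taut M₁ ∧ Taut M₂ ∧ IsPart M₁ M ∧
      IsPart M₂ M ∧ M = M₁ + M₂ ∧ bd₃ M₁ = X₁ ∧ bd₃ M₂ = X₂ ∧ nrm M₁ < nrm M ∧ nrm M₂ < nrm M ∧
      (∀ x y z w, M₁ x y z w ≠ 0 → A x ∧ A y ∧ A z ∧ A w) ∧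
      (∀ x y z w, M₂ x y z w ≠ 0 → B x ∧ B y ∧ B z ∧ B w) := by
  classical
  let S : Finset Ω → Prop := fun s => ∀ x ∈ s, A x
  set M₁ := restr₄ S M with hM₁
  have a1 : IsAlt₄ M₁ := hM.restr S
  have p1 : IsPart M₁ M := isPart_restr S M
  have a2 : IsAlt₄ (M - M₁) := hM.sub a1
  have s1 : ∀ x y z w, M₁ x y z w ≠ 0 → A x ∧ A y ∧ A z ∧ A w := by
    intro x y z w h
    by_contra hn
    refine h ?_
    rw [hM₁, restr₄, if_neg]
    intro hS
    exact hn ⟨hS x (by simp), hS y (by simp), hS z (by simp), hS w (by simp)⟩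
  have s2 : ∀ x y z w, (M - M₁) x y z w ≠ 0 → B x ∧ B y ∧ B z ∧ B w := by
    intro x y z w h
    have hM0 : M x y z w ≠ 0 := fun h0 => h (p1.symm.eq_zero h0)
    rcases hT.splits hM h1.alt h2.alt h1.cycle h2.cycle hMX hAB hab hs hA hB hM0 with h' | h'
    · exfalso
      apply h
      simp only [Pi.sub_apply, hM₁, restr₄]
      rw [if_pos, sub_self]
      intro u hu
      simp only [mem_insert, mem_singleton] at hu
      rcases hu with rfl | rfl | rfl | rfl
      exacts [h'.1, h'.2.1, h'.2.2.1, h'.2.2.2]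
    · exact h'
  -- The left side lives on `A` and the right side on `B`, so both are cycles on the three overlap
  -- vertices and vanish.
  have e0 : bd₃ M₁ - X₁ = X₂ - bd₃ (M - M₁) := by
    rw [bd₃_sub, hMX]; abel
  have e1 : bd₃ M₁ - X₁ = 0 := by
    refine IsAlt₃.eq_zero_of_three (p := a) (q := b) (t := c) (a1.bd.sub h1.alt) ?_ ?_
    · rw [bd₂_sub, a1.bd₂_bd₃, h1.cycle, sub_zero]
    · intro x y z h
      have hAx : A x ∧ A y ∧ A z := by
        by_cases h0 : X₁ x y z = 0
        · have : bd₃ M₁ x y z ≠ 0 := by simpa [h0] using h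
          obtain ⟨w, hw⟩ := exists_ne_zero_of_bd₃ this
          exact (s1 _ _ _ _ hw).2
        · exact hA _ _ _ h0
      have hBx : B x ∧ B y ∧ B z := by
        rw [e0] at h
        by_cases h0 : X₂ x y z = 0
        · have : bd₃ (M - M₁) x y z ≠ 0 := by
            intro h1; exact h (by simp [h0, h1])
          obtain ⟨w, hw⟩ := exists_ne_zero_of_bd₃ this
          exact (s2 _ _ _ _ hw).2
        · exact hB _ _ _ h0
      exact ⟨(hs x).1 ⟨hAx.1, hBx.1⟩, (hs y).1 ⟨hAx.2.1, hBx.2.1⟩, (hs z).1 ⟨hAx.2.2, hBx.2.2⟩⟩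
  have b1 : bd₃ M₁ = X₁ := sub_eq_zero.1 e1
  have b2 : bd₃ (M - M₁) = X₂ := by
    rw [e1] at e0; exact (sub_eq_zero.1 e0.symm).symm
  have n := p1.nrm_eq
  have n1 : 0 < nrm M₁ := by
    obtain ⟨x, y, z, h⟩ := h1.nonzero
    rw [← b1] at h
    obtain ⟨w, hw⟩ := exists_ne_zero_of_bd₃ h
    exact nrm_pos hw
  have n2 : 0 < nrm (M - M₁) := by
    obtain ⟨x, y, z, h⟩ := h2.nonzero
    rw [← b2] at h
    obtain ⟨w, hw⟩ := exists_ne_zero_of_bd₃ h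
    exact nrm_pos hw
  exact ⟨M₁, M - M₁, a1, a2, hT.of_isPart hM a1 p1, hT.of_isPart hM a2 p1.symm, p1, p1.symm,
    by abel, b1, b2, by linarith, by linarith, s1, s2⟩

end Parts

variable {Ω : Type*} [DecidableEq Ω]

lemma tetrahedron_faces {X : Ω → Ω → Ω → ℤ} (hX : IsAlt₃ X) {p q x y : Ω} (h1 : X p q x ≠ 0)
    (h2 : X p q y ≠ 0) (h3 : X p x y ≠ 0) (h4 : X q x y ≠ 0) {u v w : Ω} (huv : u ≠ v)
    (huw : u ≠ w) (hvw : v ≠ w) (hu : u = p ∨ u = q ∨ u = x ∨ u = y)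
    (hv : v = p ∨ v = q ∨ v = x ∨ v = y) (hw : w = p ∨ w = q ∨ w = x ∨ w = y) : X u v w ≠ 0 := by
  have d1 := hX.dist h1
  have d2 := hX.dist h2
  have d3 := hX.dist h3
  have d4 := hX.dist h4
  by_cases c1 : u = y ∨ v = y ∨ w = y
  · by_cases c2 : u = x ∨ v = x ∨ w = x
    · by_cases c3 : u = q ∨ v = q ∨ w = q
      · exact hX.ne_zero h4 (triple_eq_of_mem huv huw hvw (by grind))
      · exact hX.ne_zero h3 (triple_eq_of_mem huv huw hvw (by grind))
    · exact hX.ne_zero h2 (triple_eq_of_mem huv huw hvw (by grind))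
  · exact hX.ne_zero h1 (triple_eq_of_mem huv huw hvw (by grind))

variable [Fintype Ω]

/-- A sphere containing the four faces of a tetrahedron has no other faces. -/
lemma IsSph.tetrahedron {X : Ω → Ω → Ω → ℤ} (hX : IsSph X) {p q x y : Ω} (h1 : X p q x ≠ 0)
    (h2 : X p q y ≠ 0) (h3 : X p x y ≠ 0) (h4 : X q x y ≠ 0) {u v w : Ω} (h : X u v w ≠ 0) :
    (u = p ∨ u = q ∨ u = x ∨ u = y) ∧ (v = p ∨ v = q ∨ v = x ∨ v = y) ∧
      (w = p ∨ w = q ∨ w = x ∨ w = y) := by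
  have key := hX.conn (fun f => f ⊆ {p, q, x, y}) ⟨p, q, x, h1, ?_⟩ ?_ u v w h
  · simpa [insert_subset_iff] using key
  · simp [insert_subset_iff]
  · intro a b c d hc hd hs
    simp only [insert_subset_iff, mem_insert, mem_singleton, singleton_subset_iff] at hs ⊢
    refine ⟨hs.1, hs.2.1, ?_⟩
    by_contra hd'
    obtain ⟨hab, hac, hbc⟩ := hX.alt.dist hc
    have d1 := hX.alt.dist h1
    have d2 := hX.alt.dist h2
    have d3 := hX.alt.dist h3
    -- The face from `ab` to the fourth vertex `e` is already present, so a face leaving the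
    -- tetrahedron across `ab` would be a third one there.
    have hex : ∃ e, e ≠ a ∧ e ≠ b ∧ e ≠ c ∧ (e = p ∨ e = q ∨ e = x ∨ e = y) := by
      by_contra! hcon
      have hp := hcon p
      have hq := hcon q
      have hx := hcon x
      have hy := hcon y
      grind
    obtain ⟨e, hea, heb, hec, he⟩ := hex
    have hf := tetrahedron_faces hX.alt h1 h2 h3 h4 hab hea.symm heb.symm hs.1 hs.2.1 he
    rcases hX.two _ _ _ _ _ hc hd hf with h | h | h
    · exact hd' (h ▸ hs.2.2)
    · exact hec h.symm
    · exact hd' (h ▸ he)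

/-- A taut filling of a sphere has two boundary faces on a common tetrahedron, and they can be
chosen not to contain a given edge at a given vertex of the sphere. -/
theorem exists_ear {X : Ω → Ω → Ω → ℤ} (hX : IsSph X) {M : Ω → Ω → Ω → Ω → ℤ} (hT : Taut M)
    (hM : IsAlt₄ M) (hMX : bd₃ M = X) {c v : Ω} (hc : ∃ a b, X c a b ≠ 0) (hcv : c ≠ v) :
    ∃ p q x y, x ≠ y ∧ 0 < M y p q x * X p q x ∧ 0 < M x p q y * X p q y ∧
      ¬ (c ∈ ({p, q, x} : Finset Ω) ∧ v ∈ ({p, q, x} : Finset Ω)) ∧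
      ¬ (c ∈ ({p, q, y} : Finset Ω) ∧ v ∈ ({p, q, y} : Finset Ω)) := by
  by_contra hno
  -- Counting argument. `R` selects the faces not containing the edge `cv`. Without an ear among
  -- them, each tetrahedron carries at most one such face with the right sign, so they number at
  -- most the size of `M`. Coning from `c` bounds that size by the number of faces missing `c`,
  -- which is smaller.
  let R : Ω → Ω → Ω → Prop := fun x y z =>
    ¬ (c ∈ ({x, y, z} : Finset Ω) ∧ v ∈ ({x, y, z} : Finset Ω))
  have R1 : ∀ x y z, R x y z → R y x z := fun x y z h => by
    simp only [R] at *; rwa [insert_comm]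
  have R2 : ∀ x y z, R x y z → R x z y := fun x y z h => by
    simp only [R] at *; rwa [pair_comm]
  let Q : Ω → Ω → Ω → Ω → Prop := fun w a b d => 0 < M w a b d * X a b d ∧ R a b d
  have Q1 : ∀ w a b d, Q w a b d → Q w b a d := fun w a b d h =>
    ⟨by rw [hM.swap_mid, hX.alt.swap_left, neg_mul_neg]; exact h.1, R1 _ _ _ h.2⟩
  have Q2 : ∀ w a b d, Q w a b d → Q w a d b := fun w a b d h =>
    ⟨by rw [hM.swap_right, hX.alt.swap_right, neg_mul_neg]; exact h.1, R2 _ _ _ h.2⟩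
  have Qno : ∀ x y p q, Q y x p q → Q x y p q → False := by
    intro x y p q h1 h2
    have h1' := Q2 _ _ _ _ (Q1 _ _ _ _ h1)
    have h2' := Q2 _ _ _ _ (Q1 _ _ _ _ h2)
    have hne : x ≠ y := by
      have := hM.dist (left_ne_zero_of_mul h1.1.ne')
      exact this.1.symm
    exact hno ⟨p, q, x, y, hne, h1'.1, h2'.1, h1'.2, h2'.2⟩
  classical
  -- The four terms are the four choices of an apex for the same tetrahedron; at most one of them is
  -- `1`. Summation gives the factor `4` that matches the one in `Taut.nrm_le_cone`.
  have key : ∀ x₀ x₁ x₂ x₃, (if Q x₀ x₁ x₂ x₃ then 1 else 0) + (if Q x₁ x₀ x₂ x₃ then 1 else 0) +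
      (if Q x₂ x₀ x₁ x₃ then 1 else 0) + (if Q x₃ x₀ x₁ x₂ then 1 else 0) ≤ |M x₀ x₁ x₂ x₃| := by
    intro x₀ x₁ x₂ x₃
    have n0 : Q x₀ x₁ x₂ x₃ → 1 ≤ |M x₀ x₁ x₂ x₃| := fun h =>
      Int.one_le_abs (left_ne_zero_of_mul h.1.ne')
    have n1 : Q x₁ x₀ x₂ x₃ → 1 ≤ |M x₀ x₁ x₂ x₃| := fun h => by
      have := Int.one_le_abs (left_ne_zero_of_mul h.1.ne')
      rwa [hM.swap_left, abs_neg] at this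
    have n2 : Q x₂ x₀ x₁ x₃ → 1 ≤ |M x₀ x₁ x₂ x₃| := fun h => by
      have := Int.one_le_abs (left_ne_zero_of_mul h.1.ne')
      rwa [hM.swap_left, hM.swap_mid, neg_neg] at this
    have n3 : Q x₃ x₀ x₁ x₂ → 1 ≤ |M x₀ x₁ x₂ x₃| := fun h => by
      have := Int.one_le_abs (left_ne_zero_of_mul h.1.ne')
      rwa [hM.swap_left, hM.swap_mid, hM.swap_right, neg_neg, abs_neg] at this
    have m01 : Q x₀ x₁ x₂ x₃ → ¬ Q x₁ x₀ x₂ x₃ := fun h h' => Qno _ _ _ _ h h'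
    have m02 : Q x₀ x₁ x₂ x₃ → ¬ Q x₂ x₀ x₁ x₃ := fun h h' => Qno _ _ _ _ (Q1 _ _ _ _ h) h'
    have m03 : Q x₀ x₁ x₂ x₃ → ¬ Q x₃ x₀ x₁ x₂ := fun h h' =>
      Qno _ _ _ _ (Q1 _ _ _ _ (Q2 _ _ _ _ h)) h'
    have m12 : Q x₁ x₀ x₂ x₃ → ¬ Q x₂ x₀ x₁ x₃ := fun h h' =>
      Qno _ _ _ _ (Q1 _ _ _ _ h) (Q1 _ _ _ _ h')
    have m13 : Q x₁ x₀ x₂ x₃ → ¬ Q x₃ x₀ x₁ x₂ := fun h h' =>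
      Qno _ _ _ _ (Q1 _ _ _ _ (Q2 _ _ _ _ h)) (Q1 _ _ _ _ h')
    have m23 : Q x₂ x₀ x₁ x₃ → ¬ Q x₃ x₀ x₁ x₂ := fun h h' =>
      Qno _ _ _ _ (Q1 _ _ _ _ (Q2 _ _ _ _ h)) (Q1 _ _ _ _ (Q2 _ _ _ _ h'))
    by_cases c0 : Q x₀ x₁ x₂ x₃
    · rw [if_pos c0, if_neg (m01 c0), if_neg (m02 c0), if_neg (m03 c0)]; simpa using n0 c0
    by_cases c1 : Q x₁ x₀ x₂ x₃
    · rw [if_neg c0, if_pos c1, if_neg (m12 c1), if_neg (m13 c1)]; simpa using n1 c1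
    by_cases c2 : Q x₂ x₀ x₁ x₃
    · rw [if_neg c0, if_neg c1, if_pos c2, if_neg (m23 c2)]; simpa using n2 c2
    rw [if_neg c0, if_neg c1, if_neg c2]
    by_cases c3 : Q x₃ x₀ x₁ x₂
    · rw [if_pos c3]; simpa using n3 c3
    · rw [if_neg c3]; simp
  set P : ℤ := ∑ a, ∑ b, ∑ d, ∑ w, if Q w a b d then 1 else 0 with hP
  have s0 : ∑ x₀, ∑ x₁, ∑ x₂, ∑ x₃, (if Q x₀ x₁ x₂ x₃ then 1 else 0 : ℤ) = P := by
    rw [hP, sum_comm]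
    refine sum_congr rfl fun a _ => ?_
    rw [sum_comm]
    refine sum_congr rfl fun b _ => ?_
    rw [sum_comm]
  have s1 : ∑ x₀, ∑ x₁, ∑ x₂, ∑ x₃, (if Q x₁ x₀ x₂ x₃ then 1 else 0 : ℤ) = P := by
    rw [hP]
    refine sum_congr rfl fun a _ => ?_
    rw [sum_comm]
    refine sum_congr rfl fun b _ => ?_
    rw [sum_comm]
  have s2 : ∑ x₀, ∑ x₁, ∑ x₂, ∑ x₃, (if Q x₂ x₀ x₁ x₃ then 1 else 0 : ℤ) = P := by
    rw [hP]
    refine sum_congr rfl fun a _ => sum_congr rfl fun b _ => ?_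
    rw [sum_comm]
  have s3 : ∑ x₀, ∑ x₁, ∑ x₂, ∑ x₃, (if Q x₃ x₀ x₁ x₂ then 1 else 0 : ℤ) = P := rfl
  have h4 : 4 * P ≤ nrm M := by
    have := sum_le_sum fun x₀ (_ : x₀ ∈ (univ : Finset Ω)) => sum_le_sum fun x₁ (_ : x₁ ∈ univ) =>
      sum_le_sum fun x₂ (_ : x₂ ∈ univ) => sum_le_sum fun x₃ (_ : x₃ ∈ univ) => key x₀ x₁ x₂ x₃
    simp only [sum_add_distrib, s0, s1, s2, s3] at this
    rw [nrm]
    linarith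
  have hP' : ∑ a, ∑ b, ∑ d, (if R a b d then |X a b d| else 0) ≤ P := by
    refine sum_le_sum fun a _ => sum_le_sum fun b _ => sum_le_sum fun d _ => ?_
    by_cases hR : R a b d
    · rw [if_pos hR]
      by_cases h0 : X a b d = 0
      · exact (abs_nonpos_iff.2 h0).trans (sum_nonneg fun w _ => by split_ifs <;> norm_num)
      · have hex : ∃ w, 0 < M w a b d * X a b d := by
          by_contra! hcon
          have h1 : ∑ w, M w a b d * X a b d ≤ 0 := sum_nonpos fun w _ => hcon w
          rw [← sum_mul, show ∑ w, M w a b d = X a b d by rw [← hMX]; rfl] at h1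
          exact absurd h1 (not_le.2 (mul_self_pos.2 h0))
        obtain ⟨w, hw⟩ := hex
        have : (if Q w a b d then 1 else 0 : ℤ) ≤ ∑ w, if Q w a b d then 1 else 0 :=
          single_le_sum (f := fun w => if Q w a b d then (1 : ℤ) else 0)
            (fun w _ => by split_ifs <;> norm_num) (mem_univ w)
        rw [if_pos (show Q w a b d from ⟨hw, hR⟩)] at this
        exact (hX.le_one a b d).trans this
    · rw [if_neg hR]
      exact sum_nonneg fun w _ => by split_ifs <;> norm_num
  have hcone := hT.nrm_le_cone hM c
  rw [hMX] at hcone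
  have hle : ∀ x y z, (if x ≠ c ∧ y ≠ c ∧ z ≠ c then |X x y z| else 0) ≤
      if R x y z then |X x y z| else 0 := by
    intro x y z
    have := abs_nonneg (X x y z)
    by_cases h : x ≠ c ∧ y ≠ c ∧ z ≠ c
    · rw [if_pos h, if_pos]
      intro h'
      simp only [mem_insert, mem_singleton] at h'
      rcases h'.1 with h1 | h1 | h1
      exacts [h.1 h1.symm, h.2.1 h1.symm, h.2.2 h1.symm]
    · rw [if_neg h]; split_ifs <;> simp
  -- This face contains `c` but not `v`. It satisfies `R` and is not counted by the cone, which
  -- makes the comparison strict.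
  have hface : ∃ a b, X c a b ≠ 0 ∧ v ≠ a ∧ v ≠ b := by
    have aux : ∀ b, X c v b ≠ 0 → ∃ a b, X c a b ≠ 0 ∧ v ≠ a ∧ v ≠ b := by
      intro b h
      have h' : X c b v ≠ 0 := by rw [hX.alt.swap_right]; exact neg_ne_zero.2 h
      obtain ⟨d, hd, hd', -⟩ := hX.exists_other h'
      exact ⟨b, d, by rw [hd']; exact neg_ne_zero.2 h', (hX.alt.dist h).2.2, hd.symm⟩
    obtain ⟨a, b, h⟩ := hc
    by_cases h1 : v = a
    · subst h1; exact aux b h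
    by_cases h2 : v = b
    · subst h2; exact aux a (by rw [hX.alt.swap_right]; exact neg_ne_zero.2 h)
    · exact ⟨a, b, h, h1, h2⟩
  obtain ⟨a, b, hab, hva, hvb⟩ := hface
  have hlt : ∑ x, ∑ y, ∑ z, (if x ≠ c ∧ y ≠ c ∧ z ≠ c then |X x y z| else 0) <
      ∑ x, ∑ y, ∑ z, (if R x y z then |X x y z| else 0) := by
    refine sum_lt_sum (fun x _ => sum_le_sum fun y _ => sum_le_sum fun z _ => hle x y z)
      ⟨c, mem_univ _, sum_lt_sum (fun y _ => sum_le_sum fun z _ => hle c y z)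
        ⟨a, mem_univ _, sum_lt_sum (fun z _ => hle c a z) ⟨b, mem_univ _, ?_⟩⟩⟩
    rw [if_neg (by simp), if_pos]
    · exact abs_pos.2 hab
    · simp only [R, mem_insert, mem_singleton]
      rintro ⟨-, h | h | h⟩
      exacts [hcv h.symm, hva h, hvb h]
  linarith

end TautFilling

/-! ### Closing tetrahedra -/

namespace TautFilling

open Finset

variable {Ω : Type*} [DecidableEq Ω] [Fintype Ω]

/-- A tetrahedron `[b, c, v, a]` attached to `M` along two faces of the sphere `∂M`, such that
the sum is taut. -/
structure IsClosing (M : Ω → Ω → Ω → Ω → ℤ) (ε : ℤ) (a b c v : Ω) : Prop where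
  alt : IsAlt₄ M
  taut : Taut (M + ε • tet b c v a)
  sign : ε = 1 ∨ ε = -1
  pos : 0 ≤ ε * M b c v a
  sph : IsSph (bd₃ M)
  face_left : bd₃ M c v a = - ε
  face_right : bd₃ M c v b = ε

namespace IsClosing

variable {M : Ω → Ω → Ω → Ω → ℤ} {ε : ℤ} {a b c v : Ω}

lemma dist (h : IsClosing M ε a b c v) : Dist₄ b c v a := by
  have hε : ε ≠ 0 := by rcases h.sign with h | h <;> simp [h]
  have h1 := h.sph.alt.dist (show bd₃ M c v a ≠ 0 by rw [h.face_left]; simpa)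
  have h2 := h.sph.alt.dist (show bd₃ M c v b ≠ 0 by rw [h.face_right]; simpa)
  refine ⟨h2.2.1.symm, h2.2.2.symm, ?_, h1.1, h1.2.1, h1.2.2⟩
  rintro rfl
  have := h.face_left.symm.trans h.face_right
  omega

lemma alt_add (h : IsClosing M ε a b c v) : IsAlt₄ (M + ε • tet b c v a) :=
  h.alt.add ((isAlt₄_tet b c v a).smul ε)

lemma pos_add (h : IsClosing M ε a b c v) : 1 ≤ ε * (M + ε • tet b c v a) b c v a := by
  have := h.pos
  simp only [Pi.add_apply, Pi.smul_apply, tet_self h.dist, smul_eq_mul, mul_one, mul_add]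
  rcases h.sign with rfl | rfl <;> linarith

lemma isPart (h : IsClosing M ε a b c v) : IsPart M (M + ε • tet b c v a) := by
  have := (isPart_tet h.alt_add h.sign h.pos_add).symm
  rwa [add_sub_cancel_right] at this

lemma taut_base (h : IsClosing M ε a b c v) : Taut M :=
  h.taut.of_isPart h.alt_add h.alt h.isPart

/-- This passes the situation to smaller fillings in the induction: discarding the complement of `N`
from both `M` and the closed-up chain leaves a part of a taut chain. -/
lemma of_isPart (h : IsClosing M ε a b c v) {N : Ω → Ω → Ω → Ω → ℤ} (hN : IsAlt₄ N)
    (hNM : IsPart N M) (hs : IsSph (bd₃ N))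
    (ha' : bd₃ N c v a = bd₃ M c v a) (hb' : bd₃ N c v b = bd₃ M c v b) :
    IsClosing N ε a b c v where
  alt := hN
  taut := by
    have := hNM.add_compl h.isPart
    rw [add_sub_cancel_left] at this
    exact h.taut.of_isPart h.alt_add (hN.add ((isAlt₄_tet b c v a).smul ε)) this
  sign := h.sign
  pos := hNM.mul_nonneg h.sign h.pos
  sph := hs
  face_left := by rw [ha', h.face_left]
  face_right := by rw [hb', h.face_right]

/-- Were `abc` a face, the faces of the sphere at `c` would be exactly `cva`, `cvb` and `cab`, and
the added tetrahedron cancels all three. Then `c` would be an interior vertex of a taut chain that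
uses it. -/
lemma not_face (h : IsClosing M ε a b c v) : bd₃ M a b c = 0 := by
  by_contra h0
  obtain ⟨d1, d2, d3, d4, d5, d6⟩ := h.dist
  have hε : ε ≠ 0 := by rcases h.sign with h | h <;> simp [h]
  have fa : bd₃ M c v a ≠ 0 := by rw [h.face_left]; simpa
  have fb : bd₃ M c v b ≠ 0 := by rw [h.face_right]; simpa
  have fc : bd₃ M c a b ≠ 0 := by rw [h.sph.alt.rot']; exact h0
  have hav : bd₃ M c a v ≠ 0 := by rw [h.sph.alt.swap_right]; simpa
  have hbv : bd₃ M c b v ≠ 0 := by rw [h.sph.alt.swap_right]; simpa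
  have hba : bd₃ M c b a ≠ 0 := by rw [h.sph.alt.swap_right]; simpa
  have hvab : bd₃ M c a b = - ε := by
    rw [h.sph.eq_neg hav fc d2.symm, h.sph.alt.swap_right c v a, neg_neg, h.face_left]
  obtain ⟨v1, v2, v3, v4⟩ := bd₃_tet_values h.dist
  have hbd : bd₃ (M + ε • tet b c v a) = bd₃ M + ε • bd₃ (tet b c v a) := by
    rw [bd₃_add, bd₃_smul]
  have hfaces : ∀ u w, bd₃ M c u w ≠ 0 → ({c, u, w} : Finset Ω) = {c, v, a} ∨
      ({c, u, w} : Finset Ω) = {c, v, b} ∨ ({c, u, w} : Finset Ω) = {c, a, b} := by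
    intro u w huw
    refine h.sph.link_conn (fun f => f = {c, v, a} ∨ f = {c, v, b} ∨ f = {c, a, b}) ?_ fa
      (Or.inl rfl) huw
    intro x y z hy hz hS
    obtain ⟨hcx, hcy, hxy⟩ := h.sph.alt.dist hy
    have hx : x = v ∨ x = a ∨ x = b := by
      have hx : x ∈ ({c, x, y} : Finset Ω) := by simp
      rcases hS with hS | hS | hS <;> rw [hS] at hx <;> simp only [mem_insert, mem_singleton] at hx
      all_goals grind
    rcases hx with rfl | rfl | rfl
    · rcases h.sph.two _ _ _ _ _ fa fb hz with e | e | e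
      · exact absurd e d3.symm
      · left; rw [e]
      · right; left; rw [e]
    · rcases h.sph.two _ _ _ _ _ hav fc hz with e | e | e
      · exact absurd e d2.symm
      · left; rw [← e, pair_comm]
      · right; right; rw [e]
    · rcases h.sph.two _ _ _ _ _ hbv hba hz with e | e | e
      · exact absurd e d6
      · right; left; rw [← e, pair_comm]
      · right; right; rw [← e, pair_comm]
  have hzero : ∀ u w, bd₃ (M + ε • tet b c v a) c u w = 0 := by
    intro u w
    by_contra hne
    have hcase : ({c, u, w} : Finset Ω) = {c, v, a} ∨
      ({c, u, w} : Finset Ω) = {c, v, b} ∨ ({c, u, w} : Finset Ω) = {c, a, b} := by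
      by_cases hx : bd₃ M c u w = 0
      · have ht : bd₃ (tet b c v a) c u w ≠ 0 := by
          intro ht; exact hne (by rw [hbd]; simp [hx, ht])
        rcases bd₃_tet_support ht with e | e | e | e
        · exact Or.inl e
        · exact Or.inr (Or.inl e)
        · exact Or.inr (Or.inr e)
        · have := (mem_of_triple_eq e).1
          grind
      · exact hfaces u w hx
    rw [← ne_eq, ← abs_pos] at hne
    rcases hcase with e | e | e
    · rw [h.alt_add.bd.abs_eq d4 d5 d6 e, hbd] at hne
      simp [h.face_left, v1] at hne
    · rw [h.alt_add.bd.abs_eq d4 d1.symm d2.symm e, hbd] at hne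
      simp [h.face_right, v2] at hne
    · rw [h.alt_add.bd.abs_eq d5 d1.symm d3.symm e, hbd] at hne
      simp [hvab, v3] at hne
  have h1 := h.pos_add
  rw [h.alt_add.swap_left, h.taut.eq_zero_of_interior h.alt_add hzero] at h1
  simp at h1

/-- The two free vertices of a closing tetrahedron are not adjacent in the sphere. -/
lemma not_edge (h : IsClosing M ε a b c v) (z : Ω) : bd₃ M a b z = 0 := by
  by_contra hz
  obtain ⟨d1, d2, d3, d4, d5, d6⟩ := h.dist
  have hε : ε ≠ 0 := by rcases h.sign with h | h <;> simp [h]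
  have hX := h.sph
  have fa : bd₃ M c v a ≠ 0 := by rw [h.face_left]; simpa
  have fb : bd₃ M c v b ≠ 0 := by rw [h.face_right]; simpa
  -- If `ab` were an edge, `abc` would separate the sphere. The piece containing `v` keeps both
  -- faces at `cv` and has `abc` as a face, against `not_face`.
  obtain ⟨X₁, X₂, A, B, s1, s2, e, hAB, hs, hA, hB, n1, n2⟩ := hX.split h.not_face ⟨z, hz⟩
    ⟨v, by rw [hX.alt.rot']; exact fb⟩ ⟨v, by rw [hX.alt.swap_right]; simpa⟩
  obtain ⟨M₁, M₂, a1, a2, t1, t2, p1, p2, eM, b1, b2, -, -, -, -⟩ :=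
    h.taut_base.exists_parts h.alt s1 s2 e hAB d3.symm hs hA hB
  have hv : ¬ (A v ∧ B v) := by
    rw [hs]; rintro (r | r | r)
    exacts [d6 r, d2 r.symm, d4 r.symm]
  rcases hAB v with hv' | hv'
  · have hz : ∀ x y z, y = v → X₂ x y z = 0 := fun x y z hy => by
      by_contra h0
      exact hv ⟨hv', hy ▸ (hB _ _ _ h0).2.1⟩
    have ea : X₁ c v a = bd₃ M c v a := by rw [e]; simp [hz]
    have eb : X₁ c v b = bd₃ M c v b := by rw [e]; simp [hz]
    have := (h.of_isPart a1 p1 (b1 ▸ s1) (by rw [b1, ea])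
      (by rw [b1, eb])).not_face
    exact n1 (b1 ▸ this)
  · have hz : ∀ x y z, y = v → X₁ x y z = 0 := fun x y z hy => by
      by_contra h0
      exact hv ⟨hy ▸ (hA _ _ _ h0).2.1, hv'⟩
    have ea : X₂ c v a = bd₃ M c v a := by rw [e]; simp [hz]
    have eb : X₂ c v b = bd₃ M c v b := by rw [e]; simp [hz]
    have := (h.of_isPart a2 p2 (b2 ▸ s2) (by rw [b2, ea])
      (by rw [b2, eb])).not_face
    exact n2 (b2 ▸ this)

end IsClosing

/-- Removing a tetrahedron that meets the boundary sphere in exactly two faces. -/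
lemma ear_removal {M : Ω → Ω → Ω → Ω → ℤ} (hM : IsAlt₄ M) (hX : IsSph (bd₃ M)) {p q x y : Ω}
    (hxy : x ≠ y) (hx : 0 < M y p q x * bd₃ M p q x) (hy : bd₃ M p q y ≠ 0)
    (hno : ∀ z, bd₃ M x y z = 0) :
    IsAlt₄ (M - bd₃ M p q x • tet y p q x) ∧ IsPart (M - bd₃ M p q x • tet y p q x) M ∧
      IsSph (bd₃ (M - bd₃ M p q x • tet y p q x)) ∧
      nrm (M - bd₃ M p q x • tet y p q x) < nrm M := by
  have h0 : bd₃ M p q x ≠ 0 := right_ne_zero_of_mul hx.ne'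
  have hp := isPart_tet hM (hX.eq_or h0) (show 1 ≤ bd₃ M p q x * M y p q x by rw [mul_comm]; exact hx)
  have hd := hM.dist (left_ne_zero_of_mul hx.ne')
  refine ⟨hM.sub ((isAlt₄_tet _ _ _ _).smul _), hp.symm, ?_, ?_⟩
  · rw [bd₃_sub, bd₃_smul]
    exact hX.flip h0 hy hxy hno
  · have := hp.nrm_eq
    have h2 : 0 < nrm (bd₃ M p q x • tet y p q x) :=
      nrm_pos (a := y) (b := p) (c := q) (d := x) (by simpa [tet_self hd] using h0)
    linarith

/-- In a sphere without separating triangles which is not the boundary of a tetrahedron, the tips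
of two adjacent faces are not adjacent. -/
lemma IsSph.tips {X : Ω → Ω → Ω → ℤ} (hX : IsSph X)
    (hsep : ∀ a b c, (∃ d, X a b d ≠ 0) → (∃ d, X b c d ≠ 0) → (∃ d, X c a d ≠ 0) → X a b c ≠ 0)
    {p q x y : Ω} (hx : X p q x ≠ 0) (hy : X p q y ≠ 0) :
    (∀ z, X x y z = 0) ∨ (X p x y ≠ 0 ∧ X q x y ≠ 0) := by
  by_cases h : ∀ z, X x y z = 0
  · exact Or.inl h
  · push Not at h
    refine Or.inr ⟨hsep _ _ _ ⟨q, ?_⟩ h ⟨q, ?_⟩, hsep _ _ _ ⟨p, ?_⟩ h ⟨p, ?_⟩⟩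
    · rw [hX.alt.swap_right]; simpa
    · rw [hX.alt.rot']; simpa
    · rw [hX.alt.rot]; simpa
    · rw [hX.alt.swap_out]; simpa

/-- The opposite edge `ab` of the closing tetrahedron is new even to the interior of `M`, so that
the tetrahedron meets the rest only in the two faces at `cv`. The proof is by induction on the norm,
shrinking `M` by ear removal or by splitting. -/
theorem IsClosing.not_mem {ε : ℤ} {a b c v : Ω} : ∀ {M : Ω → Ω → Ω → Ω → ℤ},
    IsClosing M ε a b c v → ∀ x y, M a b x y = 0 := by
  suffices H : ∀ (n : ℕ) (M : Ω → Ω → Ω → Ω → ℤ), (nrm M).toNat < n →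
      IsClosing M ε a b c v → ∀ x y, M a b x y = 0 from
    fun {M} h => H _ M (Nat.lt_succ_self _) h
  intro n
  induction n with
  | zero => intro M h; omega
  | succ n ih =>
  intro M hn h u w
  have ih' : ∀ N : Ω → Ω → Ω → Ω → ℤ, nrm N < nrm M → IsClosing N ε a b c v →
      ∀ x y, N a b x y = 0 := fun N hN hc =>
    ih N (by have := nrm_nonneg N; omega) hc
  have hX := h.sph
  obtain ⟨d1, d2, d3, d4, d5, d6⟩ := h.dist
  have hε : ε ≠ 0 := by rcases h.sign with h | h <;> simp [h]
  have fa : bd₃ M c v a ≠ 0 := by rw [h.face_left]; simpa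
  have fb : bd₃ M c v b ≠ 0 := by rw [h.face_right]; simpa
  by_cases hsep : ∀ a b c, (∃ d, bd₃ M a b d ≠ 0) → (∃ d, bd₃ M b c d ≠ 0) →
    (∃ d, bd₃ M c a d ≠ 0) → bd₃ M a b c ≠ 0
  -- The ear is chosen with its boundary faces off the edge `cv`, so the faces `cva` and `cvb`
  -- survive its removal and the smaller filling is again closed up by the same tetrahedron.
  · obtain ⟨p, q, x, y, hxy, hx, hy, r1, r2⟩ :=
      exists_ear hX h.taut_base h.alt rfl ⟨v, a, fa⟩ d4
    have hx0 := right_ne_zero_of_mul hx.ne'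
    have hy0 := right_ne_zero_of_mul hy.ne'
    rcases hX.tips hsep hx0 hy0 with hno | ⟨h3, h4⟩
    · obtain ⟨m1, m2, m3, m4⟩ := ear_removal h.alt hX hxy hx hy0 hno
      have hsame : ∀ z, bd₃ M c v z ≠ 0 →
          bd₃ (M - bd₃ M p q x • tet y p q x) c v z = bd₃ M c v z := by
        intro z hz
        have ht : bd₃ (tet y p q x) c v z = 0 := by
          by_contra ht
          rcases bd₃_tet_support ht with e | e | e | e
          · exact r1 (by rw [← e]; simp)
          · exact r2 (by rw [← e]; simp)
          · exact hX.alt.ne_zero hz e.symm (by rw [← hX.alt.rot, hno])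
          · exact hX.alt.ne_zero hz e.symm (by rw [← hX.alt.rot, hno])
        rw [bd₃_sub, bd₃_smul]
        simp [ht]
      have hcl := h.of_isPart m1 m2 m3 (hsame a fa) (hsame b fb)
      have h1 := ih' _ m4 hcl u w
      by_contra hM0
      have ht : tet y p q x a b u w ≠ 0 := by
        intro ht
        simp only [Pi.sub_apply, Pi.smul_apply, ht, smul_zero, sub_zero] at h1
        exact hM0 h1
      have hset := tet_support ht
      have ha : a ∈ ({y, p, q, x} : Finset Ω) := by rw [← hset]; simp
      have hb : b ∈ ({y, p, q, x} : Finset Ω) := by rw [← hset]; simp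
      have e1 := h.not_edge
      have e1' : ∀ z, bd₃ M b a z = 0 := fun z => by rw [hX.alt.swap_left, e1, neg_zero]
      have e2 := hcl.not_edge
      have e2' : ∀ z, bd₃ (M - bd₃ M p q x • tet y p q x) b a z = 0 := fun z => by
        rw [hcl.sph.alt.swap_left, e2, neg_zero]
      have n2 : bd₃ (M - bd₃ M p q x • tet y p q x) x y p ≠ 0 := by
        rw [bd₃_sub, bd₃_smul, hX.flip_support hx0 hy0 hxy hno]
        exact Or.inr (Or.inl (triple_rot _ _ _))
      have f1 : bd₃ M p x q ≠ 0 := by rw [hX.alt.swap_right]; simpa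
      have f2 : bd₃ M q x p ≠ 0 := by rw [hX.alt.rot]; simpa
      have f3 : bd₃ M p y q ≠ 0 := by rw [hX.alt.swap_right]; simpa
      have f4 : bd₃ M q y p ≠ 0 := by rw [hX.alt.rot]; simpa
      simp only [mem_insert, mem_singleton] at ha hb
      -- The ear is now the only tetrahedron that could contain `ab`. Five of its edges are in the
      -- sphere before the removal, and `xy` is in the sphere after it, so `not_edge` excludes all
      -- six.
      rcases ha with rfl | rfl | rfl | rfl <;> rcases hb with rfl | rfl | rfl | rfl
      · exact d3 rfl
      · exact f3 (e1' _)
      · exact f4 (e1' _)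
      · exact n2 (e2' _)
      · exact f3 (e1 _)
      · exact d3 rfl
      · exact hx0 (e1 _)
      · exact f1 (e1 _)
      · exact f4 (e1 _)
      · exact hx0 (e1' _)
      · exact d3 rfl
      · exact f2 (e1 _)
      · exact n2 (e2 _)
      · exact f1 (e1' _)
      · exact f2 (e1' _)
      · exact d3 rfl
    · exfalso
      obtain ⟨hc, -, ha⟩ := hX.tetrahedron hx0 hy0 h3 h4 fa
      obtain ⟨-, -, hb⟩ := hX.tetrahedron hx0 hy0 h3 h4 fb
      exact tetrahedron_faces hX.alt hx0 hy0 h3 h4 d3.symm d5.symm d1 ha hb hc h.not_face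
  · push Not at hsep
    obtain ⟨x, y, z, hxy, hyz, hzx, h0⟩ := hsep
    obtain ⟨X₁, X₂, A, B, s1, s2, e, hAB, hs, hA, hB, n1, n2⟩ := hX.split h0 hxy hyz hzx
    have hxyz := s1.alt.dist n1
    obtain ⟨M₁, M₂, a1, a2, t1, t2, p1, p2, eM, b1, b2, l1, l2, S1, S2⟩ :=
      h.taut_base.exists_parts h.alt s1 s2 e hAB hxyz.1 hs hA hB
    have hedge : ∀ r s, r ≠ s → (r = x ∨ r = y ∨ r = z) → (s = x ∨ s = y ∨ s = z) →
        ∃ t, bd₃ M r s t ≠ 0 := by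
      have sw : ∀ r s, (∃ t, bd₃ M r s t ≠ 0) → ∃ t, bd₃ M s r t ≠ 0 := by
        rintro r s ⟨t, ht⟩
        exact ⟨t, by rw [hX.alt.swap_left]; simpa⟩
      rintro r s hrs (rfl | rfl | rfl) (rfl | rfl | rfl)
      · exact absurd rfl hrs
      · exact hxy
      · exact sw _ _ hzx
      · exact sw _ _ hxy
      · exact absurd rfl hrs
      · exact hyz
      · exact hzx
      · exact sw _ _ hyz
      · exact absurd rfl hrs
    have hnab : ¬ ((a = x ∨ a = y ∨ a = z) ∧ (b = x ∨ b = y ∨ b = z)) := by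
      rintro ⟨h1, h2⟩
      obtain ⟨t, ht⟩ := hedge a b d3.symm h1 h2
      exact ht (h.not_edge t)
    have hone : ∀ r, bd₃ M c v r ≠ 0 → c ≠ r → v ≠ r → ¬ ((A c ∧ A v ∧ A r) ∧ (B c ∧ B v ∧ B r)) := by
      rintro r hr hcr hvr ⟨h1, h2⟩
      have := triple_eq_of_mem d4 hcr hvr ⟨(hs c).1 ⟨h1.1, h2.1⟩, (hs v).1 ⟨h1.2.1, h2.2.1⟩,
        (hs r).1 ⟨h1.2.2, h2.2.2⟩⟩
      exact hX.alt.ne_zero hr this.symm h0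
    have hMab : ∀ u w, M a b u w ≠ 0 → (A a ∧ A b ∧ M₁ a b u w ≠ 0) ∨
        (B a ∧ B b ∧ M₂ a b u w ≠ 0) := by
      intro u w hM0
      by_cases hM1 : M₁ a b u w = 0
      · have hM2 : M₂ a b u w ≠ 0 := by
          intro hM2; exact hM0 (by rw [eM]; simp [hM1, hM2])
        have := S2 _ _ _ _ hM2
        exact Or.inr ⟨this.1, this.2.1, hM2⟩
      · have := S1 _ _ _ _ hM1
        exact Or.inl ⟨this.1, this.2.1, hM1⟩
    have hside : ∀ r, bd₃ M c v r ≠ 0 → c ≠ r → v ≠ r →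
        (X₁ c v r = bd₃ M c v r ∧ A c ∧ A v ∧ A r ∧ (B c → B v → ¬ B r)) ∨
        (X₂ c v r = bd₃ M c v r ∧ B c ∧ B v ∧ B r ∧ (A c → A v → ¬ A r)) := by
      intro r hr h1 h2
      have hone' := hone r hr h1 h2
      by_cases hz1 : X₁ c v r = 0
      · have hz2 : X₂ c v r = bd₃ M c v r := by rw [e]; simp [hz1]
        have hB' := hB _ _ _ (hz2 ▸ hr)
        exact Or.inr ⟨hz2, hB'.1, hB'.2.1, hB'.2.2, fun q1 q2 q3 => hone' ⟨⟨q1, q2, q3⟩, hB'⟩⟩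
      · have hA' := hA _ _ _ hz1
        have hz2 : X₂ c v r = 0 := by
          by_contra hz2
          exact hone' ⟨hA', hB _ _ _ hz2⟩
        exact Or.inl ⟨by rw [e]; simp [hz2], hA'.1, hA'.2.1, hA'.2.2,
          fun q1 q2 q3 => hone' ⟨hA', ⟨q1, q2, q3⟩⟩⟩
    by_contra hM0
    -- If the two faces at `cv` are on the same side, induction applies to that piece, and in the
    -- other piece both `a` and `b` would be on the separating triangle, making `ab` an edge. If
    -- they are on different sides, `a` and `b` share no side.
    rcases hside a fa d5 d6 with ⟨ea, ha⟩ | ⟨ea, ha⟩ <;>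
      rcases hside b fb d1.symm d2.symm with ⟨eb, hb⟩ | ⟨eb, hb⟩
    · have := ih' M₁ l1 (h.of_isPart a1 p1 (b1 ▸ s1) (b1 ▸ ea) (b1 ▸ eb)) u w
      rcases hMab u w hM0 with h1 | h1
      · exact h1.2.2 this
      · exact hnab ⟨(hs a).1 ⟨ha.2.2.1, h1.1⟩, (hs b).1 ⟨hb.2.2.1, h1.2.1⟩⟩
    · rcases hMab u w hM0 with h1 | h1
      · exact hb.2.2.2 ha.1 ha.2.1 h1.2.1
      · exact ha.2.2.2 hb.1 hb.2.1 h1.1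
    · rcases hMab u w hM0 with h1 | h1
      · exact ha.2.2.2 hb.1 hb.2.1 h1.1
      · exact hb.2.2.2 ha.1 ha.2.1 h1.2.1
    · have := ih' M₂ l2 (h.of_isPart a2 p2 (b2 ▸ s2) (b2 ▸ ea) (b2 ▸ eb)) u w
      rcases hMab u w hM0 with h1 | h1
      · exact hnab ⟨(hs a).1 ⟨h1.1, ha.2.2.1⟩, (hs b).1 ⟨h1.2.1, hb.2.2.1⟩⟩
      · exact h1.2.2 this

end TautFilling

/-! ### Combinatorial shellings -/

namespace TautFilling

open Finset

section Shelling

variable {Ω : Type*} [DecidableEq Ω]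

/-- Combinatorial shellings of `3`-balls. `Shells N F` says that the tetrahedra of `N`, added one
after another starting from the last entry, build up a ball with the set `F` of boundary faces. A
new tetrahedron `A ∪ B` is attached along its faces opposite to the vertices of `A`. -/
inductive Shells : List (Finset Ω) → Set (Finset Ω) → Prop
  | single (t : Finset Ω) (ht : t.card = 4) : Shells [t] {f | f ⊆ t ∧ f.card = 3}
  | cons (N : List (Finset Ω)) (F : Set (Finset Ω)) (A B : Finset Ω) (h : Shells N F)
      (hAB : Disjoint A B) (hA : A.Nonempty) (hB : B.Nonempty) (hcard : (A ∪ B).card = 4)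
      (hnew : ∀ s ∈ N, ¬ A ⊆ s) (hold : ∀ a ∈ A, (A ∪ B).erase a ∈ F)
      (hface : ∀ f ∈ F, B ⊆ f → ∃ a ∈ A, f = (A ∪ B).erase a) :
      Shells ((A ∪ B) :: N) {f | (f ∈ F ∧ ¬ B ⊆ f) ∨ ∃ b ∈ B, f = (A ∪ B).erase b}

lemma Shells.exists_superset {N : List (Finset Ω)} {F : Set (Finset Ω)} (h : Shells N F) :
    ∀ f ∈ F, ∃ s ∈ N, f ⊆ s := by
  induction h with
  | single t ht => exact fun f hf => ⟨t, by simp, hf.1⟩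
  | cons N F A B h _ _ _ _ _ _ _ ih =>
    rintro f (⟨hf, -⟩ | ⟨b, -, rfl⟩)
    · obtain ⟨s, hs, hfs⟩ := ih f hf
      exact ⟨s, by simp [hs], hfs⟩
    · exact ⟨A ∪ B, by simp, erase_subset _ _⟩

lemma Shells.card_eq {N : List (Finset Ω)} {F : Set (Finset Ω)} (h : Shells N F) :
    ∀ s ∈ N, s.card = 4 := by
  induction h with
  | single t ht => simpa using ht
  | cons N F A B h _ _ _ hc _ _ _ ih =>
    intro s hs
    rcases List.mem_cons.1 hs with rfl | hs
    exacts [hc, ih s hs]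

lemma Shells.nodup {N : List (Finset Ω)} {F : Set (Finset Ω)} (h : Shells N F) : N.Nodup := by
  induction h with
  | single t ht => simp
  | cons N F A B h _ _ _ hc hnew _ _ ih =>
    exact List.nodup_cons.2 ⟨fun hm => hnew _ hm subset_union_left, ih⟩

lemma Shells.ne_nil {N : List (Finset Ω)} {F : Set (Finset Ω)} (h : Shells N F) : N ≠ [] := by
  cases h <;> simp

lemma Shells.card_face {N : List (Finset Ω)} {F : Set (Finset Ω)} (h : Shells N F) :
    ∀ f ∈ F, f.card = 3 := by
  induction h with
  | single t ht => exact fun f hf => hf.2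
  | cons N F A B h _ _ _ hc _ _ _ ih =>
    rintro f (⟨hf, -⟩ | ⟨b, hb, rfl⟩)
    · exact ih f hf
    · rw [card_erase_of_mem (mem_union_right _ hb), hc]

lemma Shells.drop {N : List (Finset Ω)} {F : Set (Finset Ω)} (h : Shells N F) :
    ∀ k < N.length, ∃ F', Shells (N.drop k) F' := by
  induction h with
  | single t ht =>
    intro k hk
    obtain rfl : k = 0 := by simpa using hk
    exact ⟨_, Shells.single t ht⟩
  | cons N F A B h hAB hA hB hcard hnew hold hface ih =>
    rintro (_ | k) hk
    · exact ⟨_, Shells.cons N F A B h hAB hA hB hcard hnew hold hface⟩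
    · exact ih k (by simpa using hk)

lemma exists_eq_erase {t f : Finset Ω} (hft : f ⊆ t) (ht : t.card = 4) (hf : f.card = 3) :
    ∃ b ∈ t, b ∉ f ∧ f = t.erase b := by
  have hc : (t \ f).card = 1 := by rw [card_sdiff_of_subset hft, ht, hf]
  obtain ⟨b, hb⟩ := card_eq_one.1 hc
  have hbt : b ∈ t \ f := by simp [hb]
  rw [mem_sdiff] at hbt
  refine ⟨b, hbt.1, hbt.2, eq_of_subset_of_card_le (fun x hx => mem_erase.2 ⟨?_, hft hx⟩) ?_⟩
  · rintro rfl; exact hbt.2 hx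
  · rw [card_erase_of_mem hbt.1, ht, hf]

/-- Shellings of balls meeting in a common boundary triangle can be concatenated. -/
theorem Shells.append {N₁ N₂ : List (Finset Ω)} {F₁ F₂ : Set (Finset Ω)} (h₁ : Shells N₁ F₁)
    (h₂ : Shells N₂ F₂) {r : Finset Ω} (hr₁ : r ∈ F₁) (hr₂ : r ∈ F₂)
    (hlast : ∀ t, N₂.getLast? = some t → r ⊆ t) (hV : ∀ s ∈ N₁, ∀ t ∈ N₂, s ∩ t ⊆ r) :
    Shells (N₂ ++ N₁) ((F₁ ∪ F₂) \ {r}) := by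
  have hr := h₁.card_face r hr₁
  have hF₁ : ∀ f ∈ F₁, r ⊆ f → f = r := fun f hf hrf =>
    (eq_of_subset_of_card_le hrf (by rw [hr, h₁.card_face f hf])).symm
  induction h₂ with
  | single t ht =>
    have hrt : r ⊆ t := hlast t (by simp)
    obtain ⟨d, hdt, hdr, herase⟩ := exists_eq_erase hrt ht hr
    have ht' : {d} ∪ r = t := by rw [← insert_eq, herase, insert_erase hdt]
    have hrne : r.Nonempty := card_pos.1 (by omega)
    -- The first tetrahedron of the second ball is glued along the single face `r`, with `d` as its
    -- new vertex.
    have key := Shells.cons N₁ F₁ {d} r h₁ (by simpa using hdr) (by simp) hrne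
      (by rw [ht', ht]) ?_ ?_ ?_
    · rw [ht'] at key
      refine (congrArg (Shells (t :: N₁)) ?_).mpr key
      ext f
      constructor
      · rintro ⟨hf | hf, hfr⟩
        · exact Or.inl ⟨hf, fun h => hfr (hF₁ f hf h)⟩
        · obtain ⟨b, hbt, -, hb⟩ := exists_eq_erase hf.1 ht hf.2
          refine Or.inr ⟨b, ?_, hb⟩
          rw [herase, mem_erase]
          refine ⟨?_, hbt⟩
          rintro rfl
          exact hfr (hb.trans herase.symm)
      · rintro (⟨hf, hrf⟩ | ⟨b, hb, rfl⟩)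
        · exact ⟨Or.inl hf, fun h => hrf (h ▸ Subset.rfl)⟩
        · refine ⟨Or.inr ⟨erase_subset _ _, by rw [card_erase_of_mem (hrt hb), ht]⟩, fun h => ?_⟩
          rw [Set.mem_singleton_iff] at h
          rw [← h] at hb
          simp at hb
    · intro s hs h
      exact hdr (hV s hs t (by simp) (mem_inter.2 ⟨h (by simp), hdt⟩))
    · simp only [mem_singleton, forall_eq]
      rw [ht', ← herase]; exact hr₁
    · intro f hf hrf
      exact ⟨d, by simp, by rw [hF₁ f hf hrf, ht', ← herase]⟩
  | cons N F A B h hAB hA hB hcard hnew hold hface ih =>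
    have hlast' : ∀ t, N.getLast? = some t → r ⊆ t := by
      intro t ht
      refine hlast t ?_
      rw [List.getLast?_cons, ht]; rfl
    have hrN : ∃ s ∈ N, r ⊆ s :=
      ⟨_, List.getLast_mem h.ne_nil, hlast' _ (List.getLast?_eq_some_getLast h.ne_nil)⟩
    obtain ⟨s₀, hs₀, hrs₀⟩ := hrN
    -- A face created by this step contains `A`. But `r` lies in the earlier tetrahedron `s₀`, which
    -- does not, so `r` was already a boundary face before the step.
    have hrb : ∀ b ∈ B, r ≠ (A ∪ B).erase b := by
      intro b hb hre
      refine hnew s₀ hs₀ (Subset.trans (fun a ha => ?_) hrs₀)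
      rw [hre, mem_erase]
      exact ⟨fun hab => disjoint_left.1 hAB ha (hab ▸ hb), mem_union_left _ ha⟩
    have hrF : r ∈ F ∧ ¬ B ⊆ r := by
      rcases hr₂ with h | ⟨b, hb, h⟩
      exacts [h, absurd h (hrb b hb)]
    have ihh := ih hrF.1 hlast' (fun s hs t ht => hV s hs t (by simp [ht]))
    have hBF₁ : ∀ f ∈ F₁, ¬ B ⊆ f := by
      intro f hf hBf
      obtain ⟨s, hs, hfs⟩ := h₁.exists_superset f hf
      exact hrF.2 (fun b hb => hV s hs (A ∪ B) (by simp)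
        (mem_inter.2 ⟨hfs (hBf hb), mem_union_right _ hb⟩))
    have key := Shells.cons _ _ A B ihh hAB hA hB hcard ?_ ?_ ?_
    · refine (congrArg (Shells ((A ∪ B) :: (N ++ N₁))) ?_).mpr key
      ext f
      constructor
      · rintro ⟨hf | ⟨hf, hBf⟩ | hf, hfr⟩
        · exact Or.inl ⟨⟨Or.inl hf, hfr⟩, hBF₁ f hf⟩
        · exact Or.inl ⟨⟨Or.inr hf, hfr⟩, hBf⟩
        · exact Or.inr hf
      · rintro (⟨⟨hf | hf, hfr⟩, hBf⟩ | ⟨b, hb, hf⟩)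
        · exact ⟨Or.inl hf, hfr⟩
        · exact ⟨Or.inr (Or.inl ⟨hf, hBf⟩), hfr⟩
        · exact ⟨Or.inr (Or.inr ⟨b, hb, hf⟩), fun h => hrb b hb (by
            rw [Set.mem_singleton_iff] at h; rw [← h, hf])⟩
    · intro s hs hAs
      rcases List.mem_append.1 hs with hs | hs
      · exact hnew s hs hAs
      · refine hnew s₀ hs₀ (Subset.trans (fun a ha => ?_) hrs₀)
        exact hV s hs (A ∪ B) (by simp) (mem_inter.2 ⟨hAs ha, mem_union_left _ ha⟩)
    · intro a ha
      refine ⟨Or.inr (hold a ha), fun h => hrF.2 (fun b hb => ?_)⟩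
      rw [Set.mem_singleton_iff] at h
      rw [← h, mem_erase]
      exact ⟨fun hab => disjoint_left.1 hAB ha (hab ▸ hb), mem_union_right _ hb⟩
    · rintro f ⟨hf | hf, -⟩ hBf
      · exact absurd hBf (hBF₁ f hf)
      · exact hface f hf hBf

end Shelling

variable {Ω : Type*} [DecidableEq Ω]

/-- The triangles occurring in a `2`-chain. -/
def faces (X : Ω → Ω → Ω → ℤ) : Set (Finset Ω) := {f | ∃ a b c, X a b c ≠ 0 ∧ f = {a, b, c}}

/-- The tetrahedra occurring in a `3`-chain. -/
def cells (M : Ω → Ω → Ω → Ω → ℤ) : Set (Finset Ω) :=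
  {s | ∃ a b c d, M a b c d ≠ 0 ∧ s = {a, b, c, d}}

lemma mem_faces_iff {X : Ω → Ω → Ω → ℤ} (hX : IsAlt₃ X) {a b c : Ω} :
    ({a, b, c} : Finset Ω) ∈ faces X ↔ X a b c ≠ 0 :=
  ⟨fun ⟨_, _, _, h, e⟩ => hX.ne_zero h e, fun h => ⟨a, b, c, h, rfl⟩⟩

lemma mem_cells_iff {M : Ω → Ω → Ω → Ω → ℤ} (hM : IsAlt₄ M) {a b c d : Ω} :
    ({a, b, c, d} : Finset Ω) ∈ cells M ↔ M a b c d ≠ 0 :=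
  ⟨fun ⟨_, _, _, _, h, e⟩ => hM.ne_zero h e, fun h => ⟨a, b, c, d, h, rfl⟩⟩

/-- All coefficients are `0` or `±1`, and the cells can be shelled starting from any one. -/
def Shellable (M : Ω → Ω → Ω → Ω → ℤ) (F : Set (Finset Ω)) : Prop :=
  (∀ a b c d, |M a b c d| ≤ 1) ∧ ∀ t ∈ cells M, ∃ l : List (Finset Ω), Shells l F ∧
    (∀ s, s ∈ l ↔ s ∈ cells M) ∧ l.getLast? = some t

variable [Fintype Ω]

/-- The shelling runs through `M₁` from `t` and continues in `M₂` from a tetrahedron on the common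
triangle `abc`; this needs the free choice of the first tetrahedron in `M₂`. Later tetrahedra stand
earlier in the list, hence the order `l₂ ++ l₁`. Starting in `M₂` is the same lemma with the pieces
exchanged. -/
lemma Shellable.of_parts {M M₁ M₂ : Ω → Ω → Ω → Ω → ℤ} {X X₁ X₂ : Ω → Ω → Ω → ℤ} {a b c : Ω}
    (hX : IsAlt₃ X) (h1 : IsAlt₃ X₁) (h2 : IsAlt₃ X₂) (hX0 : X a b c = 0)
    (e : X = X₁ + X₂) (n1 : X₁ a b c ≠ 0) (n2 : X₂ a b c ≠ 0)
    (eM : M = M₁ + M₂) (b2 : bd₃ M₂ = X₂) (a1 : IsAlt₄ M₁) (a2 : IsAlt₄ M₂)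
    {A B : Ω → Prop} (hs : ∀ x, (A x ∧ B x) ↔ (x = a ∨ x = b ∨ x = c))
    (hA : ∀ x y z, X₁ x y z ≠ 0 → A x ∧ A y ∧ A z)
    (hB : ∀ x y z, X₂ x y z ≠ 0 → B x ∧ B y ∧ B z)
    (S1 : ∀ x y z w, M₁ x y z w ≠ 0 → A x ∧ A y ∧ A z ∧ A w)
    (S2 : ∀ x y z w, M₂ x y z w ≠ 0 → B x ∧ B y ∧ B z ∧ B w)
    (H1 : Shellable M₁ (faces X₁)) (H2 : Shellable M₂ (faces X₂)) :
    (∀ a b c d, |M a b c d| ≤ 1) ∧ (∀ s, s ∈ cells M ↔ s ∈ cells M₁ ∨ s ∈ cells M₂) ∧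
    ∀ t ∈ cells M₁, ∃ l : List (Finset Ω), Shells l (faces X) ∧
    (∀ s, s ∈ l ↔ s ∈ cells M) ∧ l.getLast? = some t := by
  have hdisj : ∀ x y z w, M₁ x y z w = 0 ∨ M₂ x y z w = 0 := by
    intro x y z w
    by_contra! h
    obtain ⟨h1, h2⟩ := h
    have hd := a1.dist h1
    have hA' := S1 _ _ _ _ h1
    have hB' := S2 _ _ _ _ h2
    have c1 := (hs x).1 ⟨hA'.1, hB'.1⟩
    have c2 := (hs y).1 ⟨hA'.2.1, hB'.2.1⟩
    have c3 := (hs z).1 ⟨hA'.2.2.1, hB'.2.2.1⟩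
    have c4 := (hs w).1 ⟨hA'.2.2.2, hB'.2.2.2⟩
    obtain ⟨d1, d2, d3, d4, d5, d6⟩ := hd
    clear hs hA hB S1 S2 H1 H2
    grind
  have hcells : ∀ s, s ∈ cells M ↔ s ∈ cells M₁ ∨ s ∈ cells M₂ := by
    intro s
    constructor
    · rintro ⟨x, y, z, w, h, rfl⟩
      rw [mem_cells_iff a1, mem_cells_iff a2]
      by_contra! h'
      exact h (by rw [eM]; simp [h'.1, h'.2])
    · rintro (⟨x, y, z, w, h, rfl⟩ | ⟨x, y, z, w, h, rfl⟩)
      · refine ⟨x, y, z, w, ?_, rfl⟩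
        rw [eM]; simpa [(hdisj x y z w).resolve_left h] using h
      · refine ⟨x, y, z, w, ?_, rfl⟩
        rw [eM]; simpa [(hdisj x y z w).resolve_right h] using h
  refine ⟨fun x y z w => ?_, hcells, fun t ht => ?_⟩
  · rw [eM]
    rcases hdisj x y z w with h | h
    · simpa [h] using H2.1 x y z w
    · simpa [h] using H1.1 x y z w
  · obtain ⟨l₁, L1, m1, g1⟩ := H1.2 t ht
    obtain ⟨w, hw⟩ := exists_ne_zero_of_bd₃ (b2.symm ▸ n2)
    obtain ⟨l₂, L2, m2, g2⟩ := H2.2 {w, a, b, c} ⟨w, a, b, c, hw, rfl⟩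
    refine ⟨l₂ ++ l₁, ?_, ?_, ?_⟩
    · have := L1.append L2 (r := {a, b, c}) ((mem_faces_iff h1).2 n1) ((mem_faces_iff h2).2 n2)
        ?_ ?_
      · refine (congrArg (Shells (l₂ ++ l₁)) ?_).mpr this
        ext f
        constructor
        · rintro ⟨x, y, z, h, rfl⟩
          refine ⟨?_, fun he => hX.ne_zero h ?_ hX0⟩
          · rw [Set.mem_union, mem_faces_iff h1, mem_faces_iff h2]
            by_contra! h'
            exact h (by rw [e]; simp [h'.1, h'.2])
          · rw [Set.mem_singleton_iff] at he; exact he.symm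
        · have hab3 : ∀ x y z, X₁ x y z ≠ 0 → X₂ x y z ≠ 0 →
              ({x, y, z} : Finset Ω) = {a, b, c} := by
            intro x y z q1 q2
            obtain ⟨i1, i2, i3⟩ := h1.dist q1
            have hA' := hA _ _ _ q1
            have hB' := hB _ _ _ q2
            exact triple_eq_of_mem i1 i2 i3 ⟨(hs x).1 ⟨hA'.1, hB'.1⟩,
              (hs y).1 ⟨hA'.2.1, hB'.2.1⟩, (hs z).1 ⟨hA'.2.2, hB'.2.2⟩⟩
          rintro ⟨⟨x, y, z, h, rfl⟩ | ⟨x, y, z, h, rfl⟩, hne⟩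
          · refine ⟨x, y, z, ?_, rfl⟩
            by_cases h0 : X₂ x y z = 0
            · rw [e]; simpa [h0] using h
            · exact absurd (hab3 x y z h h0) hne
          · refine ⟨x, y, z, ?_, rfl⟩
            by_cases h0 : X₁ x y z = 0
            · rw [e]; simpa [h0] using h
            · exact absurd (hab3 x y z h0 h) hne
      · intro s hs'
        rw [g2, Option.some_inj] at hs'
        rw [← hs']
        exact subset_insert _ _
      · intro s hs1 s' hs2 x hx
        rw [mem_inter] at hx
        obtain ⟨x1, x2, x3, x4, q1, rfl⟩ := (m1 s).1 hs1
        obtain ⟨y1, y2, y3, y4, q2, rfl⟩ := (m2 s').1 hs2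
        have hA' := S1 _ _ _ _ q1
        have hB' := S2 _ _ _ _ q2
        have hxA : A x := by
          have := hx.1
          simp only [mem_insert, mem_singleton] at this
          rcases this with rfl | rfl | rfl | rfl
          exacts [hA'.1, hA'.2.1, hA'.2.2.1, hA'.2.2.2]
        have hxB : B x := by
          have := hx.2
          simp only [mem_insert, mem_singleton] at this
          rcases this with rfl | rfl | rfl | rfl
          exacts [hB'.1, hB'.2.1, hB'.2.2.1, hB'.2.2.2]
        have := (hs x).1 ⟨hxA, hxB⟩
        simpa using this
    · intro s
      rw [List.mem_append, m1, m2, hcells, or_comm]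
    · rw [List.getLast?_append, g1]; rfl

end TautFilling

/-! ### The induction: shellings of taut fillings -/

namespace TautFilling

open Finset

variable {Ω : Type*} [DecidableEq Ω]

lemma card_quad {a b c d : Ω} (h : Dist₄ a b c d) : ({a, b, c, d} : Finset Ω).card = 4 := by
  obtain ⟨d1, d2, d3, d4, d5, d6⟩ := h
  rw [card_insert_of_notMem (by simp [*]), card_insert_of_notMem (by simp [*]), card_pair d6]

lemma quad_eq_of_mem {a b c d p q x y : Ω} (h : Dist₄ a b c d)
    (ha : a = p ∨ a = q ∨ a = x ∨ a = y) (hb : b = p ∨ b = q ∨ b = x ∨ b = y)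
    (hc : c = p ∨ c = q ∨ c = x ∨ c = y) (hd : d = p ∨ d = q ∨ d = x ∨ d = y) :
    ({a, b, c, d} : Finset Ω) = {p, q, x, y} := by
  refine eq_of_subset_of_card_le ?_ (card_le_four.trans (card_quad h).ge)
  simp only [insert_subset_iff, singleton_subset_iff, mem_insert, mem_singleton]
  exact ⟨ha, hb, hc, hd⟩

lemma quad_rot (a b c d : Ω) : ({d, a, b, c} : Finset Ω) = {a, b, c, d} := by
  ext z
  simp only [mem_insert, mem_singleton]
  rw [or_comm, or_assoc, or_assoc]

lemma exists_triple {s : Finset Ω} (hs : s.card = 3) {x y : Ω} (hxy : x ≠ y)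
    (h : ({x, y} : Finset Ω) ⊆ s) : ∃ r, ({x, y, r} : Finset Ω) = s := by
  have hc : (s \ {x, y}).card = 1 := by rw [card_sdiff_of_subset h, hs, card_pair hxy]
  obtain ⟨r, hr⟩ := card_eq_one.1 hc
  refine ⟨r, ?_⟩
  rw [← union_sdiff_of_subset h, hr, insert_union, ← insert_eq]

lemma exists_quad {s : Finset Ω} (hs : s.card = 4) {x y : Ω} (hxy : x ≠ y)
    (h : ({x, y} : Finset Ω) ⊆ s) : ∃ u w, ({x, y, u, w} : Finset Ω) = s := by
  have hc : (s \ {x, y}).card = 2 := by rw [card_sdiff_of_subset h, hs, card_pair hxy]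
  obtain ⟨u, w, -, hr⟩ := card_eq_two.1 hc
  refine ⟨u, w, ?_⟩
  rw [← union_sdiff_of_subset h, hr, insert_union, ← insert_eq]

/-- An even permutation exchanges the roles of the opposite edges `pq` and `xy`: an ear removed
along the faces at `pq` is a closing tetrahedron along the new faces at `xy`. -/
lemma tet_swap_pairs {p q x y : Ω} (hd : Dist₄ y p q x) : tet y p q x = tet q x y p := by
  obtain ⟨d1, d2, d3, d4, d5, d6⟩ := hd
  have hd' : Dist₄ q x y p := ⟨d6, d2.symm, d4.symm, d3.symm, d5.symm, d1⟩
  have hT := isAlt₄_tet y p q x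
  have h1 : tet y p q x q x y p = 1 := by
    have e1 := hT.swap_mid q y x p
    have e2 := hT.swap_left y q x p
    have e3 := hT.swap_right y q p x
    have e4 := hT.swap_mid y p q x
    rw [e1, e2, e3, e4, tet_self ⟨d1, d2, d3, d4, d5, d6⟩]
    norm_num
  have hset : ({y, p, q, x} : Finset Ω) = {q, x, y, p} := by
    rw [quad_rot, quad_rot]
  funext a b c d
  by_cases h : ({a, b, c, d} : Finset Ω) = {q, x, y, p}
  · rw [hT.eq_mul_tet hd' h, h1, mul_one]
  · have e1 : tet q x y p a b c d = 0 := by_contra fun h' => h (tet_support h')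
    have e2 : tet y p q x a b c d = 0 := by_contra fun h' => h ((tet_support h').trans hset)
    rw [e1, e2]

variable [Fintype Ω]

/-- The filling obtained by removing an ear is closed up by the ear. -/
lemma isClosing_ear_removal {M : Ω → Ω → Ω → Ω → ℤ} (hT : Taut M) (hM : IsAlt₄ M)
    (hX : IsSph (bd₃ M)) {p q x y : Ω}
    (hxy : x ≠ y) (hx : 0 < M y p q x * bd₃ M p q x) (hy : bd₃ M p q y ≠ 0)
    (hno : ∀ z, bd₃ M x y z = 0) :
    IsClosing (M - bd₃ M p q x • tet y p q x) (bd₃ M p q x) p q x y := by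
  obtain ⟨m1, m2, m3, m4⟩ := ear_removal hM hX hxy hx hy hno
  have hd := hM.dist (left_ne_zero_of_mul hx.ne')
  have h0 : bd₃ M p q x ≠ 0 := right_ne_zero_of_mul hx.ne'
  obtain ⟨v1, v2, v3, v4⟩ := bd₃_tet_values hd
  have hB := (isAlt₄_tet y p q x).bd
  refine ⟨m1, ?_, hX.eq_or h0, ?_, m3, ?_, ?_⟩
  · rw [← tet_swap_pairs hd, sub_add_cancel]; exact hT
  · refine m2.mul_nonneg (hX.eq_or h0) ?_
    have : M q x y p = M y p q x := by
      rw [hM.eq_mul_tet hd (x := q) (y := x) (z := y) (w := p), tet_swap_pairs hd, tet_self, one_mul]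
      · obtain ⟨d1, d2, d3, d4, d5, d6⟩ := hd
        exact ⟨d6, d2.symm, d4.symm, d3.symm, d5.symm, d1⟩
      · rw [quad_rot, quad_rot]
    rw [this, mul_comm]; exact hx.le
  · rw [bd₃_sub, bd₃_smul]
    simp [hno, hB.rot p x y, v3]
  · rw [bd₃_sub, bd₃_smul]
    simp [hno, hB.rot q x y, v4]

/-- The base case. The sphere has only four vertices and a taut filling has no others, so `M` is a
multiple of one tetrahedron, and the boundary coefficients make the multiple `±1`. -/
lemma shellable_tetrahedron {M : Ω → Ω → Ω → Ω → ℤ} (hT : Taut M) (hM : IsAlt₄ M)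
    (hX : IsSph (bd₃ M)) {p q x y : Ω} (hxy : x ≠ y) (hx : bd₃ M p q x ≠ 0)
    (hy : bd₃ M p q y ≠ 0) (h3 : bd₃ M p x y ≠ 0) (h4 : bd₃ M q x y ≠ 0) :
    Shellable M (faces (bd₃ M)) := by
  have dx := hX.alt.dist hx
  have dy := hX.alt.dist hy
  have hd : Dist₄ p q x y := ⟨dx.1, dx.2.1, dy.2.1, dx.2.2, dy.2.2, hxy⟩
  have hd' : Dist₄ y p q x := ⟨dy.2.1.symm, dy.2.2.symm, hxy.symm, dx.1, dx.2.1, dx.2.2⟩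
  have hsupp : ∀ a b c d, M a b c d ≠ 0 → (a = p ∨ a = q ∨ a = x ∨ a = y) := by
    intro a b c d h
    by_contra ha
    refine h (hT.eq_zero_of_interior hM (fun u w => ?_) b c d)
    by_contra hu
    exact ha (hX.tetrahedron hx hy h3 h4 hu).1
  have hcell : ∀ a b c d, M a b c d ≠ 0 → ({a, b, c, d} : Finset Ω) = {p, q, x, y} := by
    intro a b c d h
    have g2 := hsupp b a c d (by rw [hM.swap_left]; simpa)
    have g3 := hsupp c a b d (by rw [hM.swap_left, hM.swap_mid]; simpa)
    have g4 := hsupp d a b c (by rw [hM.swap_left, hM.swap_mid, hM.swap_right]; simpa)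
    exact quad_eq_of_mem (hM.dist h) (hsupp a b c d h) g2 g3 g4
  have hM0 : M p q x y ≠ 0 := by
    obtain ⟨w, hw⟩ := exists_ne_zero_of_bd₃ hx
    exact hM.ne_zero hw (hcell _ _ _ _ hw).symm
  have hle : |M p q x y| ≤ 1 := by
    have h1 : bd₃ M p q x = M y p q x := by
      refine sum_eq_single y (fun w _ hw => ?_) (by simp)
      by_contra h0
      have hd0 := hM.dist h0
      rcases hsupp _ _ _ _ h0 with h | h | h | h
      exacts [hd0.1 h, hd0.2.1 h, hd0.2.2.1 h, hw h]
    rw [← hM.abs_eq hd (quad_rot p q x y), ← h1]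
    exact hX.le_one p q x
  refine ⟨fun a b c d => ?_, fun t ht => ⟨[{p, q, x, y}], ?_, ?_, ?_⟩⟩
  · by_cases h : M a b c d = 0
    · rw [h]; simp
    · rw [hM.abs_eq hd (hcell _ _ _ _ h)]; exact hle
  · refine (congrArg (Shells [({p, q, x, y} : Finset Ω)]) ?_).mpr (Shells.single _ (card_quad hd))
    ext f
    constructor
    · rintro ⟨a, b, c, h, rfl⟩
      obtain ⟨g1, g2, g3⟩ := hX.tetrahedron hx hy h3 h4 h
      obtain ⟨i1, i2, i3⟩ := hX.alt.dist h
      refine ⟨?_, ?_⟩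
      · simp only [insert_subset_iff, singleton_subset_iff, mem_insert, mem_singleton]
        exact ⟨g1, g2, g3⟩
      · rw [card_insert_of_notMem (by simp [*]), card_pair i3]
    · rintro ⟨hf, hc⟩
      obtain ⟨a, b, c, i1, i2, i3, rfl⟩ := card_eq_three.1 hc
      refine ⟨a, b, c, ?_, rfl⟩
      simp only [insert_subset_iff, mem_insert, mem_singleton, singleton_subset_iff] at hf
      exact tetrahedron_faces hX.alt hx hy h3 h4 i1 i2 i3 hf.1 hf.2.1 hf.2.2
  · intro s
    rw [List.mem_singleton]
    constructor
    · rintro rfl; exact ⟨p, q, x, y, hM0, rfl⟩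
    · rintro ⟨a, b, c, d, h, rfl⟩; exact hcell _ _ _ _ h
  · obtain ⟨a, b, c, d, h, rfl⟩ := ht
    simp [hcell _ _ _ _ h]

/-- If no two adjacent boundary faces have adjacent tips, there is an ear other than a given
cell. -/
lemma exists_ear_ne {M : Ω → Ω → Ω → Ω → ℤ} (hT : Taut M) (hM : IsAlt₄ M) (hX : IsSph (bd₃ M))
    (hno : ∀ p q x y, x ≠ y → bd₃ M p q x ≠ 0 → bd₃ M p q y ≠ 0 → ∀ z, bd₃ M x y z = 0)
    (t : Finset Ω) :
    ∃ p q x y, x ≠ y ∧ 0 < M y p q x * bd₃ M p q x ∧ bd₃ M p q y ≠ 0 ∧ t ≠ {p, q, x, y} := by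
  by_cases h2 : ∃ p q x y, x ≠ y ∧ bd₃ M p q x ≠ 0 ∧ bd₃ M p q y ≠ 0 ∧ t = {p, q, x, y}
  · obtain ⟨p, q, x, y, hxy, hx, hy, rfl⟩ := h2
    -- If `t` is spanned by two faces at `pq`, the new ear is taken with faces off `pq`. On the same
    -- four vertices, such a face would contain `xy`, which is not an edge of the sphere.
    obtain ⟨p', q', x', y', hxy', hx', hy', r1, r2⟩ :=
      exists_ear hX hT hM rfl ⟨q, x, hx⟩ (hX.alt.dist hx).1
    have hx0' := right_ne_zero_of_mul hx'.ne'
    refine ⟨p', q', x', y', hxy', hx', right_ne_zero_of_mul hy'.ne', fun he => ?_⟩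
    have hz := hno p q x y hxy hx hy
    obtain ⟨i1, i2, i3⟩ := hX.alt.dist hx0'
    have m1 : p' ∈ ({p, q, x, y} : Finset Ω) := by rw [he]; simp
    have m2 : q' ∈ ({p, q, x, y} : Finset Ω) := by rw [he]; simp
    have m3 : x' ∈ ({p, q, x, y} : Finset Ω) := by rw [he]; simp
    simp only [mem_insert, mem_singleton] at m1 m2 m3 r1
    clear hno he r2
    have hmem : (x = p' ∨ x = q' ∨ x = x') ∧ (y = p' ∨ y = q' ∨ y = x') := by
      grind
    have key : ∃ r, ({x, y, r} : Finset Ω) = {p', q', x'} := by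
      obtain ⟨u, v⟩ := hmem
      rcases u with rfl | rfl | rfl <;> rcases v with rfl | rfl | rfl
      · exact absurd rfl hxy
      · exact ⟨x', rfl⟩
      · exact ⟨q', by rw [pair_comm]⟩
      · exact ⟨x', by rw [insert_comm]⟩
      · exact absurd rfl hxy
      · exact ⟨p', by rw [triple_rot]⟩
      · exact ⟨q', by rw [triple_rot']⟩
      · exact ⟨p', by rw [triple_rot p' x y, pair_comm]⟩
      · exact absurd rfl hxy
    obtain ⟨r, hr⟩ := key
    exact hX.alt.ne_zero hx0' hr (hz r)
  · obtain ⟨a, b, c, hc⟩ := hX.nonzero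
    obtain ⟨p, q, x, y, hxy, hx, hy, -, -⟩ :=
      exists_ear hX hT hM rfl ⟨b, c, hc⟩ (hX.alt.dist hc).1
    exact ⟨p, q, x, y, hxy, hx, right_ne_zero_of_mul hy.ne', fun he =>
      h2 ⟨p, q, x, y, hxy, right_ne_zero_of_mul hx.ne', right_ne_zero_of_mul hy.ne', he⟩⟩

/-- Adding an ear to a shellable filling. -/
lemma shells_of_ear {M : Ω → Ω → Ω → Ω → ℤ} (hT : Taut M) (hM : IsAlt₄ M)
    (hX : IsSph (bd₃ M)) {p q x y : Ω}
    (hxy : x ≠ y) (hx : 0 < M y p q x * bd₃ M p q x) (hy : bd₃ M p q y ≠ 0)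
    (hz : ∀ z, bd₃ M x y z = 0) (ih : Shellable (M - bd₃ M p q x • tet y p q x)
      (faces (bd₃ (M - bd₃ M p q x • tet y p q x)))) :
    (∀ a b c d, |M a b c d| ≤ 1) ∧ ∀ t ∈ cells M, t ≠ {p, q, x, y} →
      ∃ l : List (Finset Ω), Shells l (faces (bd₃ M)) ∧
        (∀ s, s ∈ l ↔ s ∈ cells M) ∧ l.getLast? = some t := by
  have hx0 := right_ne_zero_of_mul hx.ne'
  obtain ⟨m1, m2, m3, -⟩ := ear_removal hM hX hxy hx hy hz
  -- No tetrahedron of `M'` contains the edge `pq`. In particular the ear itself is gone from `M'`,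
  -- which gives its coefficient in `M`.
  have hpq := (isClosing_ear_removal hT hM hX hxy hx hy hz).not_mem
  have hfl := fun u v w => hX.flip_support hx0 hy hxy hz u v w
  rw [← bd₃_smul, ← bd₃_sub] at hfl
  have hd' := hM.dist (left_ne_zero_of_mul hx.ne')
  obtain ⟨d1, d2, d3, d4, d5, d6⟩ := id hd'
  have hd : Dist₄ p q x y := ⟨d4, d5, d1.symm, d6, d2.symm, d3.symm⟩
  set M' := M - bd₃ M p q x • tet y p q x with hM'
  have hval : ∀ a b c d, ({a, b, c, d} : Finset Ω) ≠ {p, q, x, y} →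
      M' a b c d = M a b c d := by
    intro a b c d h
    have : tet y p q x a b c d = 0 :=
      by_contra fun h' => h ((tet_support h').trans (quad_rot _ _ _ _))
    simp [hM', this]
  have hM0' : M' p q x y = 0 := hpq x y
  have hMe : M y p q x = bd₃ M p q x := by
    have h1 : M' y p q x = 0 := by
      by_contra h1
      exact m1.ne_zero h1 (quad_rot _ _ _ _).symm hM0'
    simp only [hM', Pi.sub_apply, Pi.smul_apply, tet_self hd', smul_eq_mul, mul_one] at h1
    linarith
  have hM0 : M p q x y ≠ 0 := hM.ne_zero (hMe ▸ hx0) (quad_rot _ _ _ _).symm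
  have hcells : ∀ s, s ∈ cells M ↔ s = {p, q, x, y} ∨ s ∈ cells M' := by
    intro s
    constructor
    · rintro ⟨a, b, c, d, h, rfl⟩
      by_cases he : ({a, b, c, d} : Finset Ω) = {p, q, x, y}
      · exact Or.inl he
      · exact Or.inr ⟨a, b, c, d, by rw [hval _ _ _ _ he]; exact h, rfl⟩
    · rintro (rfl | ⟨a, b, c, d, h, rfl⟩)
      · exact ⟨p, q, x, y, hM0, rfl⟩
      · exact ⟨a, b, c, d, fun h0 => h (m2.eq_zero h0), rfl⟩
  refine ⟨fun a b c d => ?_, fun t ht hne => ?_⟩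
  · by_cases he : ({a, b, c, d} : Finset Ω) = {p, q, x, y}
    · rw [hM.abs_eq hd he, ← hM.abs_eq hd (quad_rot p q x y), hMe]
      exact hX.le_one p q x
    · rw [← hval _ _ _ _ he]; exact ih.1 a b c d
  · obtain ⟨l, hl, hml, hlast⟩ := ih.2 t (((hcells t).1 ht).resolve_left hne)
    have hxyno : ∀ u v w, bd₃ M u v w ≠ 0 → ¬ ({x, y} : Finset Ω) ⊆ {u, v, w} := by
      intro u v w h hsub
      obtain ⟨i1, i2, i3⟩ := hX.alt.dist h
      obtain ⟨r, hr⟩ := exists_triple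
        (by rw [card_insert_of_notMem (by simp [*]), card_pair i3]) hxy hsub
      exact hX.alt.ne_zero h hr (hz r)
    have hAB : ({p, q} ∪ {x, y} : Finset Ω) = {p, q, x, y} := by
      rw [insert_union, ← insert_eq]
    have ep : ({p, q, x, y} : Finset Ω).erase p = {q, x, y} :=
      erase_insert (by simp [d4, d5, d1.symm])
    have eq : ({p, q, x, y} : Finset Ω).erase q = {p, x, y} := by
      rw [insert_comm]; exact erase_insert (by simp [d4.symm, d6, d2.symm])
    have ex : ({p, q, x, y} : Finset Ω).erase x = {p, q, y} := by
      rw [pair_comm x y, ← quad_rot]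
      exact erase_insert (by simp [d5.symm, d6.symm, d3.symm])
    have ey : ({p, q, x, y} : Finset Ω).erase y = {p, q, x} := by
      rw [← quad_rot]; exact erase_insert (by simp [d1, d2, d3])
    have hpq0 : ∀ s ∈ l, ¬ ({p, q} : Finset Ω) ⊆ s := by
      intro s hs hsub
      obtain ⟨u, w, rfl⟩ := exists_quad (hl.card_eq s hs) d4 hsub
      exact (mem_cells_iff m1).1 ((hml _).1 hs) (hpq u w)
    -- The ear is attached along `qxy` and `pxy`, opposite to `p` and `q`; its new edge is `pq`.
    have key := Shells.cons l _ {p, q} {x, y} hl ?_ (by simp) (by simp)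
      (by rw [hAB]; exact card_quad hd) hpq0 ?_ ?_
    · rw [hAB] at key
      refine ⟨_, (congrArg (Shells _) ?_).mpr key, ?_, ?_⟩
      · ext f
        constructor
        · rintro ⟨u, v, w, h, rfl⟩
          by_cases h1 : ({u, v, w} : Finset Ω) = {p, q, x}
          · exact Or.inr ⟨y, by simp, by rw [h1, ey]⟩
          by_cases h2 : ({u, v, w} : Finset Ω) = {p, q, y}
          · exact Or.inr ⟨x, by simp, by rw [h2, ex]⟩
          refine Or.inl ⟨⟨u, v, w, (hfl u v w).2 (Or.inl ⟨h, h1, h2⟩), rfl⟩, hxyno u v w h⟩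
        · rintro (⟨⟨u, v, w, h, rfl⟩, hsub⟩ | ⟨b, hb, rfl⟩)
          · rcases (hfl u v w).1 h with h | h | h
            · exact ⟨u, v, w, h.1, rfl⟩
            · rw [h] at hsub; exact absurd (by simp) hsub
            · rw [h] at hsub; exact absurd (by simp) hsub
          · simp only [mem_insert, mem_singleton] at hb
            rcases hb with rfl | rfl
            · exact ⟨p, q, y, hy, ex⟩
            · exact ⟨p, q, x, hx0, ey⟩
      · intro s
        rw [List.mem_cons, hcells, hml]
      · rw [List.getLast?_cons, hlast]; rfl
    · simp only [disjoint_insert_left, disjoint_singleton_left, mem_insert, mem_singleton]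
      exact ⟨by simp [d5, d1.symm], by simp [d6, d2.symm]⟩
    · intro a ha
      rw [hAB]
      simp only [mem_insert, mem_singleton] at ha
      rcases ha with rfl | rfl
      · rw [ep]; exact ⟨q, x, y, (hfl _ _ _).2 (Or.inr (Or.inr rfl)), rfl⟩
      · rw [eq]; exact ⟨p, x, y, (hfl _ _ _).2 (Or.inr (Or.inl rfl)), rfl⟩
    · rintro f ⟨u, v, w, h, rfl⟩ hsub
      rw [hAB]
      rcases (hfl u v w).1 h with h | h | h
      · exact absurd hsub (hxyno u v w h.1)
      · exact ⟨q, by simp, by rw [eq, h]⟩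
      · exact ⟨p, by simp, by rw [ep, h]⟩

/-- Taut fillings of spheres have coefficients `0, ±1`, and are shellable from any tetrahedron. -/
theorem shellable_of_taut : ∀ {M : Ω → Ω → Ω → Ω → ℤ}, IsAlt₄ M → Taut M → IsSph (bd₃ M) →
    Shellable M (faces (bd₃ M)) := by
  suffices H : ∀ (n : ℕ) (M : Ω → Ω → Ω → Ω → ℤ), (nrm M).toNat < n → IsAlt₄ M → Taut M →
      IsSph (bd₃ M) → Shellable M (faces (bd₃ M)) from
    fun {M} h1 h2 h3 => H _ M (Nat.lt_succ_self _) h1 h2 h3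
  intro n
  induction n with
  | zero => intro M h; omega
  | succ n ih =>
  intro M hn hM hT hX
  have ih' : ∀ N : Ω → Ω → Ω → Ω → ℤ, nrm N < nrm M → IsAlt₄ N → Taut N →
      IsSph (bd₃ N) → Shellable N (faces (bd₃ N)) := fun N hN =>
    ih N (by have := nrm_nonneg N; omega)
  by_cases hsep : ∀ a b c, (∃ d, bd₃ M a b d ≠ 0) → (∃ d, bd₃ M b c d ≠ 0) →
    (∃ d, bd₃ M c a d ≠ 0) → bd₃ M a b c ≠ 0
  · by_cases htet : ∃ p q x y, x ≠ y ∧ bd₃ M p q x ≠ 0 ∧ bd₃ M p q y ≠ 0 ∧ bd₃ M p x y ≠ 0 ∧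
      bd₃ M q x y ≠ 0
    · obtain ⟨p, q, x, y, hxy, hx, hy, h3, h4⟩ := htet
      exact shellable_tetrahedron hT hM hX hxy hx hy h3 h4
    · have hno : ∀ p q x y, x ≠ y → bd₃ M p q x ≠ 0 → bd₃ M p q y ≠ 0 → ∀ z, bd₃ M x y z = 0 := by
        intro p q x y hxy hx hy
        rcases hX.tips hsep hx hy with h | h
        · exact h
        · exact absurd ⟨p, q, x, y, hxy, hx, hy, h.1, h.2⟩ htet
      have step := fun p q x y hxy hx hy =>
        have hz := hno p q x y hxy (right_ne_zero_of_mul (ne_of_gt hx)) hy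
        have hr := ear_removal hM hX hxy hx hy hz
        shells_of_ear hT hM hX hxy hx hy hz (ih' _ hr.2.2.2 hr.1
          (hT.of_isPart hM hr.1 hr.2.1) hr.2.2.1)
      -- Any ear serves for the coefficient bound; `∅` is a dummy.
      obtain ⟨p, q, x, y, hxy, hx, hy, -⟩ := exists_ear_ne hT hM hX hno ∅
      refine ⟨(step p q x y hxy hx hy).1, fun t ht => ?_⟩
      -- The removed ear becomes the last tetrahedron of the shelling, so it must differ from the
      -- prescribed first one.
      obtain ⟨p, q, x, y, hxy, hx, hy, he⟩ := exists_ear_ne hT hM hX hno t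
      exact (step p q x y hxy hx hy).2 t ht he
  · push Not at hsep
    obtain ⟨x, y, z, hxy, hyz, hzx, h0⟩ := hsep
    obtain ⟨X₁, X₂, A, B, s1, s2, e, hAB, hs, hA, hB, n1, n2⟩ := hX.split h0 hxy hyz hzx
    obtain ⟨M₁, M₂, a1, a2, t1, t2, p1, p2, eM, b1, b2, l1, l2, S1, S2⟩ :=
      hT.exists_parts hM s1 s2 e hAB (s1.alt.dist n1).1 hs hA hB
    have H1 := ih' M₁ l1 a1 t1 (b1 ▸ s1)
    have H2 := ih' M₂ l2 a2 t2 (b2 ▸ s2)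
    rw [b1] at H1
    rw [b2] at H2
    obtain ⟨q1, q2, q3⟩ := Shellable.of_parts hX.alt s1.alt s2.alt h0 e n1 n2 eM b2 a1 a2 hs hA hB
      S1 S2 H1 H2
    obtain ⟨-, -, q4⟩ := Shellable.of_parts hX.alt s2.alt s1.alt h0 (e.trans (add_comm _ _)) n2 n1
      (eM.trans (add_comm _ _)) b1 a2 a1 (fun x => by rw [and_comm]; exact hs x) hB hA S2 S1 H2 H1
    refine ⟨q1, fun t ht => ?_⟩
    rcases (q2 t).1 ht with h | h
    exacts [q3 t h, q4 t h]

end TautFilling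

/-! ### Geometric carriers and the single tetrahedron -/

namespace TautFilling

open Finset Metric

section Body

variable {Ω : Type*} [Fintype Ω]

/-- The union of the geometric simplices spanned by the members of `T`. -/
def body (T : Set (Finset Ω)) : Set (Ω → ℝ) :=
  {x | x ∈ stdSimplex ℝ Ω ∧ ∃ t ∈ T, ∀ v, v ∉ t → x v = 0}

lemma carrier_generatedBy (T : Set (Finset Ω)) : carrier (generatedBy T) = body T := by
  ext x
  constructor
  · rintro ⟨hx, s, ⟨hs, t, ht, hst⟩, h⟩
    exact ⟨hx, t, ht, fun v hv => h v fun hvs => hv (hst hvs)⟩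
  · rintro ⟨hx, t, ht, h⟩
    refine ⟨hx, t, ⟨?_, t, ht, Subset.rfl⟩, h⟩
    rw [nonempty_iff_ne_empty]
    rintro rfl
    have := hx.2
    rw [sum_eq_zero (fun v _ => h v (by simp))] at this
    exact zero_ne_one this

lemma isCompact_body (T : Set (Finset Ω)) : IsCompact (body T) := by
  have : body T = stdSimplex ℝ Ω ∩ ⋃ t ∈ T, {x : Ω → ℝ | ∀ v, v ∉ t → x v = 0} := by
    ext x
    simp only [body, Set.mem_inter_iff, Set.mem_iUnion, exists_prop]
    rfl
  rw [this]
  refine (isCompact_stdSimplex ℝ Ω).inter_right ?_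
  refine T.toFinite.isClosed_biUnion fun t _ => ?_
  have : {x : Ω → ℝ | ∀ v, v ∉ t → x v = 0} = ⋂ v, ⋂ (_ : v ∉ t), {x : Ω → ℝ | x v = 0} := by
    ext x
    simp only [Set.mem_iInter]
    rfl
  rw [this]
  exact isClosed_iInter fun v => isClosed_iInter fun _ =>
    isClosed_eq (continuous_apply v) continuous_const

/-- A continuous injective map on a compact set has a continuous inverse. -/
lemma exists_continuousOn_inverse {X Y : Type*} [TopologicalSpace X] [TopologicalSpace Y]
    [T2Space Y] [Nonempty X] {K : Set X} (hK : IsCompact K) {f : X → Y}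
    (hf : ContinuousOn f K) (hi : Set.InjOn f K) :
    ∃ g : Y → X, ContinuousOn g (f '' K) ∧ ∀ x ∈ K, g (f x) = x := by
  refine ⟨Function.invFunOn f K, ?_, fun x hx => hi.leftInvOn_invFunOn hx⟩
  rw [continuousOn_iff_isClosed]
  intro t ht
  refine ⟨f '' (K ∩ t), ?_, ?_⟩
  · exact ((hK.inter_right ht).image_of_continuousOn (hf.mono Set.inter_subset_left)).isClosed
  · ext y
    constructor
    · rintro ⟨h1, x, hx, rfl⟩
      refine ⟨⟨x, ⟨hx, ?_⟩, rfl⟩, ⟨x, hx, rfl⟩⟩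
      have := hi.leftInvOn_invFunOn hx
      rw [Set.mem_preimage, this] at h1
      exact h1
    · rintro ⟨⟨x, ⟨hx, hxt⟩, rfl⟩, hy⟩
      refine ⟨?_, hy⟩
      rw [Set.mem_preimage, hi.leftInvOn_invFunOn hx]
      exact hxt

/-- `f` maps the body of `N` homeomorphically to the unit ball, and the body of `F` to the unit
sphere. -/
structure IsBallMap {V : Type*} [NormedAddCommGroup V] (N F : Set (Finset Ω)) (f : (Ω → ℝ) → V) :
    Prop where
  cont : ContinuousOn f (body N)
  inj : Set.InjOn f (body N)
  image : f '' body N = closedBall 0 1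
  norm_eq : ∀ x ∈ body N, ‖f x‖ = 1 ↔ x ∈ body F

lemma IsBallMap.isBall3 {N F : Set (Finset Ω)} {f : (Ω → ℝ) → EuclideanSpace ℝ (Fin 3)}
    (h : IsBallMap N F f) : IsBall3 (generatedBy N) := by
  unfold IsBall3
  rw [carrier_generatedBy]
  have hm : ∀ x : body N, f x ∈ closedBall (0 : EuclideanSpace ℝ (Fin 3)) 1 := fun x => by
    rw [← h.image]; exact ⟨x, x.2, rfl⟩
  let g : body N → closedBall (0 : EuclideanSpace ℝ (Fin 3)) 1 := fun x => ⟨f x, hm x⟩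
  have hg : Function.Bijective g := by
    constructor
    · intro x y hxy
      exact Subtype.ext (h.inj x.2 y.2 (congrArg Subtype.val hxy))
    · rintro ⟨y, hy⟩
      rw [← h.image] at hy
      obtain ⟨x, hx, rfl⟩ := hy
      exact ⟨⟨x, hx⟩, rfl⟩
  have hc : Continuous g := (continuousOn_iff_continuous_domRestrict.1 h.cont).subtype_mk hm
  have : CompactSpace (body N) := isCompact_iff_compactSpace.1 (isCompact_body N)
  exact ⟨Continuous.homeoOfEquivCompactToT2 (f := Equiv.ofBijective g hg) hc⟩

end Body

section Simplex

/-- The interior of the solid corner simplex. -/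
lemma interior_corner : interior {z : EuclideanSpace ℝ (Fin 3) | (∀ i, 0 ≤ z i) ∧ ∑ i, z i ≤ 1} =
    {z | (∀ i, 0 < z i) ∧ ∑ i, z i < 1} := by
  have h1 : ∀ i : Fin 3, interior {z : EuclideanSpace ℝ (Fin 3) | 0 ≤ z i} = {z | 0 < z i} := by
    intro i
    have ho : IsOpenMap (EuclideanSpace.proj (𝕜 := ℝ) i) :=
      (EuclideanSpace.proj (𝕜 := ℝ) i).isOpenMap fun r => ⟨EuclideanSpace.single i r, by simp⟩
    have := ho.preimage_interior_eq_interior_preimage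
      (EuclideanSpace.proj (𝕜 := ℝ) i).continuous (Set.Ici 0)
    rw [interior_Ici] at this
    exact this.symm
  have h2 : interior {z : EuclideanSpace ℝ (Fin 3) | ∑ i, z i ≤ 1} = {z | ∑ i, z i < 1} := by
    let S : EuclideanSpace ℝ (Fin 3) →L[ℝ] ℝ := ∑ i, EuclideanSpace.proj (𝕜 := ℝ) i
    have hS : ∀ z, S z = ∑ i, z i := fun z => by simp [S]
    have ho : IsOpenMap S := S.isOpenMap fun r => ⟨EuclideanSpace.single 0 r, by simp [hS]⟩
    have := ho.preimage_interior_eq_interior_preimage S.continuous (Set.Iic 1)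
    rw [interior_Iic] at this
    have e1 : {z : EuclideanSpace ℝ (Fin 3) | ∑ i, z i ≤ 1} = S ⁻¹' Set.Iic 1 := by
      ext z; rw [Set.mem_preimage, hS]; rfl
    have e2 : {z : EuclideanSpace ℝ (Fin 3) | ∑ i, z i < 1} = S ⁻¹' Set.Iio 1 := by
      ext z; rw [Set.mem_preimage, hS]; rfl
    rw [e1, e2, this]
  have e1 : {z : EuclideanSpace ℝ (Fin 3) | (∀ i, 0 ≤ z i) ∧ ∑ i, z i ≤ 1} =
      (⋂ i, {z | 0 ≤ z i}) ∩ {z | ∑ i, z i ≤ 1} := by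
    ext z
    rw [Set.mem_inter_iff, Set.mem_iInter]; rfl
  rw [e1, interior_inter, interior_iInter_of_finite, h2]
  simp_rw [h1]
  ext z
  rw [Set.mem_inter_iff, Set.mem_iInter]; rfl

lemma isClosed_corner :
    IsClosed {z : EuclideanSpace ℝ (Fin 3) | (∀ i, 0 ≤ z i) ∧ ∑ i, z i ≤ 1} := by
  have e1 : {z : EuclideanSpace ℝ (Fin 3) | (∀ i, 0 ≤ z i) ∧ ∑ i, z i ≤ 1} =
      (⋂ i, {z | 0 ≤ z i}) ∩ {z | ∑ i, z i ≤ 1} := by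
    ext z
    rw [Set.mem_inter_iff, Set.mem_iInter]; rfl
  rw [e1]
  refine (isClosed_iInter fun i => isClosed_le continuous_const (by fun_prop)).inter
    (isClosed_le (by fun_prop) continuous_const)

variable {Ω : Type*} [Fintype Ω] [DecidableEq Ω]

/-- A single tetrahedron is a ball, bounded by its faces. -/
lemma exists_isBallMap_single {t : Finset Ω} (ht : t.card = 4) :
    ∃ f : (Ω → ℝ) → EuclideanSpace ℝ (Fin 3),
      IsBallMap {t} {f | f ⊆ t ∧ f.card = 3} f := by
  set S := {z : EuclideanSpace ℝ (Fin 3) | (∀ i, 0 ≤ z i) ∧ ∑ i, z i ≤ 1} with hS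
  have hconv : Convex ℝ S := by
    rintro x ⟨hx1, hx2⟩ y ⟨hy1, hy2⟩ a b ha hb hab
    refine ⟨fun i => ?_, ?_⟩
    · have := hx1 i
      have := hy1 i
      simp only [PiLp.add_apply, PiLp.smul_apply, smul_eq_mul]
      positivity
    · simp only [PiLp.add_apply, PiLp.smul_apply, smul_eq_mul, sum_add_distrib, ← mul_sum]
      nlinarith
  have hint : (interior S).Nonempty := by
    rw [interior_corner]
    exact ⟨WithLp.toLp 2 (fun _ => 1 / 4), fun i => by simp, by simp; norm_num⟩
  have hbdd : Bornology.IsBounded S := by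
    refine (isBounded_closedBall (x := (0 : EuclideanSpace ℝ (Fin 3))) (r := 1)).subset ?_
    rintro z ⟨hz1, hz2⟩
    rw [mem_closedBall_zero_iff]
    have : ‖z‖ ^ 2 ≤ 1 := by
      rw [EuclideanSpace.norm_sq_eq]
      refine le_trans (sum_le_sum fun i _ => ?_) hz2
      have hle : z i ≤ 1 := (single_le_sum (f := fun i => z i) (fun i _ => hz1 i) (mem_univ i)).trans hz2
      rw [Real.norm_eq_abs, sq_abs]
      nlinarith [hz1 i]
    nlinarith [norm_nonneg z]
  obtain ⟨h, h1, h2, h3⟩ :=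
    exists_homeomorph_image_interior_closure_frontier_eq_unitBall hconv hint hbdd
  let e := equivFinOfCardEq ht
  -- Dropping the last barycentric coordinate, which the others determine, identifies the
  -- tetrahedron with the corner simplex, a convex body and hence a ball.
  let π : (Ω → ℝ) → EuclideanSpace ℝ (Fin 3) :=
    fun x => WithLp.toLp 2 fun i => x (e.symm i.castSucc)
  have hsum : ∀ x : Ω → ℝ, (∀ v, v ∉ t → x v = 0) →
      ∑ v, x v = ∑ i : Fin 3, x (e.symm i.castSucc) + x (e.symm (Fin.last 3)) := by
    intro x hx
    rw [← Fin.sum_univ_castSucc (fun i : Fin 4 => x (e.symm i)),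
      Equiv.sum_comp e.symm (fun v : t => x v), sum_coe_sort t x]
    exact (sum_subset (subset_univ t) fun v _ hv => hx v hv).symm
  have hval : ∀ v ∈ t, (∃ i : Fin 3, v = e.symm i.castSucc) ∨ v = e.symm (Fin.last 3) := by
    intro v hv
    rcases Fin.eq_castSucc_or_eq_last (e ⟨v, hv⟩) with ⟨i, hi⟩ | hi
    · left; exact ⟨i, by rw [← hi]; simp⟩
    · right; rw [← hi]; simp
  have hbody : ∀ x, x ∈ body {t} ↔ x ∈ stdSimplex ℝ Ω ∧ ∀ v, v ∉ t → x v = 0 := fun x => by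
    constructor
    · rintro ⟨hx, s, rfl, hs⟩; exact ⟨hx, hs⟩
    · rintro ⟨hx, hs⟩; exact ⟨hx, t, rfl, hs⟩
  have hπi : Set.InjOn π (body {t}) := by
    intro x hx y hy hxy
    rw [hbody] at hx hy
    have hi : ∀ i : Fin 3, x (e.symm i.castSucc) = y (e.symm i.castSucc) := fun i =>
      congrFun (congrArg WithLp.ofLp hxy) i
    have hl : x (e.symm (Fin.last 3)) = y (e.symm (Fin.last 3)) := by
      have h1 := hsum x hx.2
      have h2 := hsum y hy.2
      rw [hx.1.2] at h1
      rw [hy.1.2, ← sum_congr rfl fun i _ => hi i] at h2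
      linarith
    funext v
    by_cases hv : v ∈ t
    · rcases hval v hv with ⟨i, rfl⟩ | rfl
      exacts [hi i, hl]
    · rw [hx.2 v hv, hy.2 v hv]
  have hπ : π '' body {t} = S := by
    ext z
    constructor
    · rintro ⟨x, hx, rfl⟩
      rw [hbody] at hx
      refine ⟨fun i => hx.1.1 _, ?_⟩
      have h1 := hsum x hx.2
      rw [hx.1.2] at h1
      have := hx.1.1 (e.symm (Fin.last 3))
      change ∑ i : Fin 3, x (e.symm i.castSucc) ≤ 1
      linarith
    · rintro ⟨hz1, hz2⟩
      let w : Fin 4 → ℝ := Fin.snoc (fun i => z i) (1 - ∑ i, z i)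
      have hwl : w (Fin.last 3) = 1 - ∑ i, z i := Fin.snoc_last _ _
      have hwc : ∀ i : Fin 3, w i.castSucc = z i := fun i => Fin.snoc_castSucc _ _ i
      let x : Ω → ℝ := fun v => if hv : v ∈ t then w (e ⟨v, hv⟩) else 0
      have hx0 : ∀ v, v ∉ t → x v = 0 := fun v hv => dif_neg hv
      have hxe : ∀ i, x (e.symm i) = w i := fun i => by
        simp only [x]
        rw [dif_pos (e.symm i).2]
        simp
      have hw : ∀ i, 0 ≤ w i := by
        intro i
        rcases Fin.eq_castSucc_or_eq_last i with ⟨j, rfl⟩ | rfl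
        · rw [hwc]; exact hz1 j
        · rw [hwl]; linarith
      refine ⟨x, ?_, ?_⟩
      · rw [hbody]
        refine ⟨⟨fun v => ?_, ?_⟩, hx0⟩
        · by_cases hv : v ∈ t
          · simp only [x]; rw [dif_pos hv]; exact hw _
          · rw [hx0 v hv]
        · rw [hsum x hx0, hxe, sum_congr rfl fun i _ => (hxe i.castSucc).trans (hwc i), hwl]
          ring
      · ext i
        change x (e.symm i.castSucc) = z i
        rw [hxe, hwc]
  have hcont : Continuous π := by
    refine (PiLp.continuous_toLp 2 _).comp (continuous_pi fun i => continuous_apply _)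
  refine ⟨h ∘ π, (h.continuous.comp hcont).continuousOn, h.injective.comp_injOn hπi, ?_, ?_⟩
  · rw [Set.image_comp, hπ, ← h2, isClosed_corner.closure_eq]
  · intro x hx
    have hxS : π x ∈ S := hπ ▸ ⟨x, hx, rfl⟩
    have e1 : ‖(h ∘ π) x‖ = 1 ↔ π x ∉ interior S := by
      rw [← mem_sphere_zero_iff_norm, ← h3, Function.comp_apply, h.injective.mem_set_image,
        frontier, isClosed_corner.closure_eq]
      exact ⟨fun h => h.2, fun h => ⟨hxS, h⟩⟩
    rw [e1, hS, interior_corner]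
    rw [hbody] at hx
    have h5 := hsum x hx.2
    rw [hx.1.2] at h5
    constructor
    · intro hn
      have : ∃ b ∈ t, x b = 0 := by
        by_contra! hcon
        refine hn ⟨fun i => ?_, ?_⟩
        · exact lt_of_le_of_ne (hx.1.1 _) (hcon _ (e.symm i.castSucc).2).symm
        · have h6 := lt_of_le_of_ne (hx.1.1 _) (hcon _ (e.symm (Fin.last 3)).2).symm
          change ∑ i : Fin 3, x (e.symm i.castSucc) < 1
          linarith
      obtain ⟨b, hb, hb0⟩ := this
      refine ⟨hx.1, t.erase b, ⟨erase_subset _ _, by rw [card_erase_of_mem hb, ht]⟩, fun v hv => ?_⟩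
      by_cases hvb : v = b
      · rw [hvb, hb0]
      · exact hx.2 v fun hvt => hv (mem_erase.2 ⟨hvb, hvt⟩)
    · rintro ⟨-, f, ⟨hft, hfc⟩, hf⟩ ⟨hn1, hn2⟩
      obtain ⟨b, hb, hbf, -⟩ := exists_eq_erase hft ht hfc
      have hb0 := hf b hbf
      rcases hval b hb with ⟨i, rfl⟩ | rfl
      · exact (hn1 i).ne' hb0
      · change ∑ i : Fin 3, x (e.symm i.castSucc) < 1 at hn2
        linarith

end Simplex

end TautFilling

/-! ### Attaching a tetrahedron to a topological ball -/

namespace TautFilling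

open Finset Metric

/-- Radial rescaling by a continuous function on the unit sphere. -/
lemma continuous_radial {V : Type*} [NormedAddCommGroup V] [NormedSpace ℝ V] {g : V → ℝ}
    (hg : ContinuousOn g (sphere 0 1)) (h1 : ∀ u, 1 ≤ g u) :
    Continuous fun z : V => (g (‖z‖⁻¹ • z))⁻¹ • z := by
  rw [continuous_iff_continuousAt]
  intro z
  by_cases hz : z = 0
  · subst hz
    have h0 : (g (‖(0 : V)‖⁻¹ • (0 : V)))⁻¹ • (0 : V) = 0 := smul_zero _
    rw [ContinuousAt, h0]
    refine squeeze_zero_norm (a := fun z : V => ‖z‖) (fun z => ?_) ?_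
    · rw [norm_smul, norm_inv, Real.norm_eq_abs, abs_of_pos (by linarith [h1 (‖z‖⁻¹ • z)])]
      exact mul_le_of_le_one_left (norm_nonneg _) (inv_le_one_of_one_le₀ (h1 _))
    · exact tendsto_norm_zero
  · have hU : {0}ᶜ ∈ nhds z := isOpen_compl_singleton.mem_nhds hz
    have hn : ContinuousOn (fun z : V => ‖z‖⁻¹ • z) {0}ᶜ :=
      (continuous_norm.continuousOn.inv₀ fun x hx => norm_ne_zero_iff.2 hx).smul continuousOn_id
    have hmaps : Set.MapsTo (fun z : V => ‖z‖⁻¹ • z) {0}ᶜ (sphere 0 1) := by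
      intro x hx
      rw [mem_sphere_zero_iff_norm, norm_smul, norm_inv, norm_norm,
        inv_mul_cancel₀ (norm_ne_zero_iff.2 hx)]
    exact (((hg.comp hn hmaps).inv₀ fun x _ => by
      have := h1 (‖x‖⁻¹ • x); simp only [Function.comp_apply]; linarith).smul
        continuousOn_id).continuousAt hU

lemma radial_apply {V : Type*} [NormedAddCommGroup V] [NormedSpace ℝ V] {u : V} (hu : ‖u‖ = 1)
    {r : ℝ} (hr : 0 < r) : ‖r • u‖⁻¹ • (r • u) = u := by
  rw [norm_smul, hu, mul_one, Real.norm_eq_abs, abs_of_pos hr, smul_smul, inv_mul_cancel₀ hr.ne',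
    one_smul]

lemma radial_injective {V : Type*} [NormedAddCommGroup V] [NormedSpace ℝ V] {g : V → ℝ}
    (h1 : ∀ u, 1 ≤ g u) : Function.Injective fun z : V => (g (‖z‖⁻¹ • z))⁻¹ • z := by
  intro x y hxy
  simp only at hxy
  have hpos : ∀ u, 0 < (g u)⁻¹ := fun u => inv_pos.2 (by linarith [h1 u])
  by_cases hx : x = 0
  · subst hx
    rw [smul_zero] at hxy
    rcases smul_eq_zero.1 hxy.symm with h | h
    · exact absurd h (hpos _).ne'
    · exact h.symm
  by_cases hy : y = 0
  · subst hy
    rw [smul_zero] at hxy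
    rcases smul_eq_zero.1 hxy with h | h
    · exact absurd h (hpos _).ne'
    · exact h
  have hdir : ∀ (z : V) (c : ℝ), 0 < c → z ≠ 0 → ‖c • z‖⁻¹ • (c • z) = ‖z‖⁻¹ • z := by
    intro z c hc hz
    rw [norm_smul, Real.norm_eq_abs, abs_of_pos hc, smul_smul, mul_inv, mul_comm, ← mul_assoc,
      mul_inv_cancel₀ hc.ne', one_mul]
  have hu : ‖x‖⁻¹ • x = ‖y‖⁻¹ • y := by
    rw [← hdir x _ (hpos (‖x‖⁻¹ • x)) hx, hxy, hdir y _ (hpos _) hy]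
  rw [hu] at hxy
  exact smul_right_injective V (hpos _).ne' hxy

variable {Ω : Type*} [Fintype Ω]

lemma mem_body_single {t : Finset Ω} {x : Ω → ℝ} :
    x ∈ body {t} ↔ x ∈ stdSimplex ℝ Ω ∧ ∀ v, v ∉ t → x v = 0 := by
  constructor
  · rintro ⟨hx, s, rfl, hs⟩; exact ⟨hx, hs⟩
  · rintro ⟨hx, hs⟩; exact ⟨hx, t, rfl, hs⟩

variable [DecidableEq Ω]

/-- The direction in which a tetrahedron `A ∪ B` is collapsed to its faces opposite to `A`. -/
noncomputable def collapseDir (A B : Finset Ω) (v : Ω) : ℝ :=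
  if v ∈ A then 1 else if v ∈ B then - (A.card / B.card : ℝ) else 0

lemma sum_collapseDir {A B : Finset Ω} (hAB : Disjoint A B) (hB : B.Nonempty) :
    ∑ v, collapseDir A B v = 0 := by
  have h1 : ∀ v, collapseDir A B v = (if v ∈ A then 1 else 0) +
      (if v ∈ B then - (A.card / B.card : ℝ) else 0) := by
    intro v
    unfold collapseDir
    by_cases hA : v ∈ A
    · rw [if_pos hA, if_pos hA, if_neg (disjoint_left.1 hAB hA), add_zero]
    · rw [if_neg hA, if_neg hA, zero_add]
  simp_rw [h1]
  have hc : (B.card : ℝ) ≠ 0 := by exact_mod_cast hB.card_ne_zero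
  rw [sum_add_distrib, ← sum_filter, ← sum_filter]
  simp
  field_simp
  simp

/-- Attaching a tetrahedron along a disc in the boundary of a ball. -/
theorem exists_isBallMap_cons {V : Type*} [NormedAddCommGroup V] [NormedSpace ℝ V]
    {N F : Set (Finset Ω)} {A B : Finset Ω} {φ : (Ω → ℝ) → V} (hφ : IsBallMap N F φ)
    (hFN : ∀ f ∈ F, ∃ s ∈ N, f ⊆ s)
    (hAB : Disjoint A B) (hA : A.Nonempty) (hB : B.Nonempty)
    (hnew : ∀ s ∈ N, ¬ A ⊆ s) (hold : ∀ a ∈ A, (A ∪ B).erase a ∈ F)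
    (hface : ∀ f ∈ F, B ⊆ f → ∃ a ∈ A, f = (A ∪ B).erase a) :
    ∃ f : (Ω → ℝ) → V, IsBallMap (insert (A ∪ B) N)
      {f | (f ∈ F ∧ ¬ B ⊆ f) ∨ ∃ b ∈ B, f = (A ∪ B).erase b} f := by
  classical
  set t := A ∪ B with ht
  set F' : Set (Finset Ω) := {f | (f ∈ F ∧ ¬ B ⊆ f) ∨ ∃ b ∈ B, f = t.erase b} with hF'
  have hAt : A ⊆ t := subset_union_left
  have hBt : B ⊆ t := subset_union_right
  have hFb : body F ⊆ body N := by
    rintro x ⟨hx, f, hf, h⟩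
    obtain ⟨s, hs, hfs⟩ := hFN f hf
    exact ⟨hx, s, hs, fun v hv => h v fun hvf => hv (hfs hvf)⟩
  -- the disc along which the tetrahedron is attached
  have hD1 : ∀ y ∈ body {t}, y ∈ body N → ∃ a ∈ A, y a = 0 := by
    rintro y - ⟨-, s, hs, h⟩
    obtain ⟨a, ha, has⟩ := not_subset.1 (hnew s hs)
    exact ⟨a, ha, h a has⟩
  have hD2 : ∀ y ∈ body {t}, (∃ a ∈ A, y a = 0) → y ∈ body F := by
    rintro y hy ⟨a, ha, hya⟩
    rw [mem_body_single] at hy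
    refine ⟨hy.1, t.erase a, hold a ha, fun v hv => ?_⟩
    by_cases hva : v = a
    · rw [hva, hya]
    · exact hy.2 v fun hvt => hv (mem_erase.2 ⟨hva, hvt⟩)
  -- The direction `w` is `1` on `A` and `-κ⁻¹` on `B`, and its coordinates sum to zero, so moving
  -- along it stays in the hyperplane of the simplex.
  set κ : ℝ := B.card / A.card with hκ
  have hκ0 : 0 < κ := div_pos (by exact_mod_cast hB.card_pos) (by exact_mod_cast hA.card_pos)
  set w := collapseDir A B with hw
  have hwA : ∀ a ∈ A, w a = 1 := fun a ha => if_pos ha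
  have hwB : ∀ b ∈ B, w b = - κ⁻¹ := fun b hb => by
    rw [hw, collapseDir, if_neg (disjoint_right.1 hAB hb), if_pos hb, hκ, inv_div]
  have hw0 : ∀ v, v ∉ t → w v = 0 := fun v hv => by
    rw [hw, collapseDir, if_neg fun h => hv (hAt h), if_neg fun h => hv (hBt h)]
  have hwsum : ∑ v, w v = 0 := sum_collapseDir hAB hB
  -- Coordinates along the lines in direction `w`: `s` is the distance from the attaching disc (the
  -- faces opposite to `A`), and `ρ` is the room left before the free faces (opposite to `B`). The
  -- factor `κ` makes `ρ` decrease at the rate at which `s` grows. `X` projects the tetrahedron onto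
  -- the disc.
  let s : (Ω → ℝ) → ℝ := fun y => A.inf' hA fun a => y a
  let ρ : (Ω → ℝ) → ℝ := fun y => κ * B.inf' hB fun b => y b
  have hsc : Continuous s := Continuous.finset_inf'_apply hA fun a _ => continuous_apply a
  have hρc : Continuous ρ :=
    continuous_const.mul (Continuous.finset_inf'_apply hB fun b _ => continuous_apply b)
  let X : (Ω → ℝ) → Ω → ℝ := fun y => y - s y • w
  have hXc : Continuous X := continuous_id.sub (hsc.smul continuous_const)
  have hs0 : ∀ y, (∀ v, 0 ≤ y v) → 0 ≤ s y := fun y hy => (le_inf'_iff hA _).2 fun a _ => hy a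
  have hinfB0 : ∀ y : Ω → ℝ, (∀ v, 0 ≤ y v) → 0 ≤ B.inf' hB fun b => y b := fun y hy =>
    (le_inf'_iff hB _).2 fun a _ => hy a
  have hszero : ∀ y : Ω → ℝ, (∀ v, 0 ≤ y v) → ((∃ a ∈ A, y a = 0) ↔ s y = 0) := by
    intro y hy
    constructor
    · rintro ⟨a, ha, h⟩
      exact le_antisymm (h ▸ inf'_le _ ha) (hs0 y hy)
    · intro h
      obtain ⟨a, ha, h'⟩ := exists_mem_eq_inf' hA fun a => y a
      exact ⟨a, ha, h'.symm.trans h⟩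
  have hρzero : ∀ y : Ω → ℝ, (∀ v, 0 ≤ y v) → ((∃ b ∈ B, y b = 0) ↔ ρ y = 0) := by
    intro y hy
    have : ρ y = 0 ↔ (B.inf' hB fun b => y b) = 0 := by
      simp only [ρ, mul_eq_zero, hκ0.ne', false_or]
    rw [this]
    constructor
    · rintro ⟨a, ha, h⟩
      exact le_antisymm (h ▸ inf'_le _ ha) (hinfB0 y hy)
    · intro h
      obtain ⟨a, ha, h'⟩ := exists_mem_eq_inf' hB fun a => y a
      exact ⟨a, ha, h'.symm.trans h⟩
  -- moving in the collapsing direction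
  have hsadd : ∀ y c, s (y + c • w) = s y + c := by
    intro y c
    obtain ⟨a, ha, h⟩ := exists_mem_eq_inf' hA fun a => y a
    refine le_antisymm ?_ ((le_inf'_iff hA _).2 fun a' ha' => ?_)
    · refine (inf'_le _ ha).trans ?_
      simp only [s, h, Pi.add_apply, Pi.smul_apply, hwA a ha, smul_eq_mul, mul_one, le_refl]
    · simp only [Pi.add_apply, Pi.smul_apply, hwA a' ha', smul_eq_mul, mul_one]
      have : s y ≤ y a' := inf'_le _ ha'
      linarith
  have hρadd : ∀ y c, ρ (y + c • w) = ρ y - c := by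
    intro y c
    have : (B.inf' hB fun b => (y + c • w) b) = (B.inf' hB fun b => y b) - c * κ⁻¹ := by
      obtain ⟨a, ha, h⟩ := exists_mem_eq_inf' hB fun a => y a
      refine le_antisymm ?_ ((le_inf'_iff hB _).2 fun a' ha' => ?_)
      · refine (inf'_le _ ha).trans ?_
        simp only [h, Pi.add_apply, Pi.smul_apply, hwB a ha, smul_eq_mul]
        linarith
      · simp only [Pi.add_apply, Pi.smul_apply, hwB a' ha', smul_eq_mul]
        have : (B.inf' hB fun b => y b) ≤ y a' := inf'_le _ ha'
        linarith
    simp only [ρ, this]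
    field_simp
  have hmove : ∀ y ∈ body {t}, ∀ c, - s y ≤ c → c ≤ ρ y → y + c • w ∈ body {t} := by
    intro y hy c hc1 hc2
    rw [mem_body_single] at hy ⊢
    refine ⟨⟨fun v => ?_, ?_⟩, fun v hv => ?_⟩
    · simp only [Pi.add_apply, Pi.smul_apply, smul_eq_mul]
      by_cases hvA : v ∈ A
      · rw [hwA v hvA]
        have : s y ≤ y v := inf'_le _ hvA
        linarith
      by_cases hvB : v ∈ B
      · rw [hwB v hvB]
        have h1 : (B.inf' hB fun b => y b) ≤ y v := inf'_le _ hvB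
        have h2 : c * κ⁻¹ ≤ B.inf' hB fun b => y b := by
          rw [← div_eq_mul_inv, div_le_iff₀ hκ0, mul_comm]; exact hc2
        linarith
      · rw [hw0 v (by rw [ht, mem_union]; tauto)]
        simpa using hy.1.1 v
    · simp only [Pi.add_apply, Pi.smul_apply, smul_eq_mul, sum_add_distrib, ← mul_sum, hwsum]
      rw [hy.1.2]; ring
    · simp [hy.2 v hv, hw0 v hv]
  have hXe : ∀ y, X y = y + (- s y) • w := fun y => by simp only [X, neg_smul, sub_eq_add_neg]
  have hρ0 : ∀ y : Ω → ℝ, (∀ v, 0 ≤ y v) → 0 ≤ ρ y := fun y hy =>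
    mul_nonneg hκ0.le (hinfB0 y hy)
  have hXt : ∀ y ∈ body {t}, X y ∈ body {t} := fun y hy => by
    have hy' := (mem_body_single.1 hy).1.1
    rw [hXe]
    exact hmove y hy _ le_rfl (by linarith [hs0 y hy', hρ0 y hy'])
  have hXs : ∀ y, s (X y) = 0 := fun y => by rw [hXe, hsadd]; ring
  have hXρ : ∀ y, ρ (X y) = ρ y + s y := fun y => by rw [hXe, hρadd]; ring
  have hXF : ∀ y ∈ body {t}, X y ∈ body F := fun y hy =>
    hD2 _ (hXt y hy) ((hszero _ (mem_body_single.1 (hXt y hy)).1.1).2 (hXs y))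
  -- the map to a star body
  let Φ : (Ω → ℝ) → V := fun y => if y ∈ body N then φ y else (1 + s y) • φ (X y)
  have hΦN : ∀ y ∈ body N, Φ y = φ y := fun y hy => if_pos hy
  have hΦt : ∀ y ∈ body {t}, Φ y = (1 + s y) • φ (X y) := by
    intro y hy
    by_cases hyN : y ∈ body N
    · have h0 := (hszero y hyN.1.1).1 (hD1 y hy hyN)
      rw [hΦN y hyN, h0]
      simp [X, h0]
    · exact if_neg hyN
  have hbody : body (insert t N) = body N ∪ body {t} := by
    ext x
    constructor
    · rintro ⟨hx, s, rfl | hs, h⟩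
      · exact Or.inr ⟨hx, _, rfl, h⟩
      · exact Or.inl ⟨hx, s, hs, h⟩
    · rintro (⟨hx, s, hs, h⟩ | ⟨hx, s, rfl, h⟩)
      · exact ⟨hx, s, Or.inr hs, h⟩
      · exact ⟨hx, _, Or.inl rfl, h⟩
  have hφ1 : ∀ y ∈ body {t}, ‖φ (X y)‖ = 1 := fun y hy =>
    (hφ.norm_eq _ (hFb (hXF y hy))).2 (hXF y hy)
  have hφle : ∀ y ∈ body N, ‖φ y‖ ≤ 1 := fun y hy => by
    rw [← mem_closedBall_zero_iff, ← hφ.image]; exact ⟨y, hy, rfl⟩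
  have hΦc : ContinuousOn Φ (body (insert t N)) := by
    rw [hbody]
    refine ContinuousOn.union_of_isClosed ?_ ?_ (isCompact_body N).isClosed
      (isCompact_body _).isClosed
    · exact hφ.cont.congr hΦN
    · refine ContinuousOn.congr ?_ hΦt
      refine (continuous_const.add hsc).continuousOn.smul ?_
      exact hφ.cont.comp hXc.continuousOn fun y hy => hFb (hXF y hy)
  have hΦn : ∀ y ∈ body {t}, ‖Φ y‖ = 1 + s y := fun y hy => by
    have := hs0 y (mem_body_single.1 hy).1.1
    rw [hΦt y hy, norm_smul, hφ1 y hy, mul_one, Real.norm_eq_abs, abs_of_pos (by linarith)]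
  have hΦi : Set.InjOn Φ (body (insert t N)) := by
    -- Norms are at most `1` on the old ball and `1 + s` on the tetrahedron, so images can agree
    -- only where `s = 0`, on the disc.
    have hmix : ∀ y ∈ body N, ∀ y' ∈ body {t}, Φ y = Φ y' → y = y' := by
      intro y hy y' hy' he
      have h1 := hφle y hy
      rw [← hΦN y hy, he, hΦn y' hy'] at h1
      have h0' := (mem_body_single.1 hy').1.1
      have h0 : s y' = 0 := le_antisymm (by linarith) (hs0 y' h0')
      have hyN := hFb (hD2 y' hy' ((hszero y' h0').2 h0))
      rw [hΦN y hy, hΦN y' hyN] at he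
      exact hφ.inj hy hyN he
    rw [hbody]
    rintro y (hy | hy) y' (hy' | hy') he
    · rw [hΦN y hy, hΦN y' hy'] at he
      exact hφ.inj hy hy' he
    · exact hmix y hy y' hy' he
    · exact (hmix y' hy' y hy he.symm).symm
    · have h1 : s y = s y' := by
        have := hΦn y hy
        rw [he, hΦn y' hy'] at this
        linarith
      rw [hΦt y hy, hΦt y' hy', h1] at he
      have h2 := smul_right_injective V
        (show 1 + s y' ≠ 0 by linarith [hs0 y' (mem_body_single.1 hy').1.1]) he
      have h3 := hφ.inj (hFb (hXF y hy)) (hFb (hXF y' hy')) h2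
      have h4 : y - s y • w = y' - s y' • w := h3
      rw [h1] at h4
      exact sub_left_injective h4
  -- radial rescaling
  obtain ⟨ψ, hψc, hψ⟩ := exists_continuousOn_inverse (isCompact_body N) hφ.cont hφ.inj
  rw [hφ.image] at hψc
  -- The star body reaches `1 + ρ` in the direction of a point of the unit sphere; off the disc `ρ`
  -- vanishes on the boundary by `hface`. The maximum only ensures `g ≥ 1` where `ψ` takes arbitrary
  -- values.
  let g : V → ℝ := fun u => 1 + max (ρ (ψ u)) 0
  have hg1 : ∀ u, 1 ≤ g u := fun u => by simp [g]
  have hgc : ContinuousOn g (sphere 0 1) :=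
    continuousOn_const.add ((hρc.comp_continuousOn (hψc.mono sphere_subset_closedBall)).sup
      continuousOn_const)
  have hgφ : ∀ y ∈ body N, g (φ y) = 1 + ρ y := fun y hy => by
    simp only [g, hψ y hy, max_eq_left (hρ0 y hy.1.1)]
  let h : V → V := fun z => (g (‖z‖⁻¹ • z))⁻¹ • z
  have hhc : Continuous h := continuous_radial hgc hg1
  have hhi : Function.Injective h := radial_injective hg1
  have hhn : ∀ z, ‖h z‖ = ‖z‖ / g (‖z‖⁻¹ • z) := fun z => by
    simp only [h]
    rw [norm_smul, norm_inv, Real.norm_eq_abs, abs_of_pos (by linarith [hg1 (‖z‖⁻¹ • z)]),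
      div_eq_inv_mul]
  -- This quotient equals `1` exactly when `ρ y = 0`, that is on the free faces.
  have hnt : ∀ y ∈ body {t}, ‖h (Φ y)‖ = (1 + s y) / (1 + (ρ y + s y)) := by
    intro y hy
    rw [hhn, hΦn y hy]
    have := hs0 y (mem_body_single.1 hy).1.1
    rw [← hΦn y hy, hΦt y hy, radial_apply (hφ1 y hy) (by linarith), hgφ _ (hFb (hXF y hy)), hXρ,
      ← hΦt y hy, hΦn y hy]
  have hnN : ∀ y ∈ body N, ‖h (Φ y)‖ ≤ ‖φ y‖ := by
    intro y hy
    rw [hhn, hΦN y hy]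
    exact div_le_self (norm_nonneg _) (hg1 _)
  refine ⟨h ∘ Φ, hhc.comp_continuousOn hΦc, hhi.comp_injOn hΦi, ?_, ?_⟩
  · ext z
    rw [mem_closedBall_zero_iff]
    constructor
    · rintro ⟨y, hy, rfl⟩
      rw [hbody] at hy
      rcases hy with hy | hy
      · exact (hnN y hy).trans (hφle y hy)
      · rw [Function.comp_apply, hnt y hy]
        have h1 := hs0 y (mem_body_single.1 hy).1.1
        have h2 := hρ0 y (mem_body_single.1 hy).1.1
        rw [div_le_one (by linarith)]
        linarith
    · intro hz
      rw [hbody]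
      by_cases hz0 : z = 0
      · have : (0 : V) ∈ φ '' body N := by rw [hφ.image]; simp
        obtain ⟨y, hy, hy0⟩ := this
        exact ⟨y, Or.inl hy, by simp only [Function.comp_apply, hΦN y hy, hy0, hz0, h, smul_zero]⟩
      set u := ‖z‖⁻¹ • z with hu
      have hzn : 0 < ‖z‖ := norm_pos_iff.2 hz0
      have hu1 : ‖u‖ = 1 := by rw [hu, norm_smul, norm_inv, norm_norm, inv_mul_cancel₀ hzn.ne']
      have hzu : z = ‖z‖ • u := by rw [hu, smul_smul, mul_inv_cancel₀ hzn.ne', one_smul]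
      have hgu := hg1 u
      set r := ‖z‖ * g u with hr
      have hr0 : 0 < r := mul_pos hzn (by linarith)
      have hru : h (r • u) = z := by
        simp only [h]
        rw [radial_apply hu1 hr0, smul_smul, hr, mul_comm ‖z‖, ← mul_assoc,
          inv_mul_cancel₀ (by linarith), one_mul, ← hzu]
      by_cases hr1 : r ≤ 1
      · have : r • u ∈ φ '' body N := by
          rw [hφ.image, mem_closedBall_zero_iff, norm_smul, hu1, Real.norm_eq_abs, abs_of_pos hr0,
            mul_one]
          exact hr1
        obtain ⟨y, hy, hyr⟩ := this
        exact ⟨y, Or.inl hy, by rw [Function.comp_apply, hΦN y hy, hyr, hru]⟩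
      · push Not at hr1
        have : u ∈ φ '' body N := by rw [hφ.image, mem_closedBall_zero_iff, hu1]
        obtain ⟨x, hx, hxu⟩ := this
        have hxF : x ∈ body F := (hφ.norm_eq x hx).1 (by rw [hxu, hu1])
        have hgx : g u = 1 + ρ x := by rw [← hxu, hgφ x hx]
        have hrle : r ≤ 1 + ρ x := by
          rw [hr, ← hgx]; exact mul_le_of_le_one_left (by linarith) hz
        -- A point beyond the old ball forces room above `x`. So `x` has positive coordinates on
        -- `B`, its boundary face contains `B`, and `hface` puts `x` on the disc.
        have hρx : ρ x ≠ 0 := by linarith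
        have hxt : x ∈ body {t} ∧ s x = 0 := by
          obtain ⟨hx1, f, hf, hxf⟩ := hxF
          have hBf : B ⊆ f := by
            intro b hb
            by_contra hbf
            exact hρx ((hρzero x hx1.1).1 ⟨b, hb, hxf b hbf⟩)
          obtain ⟨a, ha, rfl⟩ := hface f hf hBf
          exact ⟨mem_body_single.2 ⟨hx1, fun v hv => hxf v fun h => hv (mem_of_mem_erase h)⟩,
            (hszero x hx1.1).1 ⟨a, ha, hxf a (notMem_erase a _)⟩⟩
        have hy : x + (r - 1) • w ∈ body {t} :=
          hmove x hxt.1 _ (by rw [hxt.2]; linarith) (by linarith)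
        have hsy : s (x + (r - 1) • w) = r - 1 := by rw [hsadd, hxt.2, zero_add]
        refine ⟨x + (r - 1) • w, Or.inr hy, ?_⟩
        have hXx : X (x + (r - 1) • w) = x := by simp only [X, hsy, add_sub_cancel_right]
        rw [Function.comp_apply, hΦt _ hy, hsy, hXx, hxu, ← hru]
        congr 2; ring
  · intro y hy
    rw [hbody] at hy
    by_cases hyt : y ∈ body {t}
    · have h0 := (mem_body_single.1 hyt).1.1
      have h1 := hs0 y h0
      have h2 := hρ0 y h0
      rw [Function.comp_apply, hnt y hyt, div_eq_one_iff_eq (by linarith)]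
      have : 1 + s y = 1 + (ρ y + s y) ↔ ρ y = 0 := ⟨fun h => by linarith, fun h => by rw [h]; ring⟩
      rw [this, ← hρzero y h0]
      constructor
      · rintro ⟨b, hb, hyb⟩
        refine ⟨hyt.1, t.erase b, Or.inr ⟨b, hb, rfl⟩, fun v hv => ?_⟩
        by_cases hvb : v = b
        · rw [hvb, hyb]
        · exact (mem_body_single.1 hyt).2 v fun hvt => hv (mem_erase.2 ⟨hvb, hvt⟩)
      · rintro ⟨-, f, ⟨hf, hBf⟩ | ⟨b, hb, rfl⟩, h⟩
        · obtain ⟨b, hb, hbf⟩ := not_subset.1 hBf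
          exact ⟨b, hb, h b hbf⟩
        · exact ⟨b, hb, h b (notMem_erase b _)⟩
    · have hyN := hy.resolve_right hyt
      rw [Function.comp_apply]
      constructor
      · intro h1
        have h2 := hnN y hyN
        have h3 : y ∈ body F := (hφ.norm_eq y hyN).1 (le_antisymm (hφle y hyN) (h1 ▸ h2))
        obtain ⟨hy1, f, hf, hyf⟩ := h3
        refine ⟨hy1, f, Or.inl ⟨hf, fun hBf => ?_⟩, hyf⟩
        obtain ⟨a, ha, rfl⟩ := hface f hf hBf
        exact hyt (mem_body_single.2 ⟨hy1, fun v hv => hyf v fun h => hv (mem_of_mem_erase h)⟩)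
      · rintro ⟨hy1, f, ⟨hf, hBf⟩ | ⟨b, hb, rfl⟩, hyf⟩
        · have hyF : y ∈ body F := ⟨hy1, f, hf, hyf⟩
          have hn1 := (hφ.norm_eq y hyN).2 hyF
          obtain ⟨b, hb, hbf⟩ := not_subset.1 hBf
          have hρy := (hρzero y hy1.1).1 ⟨b, hb, hyf b hbf⟩
          rw [hhn, hΦN y hyN, hn1, inv_one, one_smul, hgφ y hyN, hρy]
          norm_num
        · exact absurd (mem_body_single.2 ⟨hy1, fun v hv => hyf v fun h =>
            hv (mem_of_mem_erase h)⟩) hyt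

/-- Combinatorial shellings build balls. -/
theorem Shells.exists_isBallMap {N : List (Finset Ω)} {F : Set (Finset Ω)} (h : Shells N F) :
    ∃ f : (Ω → ℝ) → EuclideanSpace ℝ (Fin 3), IsBallMap {s | s ∈ N} F f := by
  induction h with
  | single t ht =>
    obtain ⟨f, hf⟩ := exists_isBallMap_single ht
    refine ⟨f, ?_⟩
    have : {s | s ∈ [t]} = ({t} : Set (Finset Ω)) := by ext s; exact List.mem_singleton
    rwa [this]
  | cons N F A B h hAB hA hB hcard hnew hold hface ih =>
    obtain ⟨φ, hφ⟩ := ih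
    obtain ⟨f, hf⟩ := exists_isBallMap_cons hφ h.exists_superset hAB hA hB hnew hold hface
    refine ⟨f, ?_⟩
    have : {s | s ∈ (A ∪ B) :: N} = insert (A ∪ B) {s | s ∈ N} := by
      ext s; exact List.mem_cons
    rwa [this]

lemma Shells.isBall3 {N : List (Finset Ω)} {F : Set (Finset Ω)} (h : Shells N F) :
    IsBall3 (generatedBy {s | s ∈ N}) := by
  obtain ⟨f, hf⟩ := h.exists_isBallMap
  exact hf.isBall3

end TautFilling

/-! ### Continuous logarithms and plane charts of the sphere -/

namespace TautFilling

open Metric Complex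

section Logarithms

/-- Nonvanishing continuous functions on open star-shaped sets have logarithms. -/
lemma exists_log_of_starConvex {E : Type*} [NormedAddCommGroup E] [NormedSpace ℝ E] {U : Set E}
    {x : E} (hU : StarConvex ℝ x U) (hne : U.Nonempty) (ho : IsOpen U) {f : E → ℂ}
    (hf : ContinuousOn f U) (h0 : ∀ y ∈ U, f y ≠ 0) :
    ∃ L : E → ℂ, ContinuousOn L U ∧ ∀ y ∈ U, exp (L y) = f y := by
  have := hU.contractibleSpace hne
  have hs : IsSimplyConnected U := SimplyConnectedSpace.ofContractible U
  obtain ⟨L, hL, hL'⟩ := exists_continuousOn_eqOn_exp_comp hs ho hf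
    (by rintro ⟨y, hy, h⟩; exact h0 y hy h)
  exact ⟨L, hL, fun y hy => hL' hy⟩

/-- Two logarithms of the same function on a connected set differ by a constant. -/
lemma log_sub_eq {X : Type*} [TopologicalSpace X] {s : Set X} (hs : IsPreconnected s)
    {L L' : X → ℂ} (hL : ContinuousOn L s) (hL' : ContinuousOn L' s)
    (h : ∀ x ∈ s, exp (L x) = exp (L' x)) {x y : X} (hx : x ∈ s) (hy : y ∈ s) :
    L x - L' x = L y - L' y := by
  have hn : ∀ x ∈ s, ∃ n : ℤ, L x - L' x = n * (2 * Real.pi * I) := by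
    intro x hx
    obtain ⟨n, hn⟩ := exp_eq_exp_iff_exists_int.1 (h x hx)
    exact ⟨n, by rw [hn]; ring⟩
  let g : X → ℝ := fun x => ((L x - L' x) / (2 * Real.pi * I)).re
  have hg : ContinuousOn g s := continuous_re.comp_continuousOn ((hL.sub hL').div_const _)
  have hgn : ∀ x ∈ s, ∃ n : ℤ, g x = n ∧ L x - L' x = n * (2 * Real.pi * I) := by
    intro x hx
    obtain ⟨n, hn⟩ := hn x hx
    refine ⟨n, ?_, hn⟩
    simp only [g, hn]
    rw [mul_div_assoc, div_self two_pi_I_ne_zero, mul_one, intCast_re]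
  -- Between two different integer values, the continuous function `g` would take a half-integer
  -- value.
  have key : ∀ x ∈ s, ∀ y ∈ s, ¬ g x < g y := by
    intro x hx y hy hlt
    obtain ⟨n, hn, -⟩ := hgn x hx
    obtain ⟨m, hm, -⟩ := hgn y hy
    have hnm : n < m := by rw [hn, hm] at hlt; exact_mod_cast hlt
    have hnm' : (n : ℝ) + 1 ≤ m := by exact_mod_cast hnm
    have : (n : ℝ) + 1 / 2 ∈ g '' s := hs.intermediate_value hx hy hg
      ⟨by rw [hn]; linarith, by rw [hm]; linarith⟩
    obtain ⟨w, hw, hw'⟩ := this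
    obtain ⟨k, hk, -⟩ := hgn w hw
    rw [hk] at hw'
    have : (2 * k : ℝ) = 2 * n + 1 := by linarith
    have : 2 * k = 2 * n + 1 := by exact_mod_cast this
    omega
  obtain ⟨n, hn, hn'⟩ := hgn x hx
  obtain ⟨m, hm, hm'⟩ := hgn y hy
  have : (n : ℝ) = m := by
    rw [← hn, ← hm]
    exact le_antisymm (not_lt.1 (key y hy x hx)) (not_lt.1 (key x hx y hy))
  rw [hn', hm', show n = m by exact_mod_cast this]

/-- Nonvanishing continuous functions on a punctured space of dimension at least three have
logarithms. -/
lemma exists_log_compl_zero {E : Type*} [NormedAddCommGroup E] [NormedSpace ℝ E]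
    [FiniteDimensional ℝ E] (hE : 3 ≤ Module.finrank ℝ E) {f : E → ℂ}
    (hf : ContinuousOn f {0}ᶜ) (h0 : ∀ y ≠ 0, f y ≠ 0) :
    ∃ L : E → ℂ, ContinuousOn L {0}ᶜ ∧ ∀ y ≠ 0, exp (L y) = f y := by
  have : Nontrivial E := Module.nontrivial_of_finrank_pos (R := ℝ) (by omega)
  obtain ⟨e, he⟩ := exists_ne (0 : E)
  -- The space minus the closed ray opposite to `e`, star-shaped about `e`. The sets for `e` and
  -- `-e` cover the punctured space.
  let U : E → Set E := fun e => ((fun t : ℝ => t • (-e)) '' Set.Ici 0)ᶜ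
  have hUo : ∀ e, IsOpen (U e) := fun e =>
    (isClosedMap_smul_left (-e) _ isClosed_Ici).isOpen_compl
  have hUs : ∀ e ≠ 0, StarConvex ℝ e (U e) := by
    rintro e he y hy a b ha hb hab ⟨t, ht, h⟩
    rw [Set.mem_Ici] at ht
    simp only [smul_neg] at h
    rcases hb.eq_or_lt with rfl | hb'
    · obtain rfl : a = 1 := by linarith
      have : (1 + t) • e = 0 := by
        linear_combination (norm := module) -h
      rcases smul_eq_zero.1 this with h | h
      · linarith
      · exact he h
    · refine hy ⟨(t + a) / b, div_nonneg (by linarith) hb, ?_⟩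
      have h2 : b • y = (t + a) • (-e) := by
        linear_combination (norm := module) -h
      change ((t + a) / b) • (-e) = y
      rw [div_eq_inv_mul, mul_smul, ← h2, smul_smul, inv_mul_cancel₀ hb'.ne', one_smul]
  have hUe : ∀ e ≠ 0, (U e).Nonempty := by
    intro e he
    refine ⟨e, ?_⟩
    rintro ⟨t, ht, h⟩
    rw [Set.mem_Ici] at ht
    have : (1 + t) • e = 0 := by
      simp only [smul_neg] at h
      linear_combination (norm := module) -h
    rcases smul_eq_zero.1 this with h | h
    · linarith
    · exact he h
  have hU0 : ∀ e, U e ⊆ {0}ᶜ := by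
    rintro e y hy rfl
    exact hy ⟨0, by simp, by simp⟩
  obtain ⟨L₁, c1, l1⟩ := exists_log_of_starConvex (hUs e he) (hUe e he) (hUo e)
    (hf.mono (hU0 e)) fun y hy => h0 y (hU0 e hy)
  obtain ⟨L₂, c2, l2⟩ := exists_log_of_starConvex (hUs (-e) (neg_ne_zero.2 he))
    (hUe (-e) (neg_ne_zero.2 he)) (hUo (-e)) (hf.mono (hU0 (-e))) fun y hy => h0 y (hU0 (-e) hy)
  have hcov : ∀ y ≠ 0, y ∈ U e ∨ y ∈ U (-e) := by
    intro y hy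
    by_contra! h
    obtain ⟨⟨t, ht, h1⟩, ⟨s, hs, h2⟩⟩ : y ∈ (fun t : ℝ => t • (-e)) '' Set.Ici 0 ∧
        y ∈ (fun t : ℝ => t • (- -e)) '' Set.Ici 0 := by
      exact ⟨not_not.1 h.1, not_not.1 h.2⟩
    rw [Set.mem_Ici] at hs ht
    simp only [neg_neg, smul_neg] at h1 h2
    have : (s + t) • e = 0 := by rw [add_smul, h2, ← h1]; simp
    rcases smul_eq_zero.1 this with h | h
    · obtain rfl : s = 0 := by linarith
      exact hy (by rw [← h2, zero_smul])
    · exact he h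
  have hint : U e ∩ U (-e) = ((ℝ ∙ e : Submodule ℝ E) : Set E)ᶜ := by
    ext y
    rw [Set.mem_inter_iff, Set.mem_compl_iff (s := ((ℝ ∙ e : Submodule ℝ E) : Set E)),
      SetLike.mem_coe, Submodule.mem_span_singleton]
    constructor
    · rintro ⟨h1, h2⟩ ⟨t, rfl⟩
      rcases le_total 0 t with ht | ht
      · exact h2 ⟨t, ht, by simp⟩
      · exact h1 ⟨-t, by simpa using ht, by simp⟩
    · intro h
      refine ⟨?_, ?_⟩
      · rintro ⟨t, -, rfl⟩; exact h ⟨-t, by simp⟩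
      · rintro ⟨t, -, rfl⟩; exact h ⟨t, by simp⟩
  -- The overlap is the complement of a line, connected because the dimension is at least three. The
  -- two logarithms therefore differ by one constant and can be glued; in the plane this step fails.
  have hconn : IsConnected (U e ∩ U (-e)) := by
    rw [hint]
    refine isConnected_compl_of_one_lt_codim ?_
    have h1 := (ℝ ∙ e).finrank_quotient_add_finrank
    have h2 := finrank_span_singleton (K := ℝ) he
    rw [← Module.finrank_eq_rank]
    exact_mod_cast (by omega : 1 < Module.finrank ℝ (E ⧸ (ℝ ∙ e)))
  obtain ⟨p, hp⟩ := hconn.nonempty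
  set k := L₁ p - L₂ p with hk
  have hkc : ∀ y ∈ U e ∩ U (-e), L₁ y = L₂ y + k := fun y hy => by
    have := log_sub_eq hconn.isPreconnected (c1.mono Set.inter_subset_left)
      (c2.mono Set.inter_subset_right) (fun x hx => (l1 x hx.1).trans (l2 x hx.2).symm) hy hp
    rw [hk, ← this]; ring
  have hk1 : exp k = 1 := by
    rw [hk, exp_sub, l1 p hp.1, l2 p hp.2, div_self (h0 p (hU0 _ hp.1))]
  classical
  let L : E → ℂ := fun y => if y ∈ U e then L₁ y else L₂ y + k
  have hL1 : ∀ y ∈ U e, L y = L₁ y := fun y hy => if_pos hy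
  have hL2 : ∀ y ∈ U (-e), L y = L₂ y + k := fun y hy => by
    by_cases h : y ∈ U e
    · rw [hL1 y h, hkc y ⟨h, hy⟩]
    · exact if_neg h
  refine ⟨L, fun y hy => ?_, fun y hy => ?_⟩
  · rcases hcov y hy with h | h
    · exact ((c1.congr hL1).continuousAt ((hUo e).mem_nhds h)).continuousWithinAt
    · exact (((c2.add continuousOn_const).congr hL2).continuousAt
        ((hUo (-e)).mem_nhds h)).continuousWithinAt
  · rcases hcov y hy with h | h
    · rw [hL1 y h, l1 y h]
    · rw [hL2 y h, exp_add, hk1, mul_one, l2 y h]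

end Logarithms

section Charts

variable {Ω : Type*}

/-- A homeomorphism of `K` minus the point `q` with the plane, together with its inverse. -/
structure IsPlaneChart (K : Set (Ω → ℝ)) (q : Ω → ℝ) (z : (Ω → ℝ) → ℂ) (ζ : ℂ → Ω → ℝ) :
    Prop where
  cont : ContinuousOn z (K \ {q})
  cont_inv : Continuous ζ
  mem : ∀ w, ζ w ∈ K \ {q}
  left_inv : ∀ x ∈ K \ {q}, ζ (z x) = x
  right_inv : ∀ w, z (ζ w) = w

lemma exists_isPlaneChart {K : Set (Ω → ℝ)} (e : K ≃ₜ sphere (0 : EuclideanSpace ℝ (Fin 3)) 1)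
    {q : Ω → ℝ} (hq : q ∈ K) : ∃ z ζ, IsPlaneChart K q z ζ := by
  classical
  have : Fact (Module.finrank ℝ (EuclideanSpace ℝ (Fin 3)) = 2 + 1) := ⟨by simp⟩
  let S := stereographic' 2 (e ⟨q, hq⟩)
  let c : ℂ ≃ₜ EuclideanSpace ℝ (Fin 2) := Complex.orthonormalBasisOneI.repr.toHomeomorph
  let z : (Ω → ℝ) → ℂ := fun x => if hx : x ∈ K then c.symm (S (e ⟨x, hx⟩)) else 0
  let ζ : ℂ → Ω → ℝ := fun w => e.symm (S.symm (c w))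
  have hzK : ∀ x : K, z x = c.symm (S (e x)) := fun x => dif_pos x.2
  have hSs : ∀ w, S.symm (c w) ∈ S.source := fun w => S.map_target (by simp [S])
  have hsrc : ∀ x : K, (x : Ω → ℝ) ≠ q → e x ∈ S.source := by
    intro x hx
    simp only [S, stereographic'_source, Set.mem_compl_iff, Set.mem_singleton_iff]
    exact fun h => hx (congrArg Subtype.val (e.injective h))
  refine ⟨z, ζ, ?_, ?_, ?_, ?_, ?_⟩
  · rw [continuousOn_iff_continuous_domRestrict]
    have h1 : Continuous fun x : ↥(K \ {q}) => e ⟨x.1, x.2.1⟩ :=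
      e.continuous.comp (continuous_subtype_val.subtype_mk _)
    have h2 : Continuous fun x : ↥(K \ {q}) => S (e ⟨x.1, x.2.1⟩) :=
      S.continuousOn.comp_continuous h1 fun x => hsrc ⟨x.1, x.2.1⟩ x.2.2
    convert c.symm.continuous.comp h2 using 1
    ext x
    exact hzK ⟨x.1, x.2.1⟩
  · have h2 : Continuous fun w => S.symm (c w) :=
      S.symm.continuousOn.comp_continuous c.continuous fun w => by simp [S]
    exact continuous_subtype_val.comp (e.symm.continuous.comp h2)
  · intro w
    refine ⟨(e.symm (S.symm (c w))).2, fun h => ?_⟩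
    have h1 : e.symm (S.symm (c w)) = ⟨q, hq⟩ := Subtype.ext h
    have h2 := hSs w
    rw [← e.apply_symm_apply (S.symm (c w)), h1] at h2
    simp [S] at h2
  · rintro x ⟨hx, hxq⟩
    simp only [ζ]
    rw [hzK ⟨x, hx⟩, c.apply_symm_apply, S.left_inv (hsrc ⟨x, hx⟩ hxq), e.symm_apply_apply]
  · intro w
    simp only [ζ]
    rw [hzK, e.apply_symm_apply, S.right_inv (by simp [S]), c.symm_apply_apply]

lemma exists_isPlaneChart_zero {K : Set (Ω → ℝ)}
    (e : K ≃ₜ sphere (0 : EuclideanSpace ℝ (Fin 3)) 1) {q : Ω → ℝ} (hq : q ∈ K) (m : Ω → ℝ) :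
    ∃ z ζ, IsPlaneChart K q z ζ ∧ z m = 0 := by
  obtain ⟨z, ζ, h⟩ := exists_isPlaneChart e hq
  refine ⟨fun x => z x - z m, fun w => ζ (w + z m), ⟨h.cont.sub continuousOn_const,
    h.cont_inv.comp (continuous_add_const _), fun w => h.mem _, fun x hx => ?_, fun w => ?_⟩,
    sub_self _⟩
  · simp [h.left_inv x hx]
  · simp [h.right_inv]

lemma IsPlaneChart.ne_zero {K : Set (Ω → ℝ)} {q m : Ω → ℝ} {z : (Ω → ℝ) → ℂ} {ζ : ℂ → Ω → ℝ}
    (h : IsPlaneChart K q z ζ) (hm : m ∈ K \ {q}) (hzm : z m = 0) {x : Ω → ℝ} (hx : x ∈ K \ {q})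
    (hxm : x ≠ m) : z x ≠ 0 := by
  intro h0
  exact hxm (by rw [← h.left_inv x hx, h0, ← hzm, h.left_inv m hm])

/-- The complement of a finite set in a sphere is connected. -/
lemma isConnected_diff_finite {K : Set (Ω → ℝ)}
    (e : K ≃ₜ sphere (0 : EuclideanSpace ℝ (Fin 3)) 1) {P : Set (Ω → ℝ)} (hP : P.Finite)
    (hPK : (K ∩ P).Nonempty) : IsConnected (K \ P) := by
  -- One removed point serves as the pole of the chart; the others become a finite subset of the
  -- plane.
  obtain ⟨q, hqK, hqP⟩ := hPK
  obtain ⟨z, ζ, h⟩ := exists_isPlaneChart e hqK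
  set Q := z '' (P ∩ (K \ {q})) with hQ
  have hc : IsConnected (Qᶜ : Set ℂ) :=
    ((hP.inter_of_left _).image z).countable.isConnected_compl_of_one_lt_rank
      (by rw [rank_real_complex]; exact Nat.one_lt_ofNat)
  have : K \ P = ζ '' Qᶜ := by
    ext x
    constructor
    · rintro ⟨hx, hxP⟩
      have hxq : x ∈ K \ {q} := ⟨hx, fun hxq => hxP (hxq ▸ hqP)⟩
      refine ⟨z x, ?_, h.left_inv x hxq⟩
      rintro ⟨p, ⟨hp, hpq⟩, hpx⟩
      exact hxP (by rw [← h.left_inv x hxq, ← hpx, h.left_inv p hpq]; exact hp)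
    · rintro ⟨w, hw, rfl⟩
      exact ⟨(h.mem w).1, fun hP => hw ⟨ζ w, ⟨hP, h.mem w⟩, h.right_inv w⟩⟩
  rw [this]
  exact hc.image ζ h.cont_inv.continuousOn

end Charts

end TautFilling

/-! ### Winding numbers and the dimension of the complex -/

namespace TautFilling

open Metric Complex

/-- A loop once around the origin has no continuous logarithm that closes up. -/
lemma lift_circle {ρ : ℝ} (hρ : 0 < ρ) {ℓ : ℝ → ℂ} (hℓ : ContinuousOn ℓ (Set.Icc 0 (2 * Real.pi)))
    (h : ∀ θ ∈ Set.Icc 0 (2 * Real.pi), exp (ℓ θ) = ρ * exp (θ * I)) :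
    ℓ (2 * Real.pi) - ℓ 0 = 2 * Real.pi * I := by
  have hpi := Real.pi_pos
  have h2 := log_sub_eq (s := Set.Icc 0 (2 * Real.pi)) isPreconnected_Icc hℓ
    (L' := fun θ : ℝ => (Real.log ρ : ℂ) + θ * I) (by fun_prop) (fun θ hθ => by
      rw [h θ hθ, exp_add, ← ofReal_exp, Real.exp_log hρ])
    (x := 2 * Real.pi) (y := 0) ⟨by positivity, le_rfl⟩ ⟨le_rfl, by positivity⟩
  push_cast at h2
  linear_combination h2

variable {Ω : Type*}

/-- A triangulated `2`-sphere has no simplices of dimension greater than two. -/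
theorem card_le_three [Fintype Ω] {σ : PreAbstractSimplicialComplex Ω} (hσ : IsSphere2 σ) {s : Finset Ω}
    (hs : s ∈ σ) : s.card ≤ 3 := by
  classical
  obtain ⟨e⟩ := hσ
  by_contra! hs4
  -- A simplex of maximal size, so that its open interior is open in the carrier.
  obtain ⟨T, hT, hmax⟩ := (Finset.univ.filter (· ∈ σ)).exists_max_image Finset.card
    ⟨s, by simpa using hs⟩
  simp only [Finset.mem_filter, Finset.mem_univ, true_and] at hT hmax
  have hT4 : 4 ≤ T.card := hs4.trans_le (hmax s hs)
  obtain ⟨v₀, hv₀⟩ : T.Nonempty := Finset.card_pos.1 (by omega)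
  let ι := ↥(T.erase v₀)
  -- Normalised exponentials `j`, with inverse `k` given by logarithms of ratios to the coordinate
  -- of `v₀`, identify the open simplex with a real vector space of dimension `T.card - 1`, at least
  -- three.
  let D : (ι → ℝ) → ℝ := fun x => 1 + ∑ i, Real.exp (x i)
  have hD : ∀ x, 0 < D x := fun x => by
    have : 0 ≤ ∑ i, Real.exp (x i) := Finset.sum_nonneg fun i _ => (Real.exp_pos _).le
    simp only [D]; linarith
  let J : (ι → ℝ) → Ω → ℝ := fun x v =>
    if h : v ∈ T.erase v₀ then Real.exp (x ⟨v, h⟩) else if v = v₀ then 1 else 0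
  have hJi : ∀ x (i : ι), J x i = Real.exp (x i) := fun x i => dif_pos i.2
  have hJ0 : ∀ x, J x v₀ = 1 := fun x => by simp [J]
  have hJT : ∀ x v, v ∉ T → J x v = 0 := fun x v hv => by
    have h1 : v ∉ T.erase v₀ := fun h => hv (Finset.mem_of_mem_erase h)
    have h2 : v ≠ v₀ := fun h => hv (h ▸ hv₀)
    simp only [J]
    rw [dif_neg h1, if_neg h2]
  have hJpos : ∀ x, ∀ v ∈ T, 0 < J x v := fun x v hv => by
    by_cases h : v = v₀
    · rw [h, hJ0]; exact one_pos
    · rw [hJi x ⟨v, Finset.mem_erase.2 ⟨h, hv⟩⟩]; exact Real.exp_pos _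
  have hJsum : ∀ x, ∑ v, J x v = D x := fun x => by
    rw [← Finset.sum_subset (Finset.subset_univ T) fun v _ hv => hJT x v hv,
      ← Finset.add_sum_erase T (J x) hv₀, hJ0, ← Finset.sum_coe_sort]
    simp only [D, hJi]; rfl
  have hJc : ∀ v, Continuous fun x => J x v := fun v => by
    by_cases h : v ∈ T.erase v₀
    · simp only [J, dif_pos h]; fun_prop
    · simp only [J, dif_neg h]; fun_prop
  have hDc : Continuous D := by simp only [D]; fun_prop
  let j : (ι → ℝ) → Ω → ℝ := fun x v => J x v / D x
  have hjc : Continuous j := continuous_pi fun v => (hJc v).div hDc fun x => (hD x).ne'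
  have hjK : ∀ x, j x ∈ carrier σ := fun x => by
    refine ⟨⟨fun v => ?_, ?_⟩, T, hT, fun v hv => by simp [j, hJT x v hv]⟩
    · refine div_nonneg ?_ (hD x).le
      by_cases hv : v ∈ T
      · exact (hJpos x v hv).le
      · rw [hJT x v hv]
    · simp only [j]
      rw [← Finset.sum_div, hJsum, div_self (hD x).ne']
  have hjpos : ∀ x, ∀ v ∈ T, 0 < j x v := fun x v hv => div_pos (hJpos x v hv) (hD x)
  let W : Set (Ω → ℝ) := {y | ∀ v ∈ T, 0 < y v}
  have hW : IsOpen W := by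
    have : W = ⋂ v ∈ T, {y : Ω → ℝ | 0 < y v} := by
      ext y; simp only [Set.mem_iInter]; rfl
    rw [this]
    exact isOpen_biInter_finset fun v _ => isOpen_lt continuous_const (continuous_apply v)
  have hWT : ∀ y ∈ carrier σ, y ∈ W → ∀ v, v ∉ T → y v = 0 := by
    rintro y ⟨-, s, hs, h⟩ hy v hv
    have hTs : T ⊆ s := fun u hu => by
      by_contra hus
      exact (hy u hu).ne' (h u hus)
    rw [← Finset.eq_of_subset_of_card_le hTs (hmax s hs)] at h
    exact h v hv
  let k : (Ω → ℝ) → ι → ℝ := fun y i => Real.log (y i / y v₀)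
  have hkc : ContinuousOn k W := by
    refine continuousOn_pi.2 fun i => ?_
    refine ContinuousOn.log (ContinuousOn.div (by fun_prop) (by fun_prop)
      fun y hy => (hy v₀ hv₀).ne') fun y hy => ?_
    exact (div_pos (hy i (Finset.mem_of_mem_erase i.2)) (hy v₀ hv₀)).ne'
  have hjk : ∀ y ∈ carrier σ, y ∈ W → j (k y) = y := by
    intro y hy hyW
    have h0 := hyW v₀ hv₀
    have hJk : ∀ v, J (k y) v = y v / y v₀ := by
      intro v
      by_cases h : v ∈ T.erase v₀
      · rw [hJi _ ⟨v, h⟩]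
        exact Real.exp_log (div_pos (hyW v (Finset.mem_of_mem_erase h)) h0)
      · by_cases h' : v = v₀
        · rw [h', hJ0, div_self h0.ne']
        · have hv : v ∉ T := fun hv => h (Finset.mem_erase.2 ⟨h', hv⟩)
          rw [hJT _ v hv, hWT y hy hyW v hv, zero_div]
    have hDk : D (k y) = 1 / y v₀ := by
      rw [← hJsum, Finset.sum_congr rfl fun v _ => hJk v, ← Finset.sum_div, hy.1.2]
    funext v
    simp only [j]
    rw [hJk, hDk]
    field_simp
  have hkj : ∀ x, k (j x) = x := by
    intro x
    funext i
    simp only [k, j]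
    rw [hJ0, hJi, div_div_div_cancel_right₀ (hD x).ne', div_one, Real.log_exp]
  set m := j 0 with hm
  let q : Ω → ℝ := Pi.single v₀ 1
  have hq : q ∈ carrier σ := by
    refine ⟨⟨fun v => ?_, by simp [q]⟩, T, hT, fun v hv => ?_⟩
    · by_cases h : v = v₀
      · subst h; simp [q]
      · simp [q, h]
    · have : v ≠ v₀ := fun h => hv (h ▸ hv₀)
      simp [q, this]
  have hjq : ∀ x, j x ∈ carrier σ \ {q} := fun x => by
    refine ⟨hjK x, fun h => ?_⟩
    obtain ⟨u, hu⟩ : (T.erase v₀).Nonempty := by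
      rw [← Finset.card_pos, Finset.card_erase_of_mem hv₀]; omega
    have h1 := hjpos x u (Finset.mem_of_mem_erase hu)
    rw [h] at h1
    simp [q, Finset.ne_of_mem_erase hu] at h1
  obtain ⟨z, ζ, hz, hzm⟩ := exists_isPlaneChart_zero e hq m
  have hζ0 : ζ 0 = m := by rw [← hzm, hz.left_inv m (hjq 0)]
  -- In the simplex coordinates the chart `z` has a logarithm off one point.
  obtain ⟨L, hLc, hL⟩ := exists_log_compl_zero (E := ι → ℝ) (f := fun x => z (j x)) (by
      rw [Module.finrank_fintype_fun_eq_card, Fintype.card_coe, Finset.card_erase_of_mem hv₀]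
      omega)
    (hz.cont.comp hjc.continuousOn fun x _ => hjq x)
    (fun x hx => hz.ne_zero (hjq 0) hzm (hjq x) fun h => hx (by rw [← hkj x, h, hkj]))
  have hmem : ζ ⁻¹' W ∈ nhds (0 : ℂ) :=
    (hW.preimage hz.cont_inv).mem_nhds (by
      rw [Set.mem_preimage, hζ0]; exact fun v hv => hjpos 0 v hv)
  obtain ⟨r, hr, hrW⟩ := Metric.mem_nhds_iff.1 hmem
  set ρ := r / 2 with hρ
  have hρ0 : 0 < ρ := by positivity
  have hnorm : ∀ θ : ℝ, ‖(ρ : ℂ) * exp (θ * I)‖ = ρ := fun θ => by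
    rw [norm_mul, norm_exp_ofReal_mul_I, mul_one, norm_real, Real.norm_eq_abs, abs_of_pos hρ0]
  have hin : ∀ θ : ℝ, ζ (ρ * exp (θ * I)) ∈ W := fun θ => hrW (by
    rw [mem_ball_zero_iff, hnorm, hρ]; linarith)
  have hk0 : ∀ θ : ℝ, k (ζ (ρ * exp (θ * I))) ≠ 0 := by
    intro θ h0
    have h1 := hjk _ (hz.mem (ρ * exp (θ * I))).1 (hin θ)
    rw [h0, ← hm] at h1
    have h2 := hz.right_inv (ρ * exp (θ * I))
    rw [← h1, hzm] at h2
    have h3 := hnorm θ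
    rw [← h2, norm_zero] at h3
    exact hρ0.ne h3
  have hcont : Continuous fun θ : ℝ => L (k (ζ (ρ * exp (θ * I)))) := by
    have h1 : Continuous fun θ : ℝ => ζ (ρ * exp (θ * I)) := hz.cont_inv.comp (by fun_prop)
    have h2 : Continuous fun θ : ℝ => k (ζ (ρ * exp (θ * I))) := hkc.comp_continuous h1 hin
    exact hLc.comp_continuous h2 hk0
  -- Read along a small circle around `0` in the plane, `L` is a logarithm that depends on the point
  -- alone, so it closes up, unlike the argument of the circle.
  have key := lift_circle hρ0 hcont.continuousOn fun θ _ => by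
    rw [hL _ (hk0 θ), hjk _ (hz.mem _).1 (hin θ), hz.right_inv]
  have hper : exp (((2 * Real.pi : ℝ) : ℂ) * I) = exp (((0 : ℝ) : ℂ) * I) := by
    push_cast; rw [exp_two_pi_mul_I]; simp
  rw [hper, sub_self] at key
  exact two_pi_I_ne_zero key.symm

/-- Degrees in the plane: near an isolated zero of a function, its change of argument along small
loops is a fixed multiple of the winding number. -/
lemma exists_degree {K : Set (Ω → ℝ)} {q m : Ω → ℝ} {z : (Ω → ℝ) → ℂ} {ζ : ℂ → Ω → ℝ}
    (hz : IsPlaneChart K q z ζ) (hm : m ∈ K \ {q}) (hzm : z m = 0) {F : (Ω → ℝ) → ℂ}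
    (hF : Continuous F) {W : Set (Ω → ℝ)} (hW : IsOpen W) (hmW : m ∈ W)
    (hF0 : ∀ x ∈ K, x ∈ W → x ≠ m → F x ≠ 0) :
    ∃ (n : ℤ) (r : ℝ), 0 < r ∧ ∀ γ : ℝ → Ω → ℝ, (∀ θ, γ θ ∈ K \ {q}) → (∀ θ, ‖z (γ θ)‖ < r) →
      ∀ ℓ Λ : ℝ → ℂ, Continuous ℓ → Continuous Λ → (∀ θ, exp (ℓ θ) = z (γ θ)) →
      (∀ θ ∈ Set.Icc 0 (2 * Real.pi), exp (Λ θ) = F (γ θ)) → γ (2 * Real.pi) = γ 0 →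
      Λ (2 * Real.pi) - Λ 0 = n * (ℓ (2 * Real.pi) - ℓ 0) := by
  have hζ0 : ζ 0 = m := by rw [← hzm, hz.left_inv m hm]
  have hmem : ζ ⁻¹' W ∈ nhds (0 : ℂ) :=
    (hW.preimage hz.cont_inv).mem_nhds (by rw [Set.mem_preimage, hζ0]; exact hmW)
  obtain ⟨r, hr, hrW⟩ := Metric.mem_nhds_iff.1 hmem
  -- The half-plane covers the punctured disc through `exp`, and `F` acquires a logarithm `M` there.
  -- Translation by the period changes `M` by `n` periods; this `n` is the degree.
  let H : Set ℂ := {w | w.re < Real.log r}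
  have hHo : IsOpen H := isOpen_lt continuous_re continuous_const
  have hHc : Convex ℝ H := convex_halfSpace_re_lt _
  have hHne : (Real.log r - 1 : ℂ) ∈ H := by
    change (Real.log r - 1 : ℂ).re < Real.log r
    simp
  have hexp : ∀ w ∈ H, ζ (exp w) ∈ W := fun w hw => hrW (by
    rw [mem_ball_zero_iff, norm_exp]
    exact (Real.lt_log_iff_exp_lt hr).1 hw)
  obtain ⟨M, hMc, hM⟩ := exists_log_of_starConvex (hHc.starConvex hHne) ⟨_, hHne⟩ hHo
    (f := fun w => F (ζ (exp w))) (hF.comp (hz.cont_inv.comp continuous_exp)).continuousOn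
    (fun w hw => hF0 _ (hz.mem _).1 (hexp w hw) fun h => by
      have := hz.right_inv (exp w)
      rw [h, hzm] at this
      exact exp_ne_zero w this.symm)
  have hshift : ∀ w ∈ H, ∀ k : ℤ, w + k * (2 * Real.pi * I) ∈ H := fun w hw k => by
    change (w + k * (2 * Real.pi * I)).re < Real.log r
    have hw' : w.re < Real.log r := hw
    simpa using hw'
  set w₀ : ℂ := Real.log r - 1 with hw₀
  have hex : ∃ n : ℤ, M (w₀ + (1 : ℤ) * (2 * Real.pi * I)) - M w₀ = n * (2 * Real.pi * I) := by
    have : exp (M (w₀ + (1 : ℤ) * (2 * Real.pi * I))) = exp (M w₀) := by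
      rw [hM _ (hshift w₀ hHne 1), hM _ hHne, exp_periodic.int_mul 1]
    obtain ⟨n, hn⟩ := exp_eq_exp_iff_exists_int.1 this
    exact ⟨n, by rw [hn]; ring⟩
  obtain ⟨n, hn⟩ := hex
  have hone : ∀ w ∈ H, M (w + (1 : ℤ) * (2 * Real.pi * I)) = M w + n * (2 * Real.pi * I) := by
    intro w hw
    have := log_sub_eq (s := H) hHc.isPreconnected
      (L := fun w => M (w + (1 : ℤ) * (2 * Real.pi * I))) (L' := M)
      (hMc.comp (by fun_prop) fun w hw => hshift w hw 1) hMc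
      (fun w hw => by rw [hM _ (hshift w hw 1), hM w hw, exp_periodic.int_mul 1]) hw hHne
    rw [hn] at this
    linear_combination this
  have hall : ∀ k : ℤ, ∀ w ∈ H, M (w + k * (2 * Real.pi * I)) = M w + n * k * (2 * Real.pi * I) := by
    intro k
    induction k using Int.induction_on with
    | zero => intro w _; simp
    | succ k ih =>
      intro w hw
      have := hone _ (hshift w hw k)
      rw [ih w hw] at this
      rw [show w + ((k + 1 : ℤ) : ℂ) * (2 * Real.pi * I) = w + (k : ℤ) * (2 * Real.pi * I) +
        (1 : ℤ) * (2 * Real.pi * I) by push_cast; ring, this]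
      push_cast; ring
    | pred k ih =>
      intro w hw
      have := hone _ (hshift w hw (-k - 1))
      rw [show w + ((-k - 1 : ℤ) : ℂ) * (2 * Real.pi * I) +
        (1 : ℤ) * (2 * Real.pi * I) = w + ((-k : ℤ) : ℂ) * (2 * Real.pi * I) by push_cast; ring,
        ih w hw] at this
      push_cast at this ⊢
      linear_combination -this
  refine ⟨n, r, hr, fun γ hγ hγr ℓ Λ hℓc hΛc hℓ hΛ hper => ?_⟩
  have hℓH : ∀ θ, ℓ θ ∈ H := fun θ => by
    have := hγr θ
    rw [← hℓ, norm_exp] at this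
    exact (Real.lt_log_iff_exp_lt hr).2 this
  have hpi := Real.pi_pos
  have h1 := log_sub_eq (s := Set.Icc 0 (2 * Real.pi)) isPreconnected_Icc
    (L := fun θ => M (ℓ θ)) (L' := Λ) (hMc.comp_continuous hℓc hℓH).continuousOn hΛc.continuousOn
    (fun θ hθ => by rw [hM _ (hℓH θ), hℓ, hz.left_inv _ (hγ θ), hΛ θ hθ])
    (x := 2 * Real.pi) (y := 0) ⟨by positivity, le_rfl⟩ ⟨le_rfl, by positivity⟩
  have h2 : exp (ℓ (2 * Real.pi)) = exp (ℓ 0) := by rw [hℓ, hℓ, hper]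
  obtain ⟨k, hk⟩ := exp_eq_exp_iff_exists_int.1 h2
  have h3 := hall k _ (hℓH 0)
  rw [← hk] at h3
  rw [h3] at h1
  rw [hk]
  linear_combination -h1

end TautFilling

/-! ### At most two triangles on an edge -/

namespace TautFilling

open Metric Complex

variable {Ω : Type*}

/-- A function vanishing only at the midpoint of `ab`, which winds once around the boundary of a
pair of pages if and only if `abc` is one of them. -/
noncomputable def pageFun (a b c : Ω) (x : Ω → ℝ) : ℂ :=
  (((x a - x b : ℝ) : ℂ) + (x c : ℝ) * I) ^ 2 + ((1 - x a - x b - x c : ℝ) : ℂ) ^ 2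

lemma continuous_pageFun (a b c : Ω) : Continuous (pageFun a b c) := by
  unfold pageFun
  fun_prop

variable [DecidableEq Ω]

/-- Two pages of an open book with spine `ab`: the union of the triangles `abc` and `abd`,
parametrised near the midpoint of the spine by the plane. -/
noncomputable def page (a b c d : Ω) (w : ℂ) : Ω → ℝ :=
  Pi.single a ((1 - |w.im| + w.re) / 2) + Pi.single b ((1 - |w.im| - w.re) / 2) +
    Pi.single c (max w.im 0) + Pi.single d (max (-w.im) 0)

lemma continuous_page (a b c d : Ω) : Continuous (page a b c d) := by
  have h : ∀ (v : Ω) (f : ℂ → ℝ), Continuous f → Continuous fun w => (Pi.single v (f w) : Ω → ℝ) :=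
    fun v f hf => (continuous_single v).comp hf
  unfold page
  refine (((h a _ ?_).add (h b _ ?_)).add (h c _ ?_)).add (h d _ ?_) <;> fun_prop

lemma page_zero (a b c d : Ω) :
    page a b c d 0 = Pi.single a (1 / 2) + Pi.single b (1 / 2) := by
  simp [page]

section Values

variable {a b c d : Ω} (w : ℂ)

lemma page_left (hab : a ≠ b) (hac : a ≠ c) (had : a ≠ d) :
    page a b c d w a = (1 - |w.im| + w.re) / 2 := by
  simp [page, hab, hac, had]

lemma page_right (hab : a ≠ b) (hbc : b ≠ c) (hbd : b ≠ d) :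
    page a b c d w b = (1 - |w.im| - w.re) / 2 := by
  simp [page, hab.symm, hbc, hbd]

lemma page_top (hac : a ≠ c) (hbc : b ≠ c) (hcd : c ≠ d) : page a b c d w c = max w.im 0 := by
  simp [page, hac.symm, hbc.symm, hcd]

lemma page_other {v : Ω} (h1 : v ≠ a) (h2 : v ≠ b) (h3 : v ≠ c) (h4 : v ≠ d) :
    page a b c d w v = 0 := by
  simp [page, h1, h2, h3, h4]

lemma pageFun_page_of_nonneg (hab : a ≠ b) (hac : a ≠ c) (had : a ≠ d) (hbc : b ≠ c) (hbd : b ≠ d)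
    (hcd : c ≠ d) (h : 0 ≤ w.im) : pageFun a b c (page a b c d w) = w ^ 2 := by
  rw [pageFun, page_left w hab hac had, page_right w hab hbc hbd, page_top w hac hbc hcd,
    abs_of_nonneg h, max_eq_left h]
  conv_rhs => rw [← re_add_im w]
  push_cast
  ring

lemma pageFun_page_of_nonpos (hab : a ≠ b) (hac : a ≠ c) (had : a ≠ d) (hbc : b ≠ c) (hbd : b ≠ d)
    (hcd : c ≠ d) (h : w.im ≤ 0) : pageFun a b c (page a b c d w) = (‖w‖ : ℂ) ^ 2 := by
  rw [pageFun, page_left w hab hac had, page_right w hab hbc hbd, page_top w hac hbc hcd,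
    abs_of_nonpos h, max_eq_right h, ← ofReal_pow ‖w‖, Complex.sq_norm, normSq_apply]
  push_cast
  ring

lemma pageFun_page_other {v : Ω} (hab : a ≠ b) (hac : a ≠ c) (had : a ≠ d) (hbc : b ≠ c)
    (hbd : b ≠ d) (hva : v ≠ a) (hvb : v ≠ b) (hvc : v ≠ c) (hvd : v ≠ d) :
    pageFun a b v (page a b c d w) = (‖w‖ : ℂ) ^ 2 := by
  rw [pageFun, page_left w hab hac had, page_right w hab hbc hbd, page_other w hva hvb hvc hvd,
    ← ofReal_pow ‖w‖, Complex.sq_norm, normSq_apply]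
  have h : ((|w.im| : ℝ) : ℂ) * (|w.im| : ℝ) = w.im * w.im := by
    exact_mod_cast abs_mul_abs_self w.im
  push_cast
  linear_combination h

variable [Fintype Ω]

lemma sum_page : ∑ v, page a b c d w v = 1 := by
  simp only [page, Pi.add_apply, Finset.sum_add_distrib, Finset.sum_pi_single', Finset.mem_univ,
    if_true]
  rcases le_total 0 w.im with h | h
  · rw [abs_of_nonneg h, max_eq_left h, max_eq_right (by linarith)]; ring
  · rw [abs_of_nonpos h, max_eq_right h, max_eq_left (by linarith)]; ring

lemma page_mem {σ : PreAbstractSimplicialComplex Ω} (h1 : {a, b, c} ∈ σ) (h2 : {a, b, d} ∈ σ)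
    (hw : ‖w‖ ≤ 1 / 2) : page a b c d w ∈ carrier σ := by
  have hre := abs_le.1 ((abs_re_le_norm w).trans hw)
  have him := (abs_im_le_norm w).trans hw
  have hs : ∀ (u v : Ω) {r : ℝ}, 0 ≤ r → 0 ≤ (Pi.single u r : Ω → ℝ) v := fun u v r hr => by
    rw [Pi.single_apply]; split_ifs; exacts [hr, le_rfl]
  refine ⟨⟨fun v => ?_, sum_page w⟩, ?_⟩
  · have h1 := hs a v (r := (1 - |w.im| + w.re) / 2) (by linarith)
    have h2 := hs b v (r := (1 - |w.im| - w.re) / 2) (by linarith)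
    have h3 := hs c v (le_max_right w.im 0)
    have h4 := hs d v (le_max_right (-w.im) 0)
    simp only [page, Pi.add_apply]
    positivity
  · rcases le_total 0 w.im with h | h
    · refine ⟨_, h1, fun v hv => ?_⟩
      simp only [Finset.mem_insert, Finset.mem_singleton, not_or] at hv
      simp [page, hv.1, hv.2.1, hv.2.2, max_eq_right (show -w.im ≤ 0 by linarith)]
    · refine ⟨_, h2, fun v hv => ?_⟩
      simp only [Finset.mem_insert, Finset.mem_singleton, not_or] at hv
      simp [page, hv.1, hv.2.1, hv.2.2, max_eq_right h]

end Values

variable [Fintype Ω]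


/-- By `card_le_three` a simplex containing `abc` is `abc`, so either `x c` or the weight off `abc`
vanishes. In each case the real and imaginary parts of the function allow only the midpoint of `ab`
as a zero. -/
lemma pageFun_ne_zero {σ : PreAbstractSimplicialComplex Ω} (hσ : IsSphere2 σ) {a b c : Ω}
    (hab : a ≠ b) (hac : a ≠ c) (hbc : b ≠ c) {x : Ω → ℝ} (hx : x ∈ carrier σ) (hxa : 0 < x a)
    (hxb : 0 < x b) (hxm : x ≠ Pi.single a (1 / 2) + Pi.single b (1 / 2)) :
    pageFun a b c x ≠ 0 := by
  intro h0
  obtain ⟨⟨hx0, hx1⟩, s, hs, hxs⟩ := hx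
  have hsub : ∀ v, x v ≠ 0 → v ∈ s := fun v hv => by_contra fun h => hv (hxs v h)
  have h3 : x c = 0 ∨ 1 - x a - x b - x c = 0 := by
    by_cases hc : x c = 0
    · exact Or.inl hc
    right
    have hsab : {a, b, c} ⊆ s := by
      intro v hv
      simp only [Finset.mem_insert, Finset.mem_singleton] at hv
      rcases hv with rfl | rfl | rfl
      exacts [hsub _ hxa.ne', hsub _ hxb.ne', hsub _ hc]
    have heq : ({a, b, c} : Finset Ω) = s := Finset.eq_of_subset_of_card_le hsab
      ((card_le_three hσ hs).trans (Finset.card_eq_three.2 ⟨a, b, c, hab, hac, hbc, rfl⟩).ge)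
    have hsum : ∑ v ∈ ({a, b, c} : Finset Ω), x v = 1 := by
      rw [← hx1]
      exact Finset.sum_subset (Finset.subset_univ _) fun v _ hv => hxs v (heq ▸ hv)
    rw [Finset.sum_insert (by simp [hab, hac]), Finset.sum_pair hbc] at hsum
    linarith
  have hre := congrArg re h0
  have him := congrArg im h0
  simp only [pageFun, pow_two, add_re, mul_re, ofReal_re, ofReal_im, I_re, I_im, add_im, mul_im,
    zero_re, zero_im, mul_zero, mul_one, sub_zero, add_zero, zero_add, zero_mul] at hre him
  have hd : x a - x b = 0 ∧ x c = 0 ∧ 1 - x a - x b - x c = 0 := by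
    rcases h3 with h | h
    · rw [h] at hre ⊢
      refine ⟨?_, rfl, ?_⟩ <;> nlinarith [sq_nonneg (x a - x b), sq_nonneg (1 - x a - x b - 0)]
    · rw [h] at hre ⊢
      have h' : (x a - x b) * x c = 0 := by linarith
      rcases mul_eq_zero.1 h' with h' | h'
      · rw [h'] at hre ⊢
        exact ⟨rfl, by nlinarith, rfl⟩
      · rw [h'] at hre ⊢
        exact ⟨by nlinarith, rfl, rfl⟩
  apply hxm
  have hxv : ∀ v, v ≠ a → v ≠ b → x v = 0 := by
    intro v hva hvb
    have := Finset.sum_le_sum_of_subset_of_nonneg (f := x) (Finset.subset_univ {a, b, v})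
      fun i _ _ => hx0 i
    rw [hx1, Finset.sum_insert (by simp [hab, hva.symm]), Finset.sum_pair hvb.symm] at this
    linarith [hx0 v]
  funext v
  by_cases hva : v = a
  · subst hva; simp [hab]; linarith
  · by_cases hvb : v = b
    · subst hvb; simp [hab.symm]; linarith
    · simp [hva, hvb, hxv v hva hvb]

/-- No edge of a triangulated `2`-sphere lies on three triangles. -/
theorem eq_or_eq_of_triangles {σ : PreAbstractSimplicialComplex Ω} (hσ : IsSphere2 σ)
    {a b c d e : Ω} (hab : a ≠ b) (hac : a ≠ c) (had : a ≠ d) (hae : a ≠ e) (hbc : b ≠ c)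
    (hbd : b ≠ d) (hbe : b ≠ e) (hc : {a, b, c} ∈ σ) (hd : {a, b, d} ∈ σ) (he : {a, b, e} ∈ σ) :
    c = d ∨ c = e ∨ d = e := by
  by_contra! hne
  obtain ⟨hcd, hce, hde⟩ := hne
  obtain ⟨f⟩ := id hσ
  set m : Ω → ℝ := Pi.single a (1 / 2) + Pi.single b (1 / 2) with hm
  have hma : m a = 1 / 2 := by simp [hm, hab]
  have hmb : m b = 1 / 2 := by simp [hm, hab.symm]
  have hmK : m ∈ carrier σ := by
    rw [hm, ← page_zero a b c d]; exact page_mem 0 hc hd (by simp)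
  have hq : (Pi.single a 1 : Ω → ℝ) ∈ carrier σ :=
    ⟨single_mem_stdSimplex ℝ a, _, hc, fun v hv => by
      simp only [Finset.mem_insert, not_or] at hv; simp [hv.1]⟩
  obtain ⟨z, ζ, hz, hzm⟩ := exists_isPlaneChart_zero f hq m
  have hmq : m ∈ carrier σ \ {Pi.single a 1} := ⟨hmK, fun h => by
    have := congrFun (Set.mem_singleton_iff.1 h) b
    rw [hmb] at this; simp [hab.symm] at this⟩
  let W : Set (Ω → ℝ) := {x | 0 < x a} ∩ {x | 0 < x b}
  have hW : IsOpen W := (isOpen_lt continuous_const (continuous_apply a)).inter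
    (isOpen_lt continuous_const (continuous_apply b))
  have hmW : m ∈ W := ⟨by simp [hma], by simp [hmb]⟩
  have hdeg := fun (v : Ω) (hav : a ≠ v) (hbv : b ≠ v) =>
    exists_degree hz hmq hzm (continuous_pageFun a b v) hW hmW
      fun x hx hxW hxm => pageFun_ne_zero hσ hab hav hbv hx hxW.1 hxW.2 hxm
  -- Small loops around the midpoint inside two pages, with a logarithm of the chart along them. The
  -- bound `δ / 2` keeps the loop close enough in the chart, and `1 / 4` keeps it inside the two
  -- triangles.
  have hloop : ∀ {c d : Ω}, a ≠ c → a ≠ d → b ≠ c → b ≠ d → c ≠ d → {a, b, c} ∈ σ → {a, b, d} ∈ σ →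
      ∀ r > 0, ∃ ρ : ℝ, 0 < ρ ∧ (∀ θ : ℝ, page a b c d (ρ * exp (θ * I)) ∈
        carrier σ \ {Pi.single a 1}) ∧ (∀ θ : ℝ, ‖z (page a b c d (ρ * exp (θ * I)))‖ < r) ∧
        ∃ ℓ : ℝ → ℂ, Continuous ℓ ∧ ∀ θ : ℝ, exp (ℓ θ) = z (page a b c d (ρ * exp (θ * I))) := by
    intro c d hac had hbc hbd hcd hc hd r hr
    have hmem : ∀ w : ℂ, ‖w‖ < 1 / 2 → page a b c d w ∈ carrier σ \ {Pi.single a 1} := by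
      refine fun w hw => ⟨page_mem w hc hd hw.le, fun h => ?_⟩
      have := congrFun (Set.mem_singleton_iff.1 h) a
      rw [page_left w hab hac had, Pi.single_eq_same] at this
      linarith [abs_nonneg w.im, le_abs_self w.re, abs_re_le_norm w]
    have hcont : ContinuousOn (fun w => z (page a b c d w)) (ball 0 (1 / 2)) :=
      hz.cont.comp (continuous_page a b c d).continuousOn fun w hw => hmem w (by simpa using hw)
    have h0 : ContinuousAt (fun w => z (page a b c d w)) 0 :=
      hcont.continuousAt (ball_mem_nhds _ (by norm_num))
    obtain ⟨δ, hδ, hδr⟩ := Metric.continuousAt_iff.1 h0 r hr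
    have hρ : 0 < min (δ / 2) (1 / 4) := by positivity
    have hn : ∀ θ : ℝ, ‖((min (δ / 2) (1 / 4) : ℝ) : ℂ) * exp (θ * I)‖ = min (δ / 2) (1 / 4) :=
      fun θ => by rw [norm_mul, norm_exp_ofReal_mul_I, mul_one, norm_real, Real.norm_of_nonneg hρ.le]
    have hmem' : ∀ θ : ℝ, page a b c d ((min (δ / 2) (1 / 4) : ℝ) * exp (θ * I)) ∈
        carrier σ \ {Pi.single a 1} := fun θ => hmem _ (by
      rw [hn]; exact (min_le_right _ _).trans_lt (by norm_num))
    refine ⟨_, hρ, hmem', fun θ => ?_, ?_⟩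
    · have := hδr (x := (min (δ / 2) (1 / 4) : ℝ) * exp (θ * I)) (by
        rw [dist_zero_right, hn]; exact (min_le_left _ _).trans_lt (by linarith))
      rwa [page_zero, ← hm, hzm, dist_zero_right] at this
    · obtain ⟨L, hL, hL'⟩ := exists_log_of_starConvex (convex_univ.starConvex (Set.mem_univ (0 : ℝ)))
        Set.univ_nonempty isOpen_univ
        (f := fun θ : ℝ => z (page a b c d ((min (δ / 2) (1 / 4) : ℝ) * exp (θ * I))))
        (by
          refine ContinuousOn.comp (t := carrier σ \ {Pi.single a 1}) hz.cont ?_ fun θ _ => hmem' θ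
          exact ((continuous_page a b c d).comp (by fun_prop)).continuousOn)
        (fun θ _ => hz.ne_zero hmq hzm (hmem' θ) fun h => by
          set w : ℂ := (min (δ / 2) (1 / 4) : ℝ) * exp (θ * I) with hw
          have h1 := congrFun h a
          have h2 := congrFun h b
          rw [page_left w hab hac had, hma] at h1
          rw [page_right w hab hbc hbd, hmb] at h2
          have h3 : |w.im| = 0 := by linarith
          have h4 : w = 0 := Complex.ext (by rw [zero_re]; linarith) (abs_eq_zero.1 h3)
          have := hn θ
          rw [← hw, h4, norm_zero] at this
          linarith)
      exact ⟨L, continuousOn_univ.1 hL, fun θ => hL' θ trivial⟩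
  have hper : ∀ ρ : ℝ, (ρ : ℂ) * exp ((2 * Real.pi : ℝ) * I) = ρ * exp ((0 : ℝ) * I) := fun ρ => by
    push_cast; rw [exp_two_pi_mul_I]; simp
  have hone : ∀ {c d : Ω} {ρ : ℝ}, a ≠ c → a ≠ d → b ≠ c → b ≠ d → c ≠ d → 0 < ρ →
      ∃ Λ : ℝ → ℂ, Continuous Λ ∧ (∀ θ ∈ Set.Icc 0 (2 * Real.pi), exp (Λ θ) =
        pageFun a b c (page a b c d (ρ * exp (θ * I)))) ∧
        Λ (2 * Real.pi) - Λ 0 = 2 * Real.pi * I := by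
    intro c d ρ hac had hbc hbd hcd hρ
    have hpi := Real.pi_pos
    have him : ∀ θ : ℝ, ((ρ : ℂ) * exp (θ * I)).im = ρ * Real.sin θ := fun θ => by
      rw [im_ofReal_mul, exp_ofReal_mul_I_im]
    have hn : ∀ θ : ℝ, ‖(ρ : ℂ) * exp (θ * I)‖ = ρ := fun θ => by
      rw [norm_mul, norm_exp_ofReal_mul_I, mul_one, norm_real, Real.norm_of_nonneg hρ.le]
    have hlog : exp ((2 * Real.log ρ : ℝ) : ℂ) = (ρ : ℂ) ^ 2 := by
      rw [two_mul, ofReal_add, exp_add, ← ofReal_exp, Real.exp_log hρ, sq]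
    -- On the page `abc` the function is the square of the parameter and the half circle gives a
    -- full turn; on the other page it is a positive constant along the loop.
    refine ⟨fun θ => (2 * Real.log ρ : ℝ) + (2 * min θ Real.pi : ℝ) * I, by fun_prop, ?_, ?_⟩
    · rintro θ ⟨h0, h2⟩
      rw [exp_add, hlog]
      rcases le_total θ Real.pi with h | h
      · rw [pageFun_page_of_nonneg _ hab hac had hbc hbd hcd (by
          rw [him]; exact mul_nonneg hρ.le (Real.sin_nonneg_of_nonneg_of_le_pi h0 h)),
          min_eq_left h, mul_pow, ← exp_nat_mul]
        push_cast; ring_nf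
      · rw [pageFun_page_of_nonpos _ hab hac had hbc hbd hcd (by
          rw [him, ← Real.sin_sub_two_pi]
          exact mul_nonpos_of_nonneg_of_nonpos hρ.le
            (Real.sin_nonpos_of_nonpos_of_neg_pi_le (by linarith) (by linarith))),
          min_eq_right h, hn]
        push_cast; rw [exp_two_pi_mul_I, mul_one]
    · simp only [min_eq_right (show Real.pi ≤ 2 * Real.pi by linarith), min_eq_left hpi.le]
      push_cast; ring
  -- Along the loop in the pages `c`, `d`, the function of `c` turns once and that of `e` not at
  -- all. Hence the loop winds in the chart and the degree `n₂` of the function of `e` is zero. But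
  -- this function turns once along the loop in the pages `e`, `c`.
  obtain ⟨n₁, r₁, hr₁, h₁⟩ := hdeg c hac hbc
  obtain ⟨n₂, r₂, hr₂, h₂⟩ := hdeg e hae hbe
  obtain ⟨ρ, hρ, hK, hr, ℓ, hℓ, hℓ'⟩ := hloop hac had hbc hbd hcd hc hd (min r₁ r₂) (lt_min hr₁ hr₂)
  obtain ⟨ρ', hρ', hK', hr', ℓ', hℓ₁, hℓ₁'⟩ := hloop hae hac hbe hbc hce.symm he hc r₂ hr₂
  obtain ⟨Λ, hΛ, hΛ', hΛd⟩ := hone hac had hbc hbd hcd hρ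
  obtain ⟨Λ', hΛ₁, hΛ₁', hΛd'⟩ := hone hae hac hbe hbc hce.symm hρ'
  have e1 := h₁ _ hK (fun θ => (hr θ).trans_le (min_le_left _ _)) ℓ Λ hℓ hΛ hℓ' hΛ' (by rw [hper])
  have e2 := h₂ _ hK (fun θ => (hr θ).trans_le (min_le_right _ _)) ℓ (fun _ => (2 * Real.log ρ : ℝ))
    hℓ continuous_const hℓ' (fun θ _ => by
      rw [pageFun_page_other _ hab hac had hbc hbd hae.symm hbe.symm hce.symm hde.symm, norm_mul,
        norm_exp_ofReal_mul_I, mul_one, norm_real, Real.norm_of_nonneg hρ.le, two_mul, ofReal_add,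
        exp_add, ← ofReal_exp, Real.exp_log hρ, sq]) (by rw [hper])
  have e3 := h₂ _ hK' hr' ℓ' Λ' hℓ₁ hΛ₁ hℓ₁' hΛ₁' (by rw [hper])
  rw [hΛd] at e1
  rw [hΛd'] at e3
  rw [sub_self] at e2
  rcases mul_eq_zero.1 e2.symm with h | h
  · rw [h, zero_mul] at e3; exact two_pi_I_ne_zero e3
  · rw [h, mul_zero] at e1; exact two_pi_I_ne_zero e1

end TautFilling

/-! ### Strong connectivity and first cohomology of triangulated spheres -/

namespace TautFilling

open Metric Complex

variable {Ω : Type*}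

section Barycentre

variable [DecidableEq Ω]

/-- The barycentre of a simplex. -/
noncomputable def barycentre (s : Finset Ω) (v : Ω) : ℝ := if v ∈ s then (s.card : ℝ)⁻¹ else 0

lemma barycentre_ne_zero {s : Finset Ω} {v : Ω} (hv : v ∈ s) : barycentre s v ≠ 0 := by
  have : (s.card : ℝ) ≠ 0 := by exact_mod_cast (Finset.card_pos.2 ⟨v, hv⟩).ne'
  simp [barycentre, hv, this]

lemma barycentre_notMem_range {s : Finset Ω} (hs : 2 ≤ s.card) :
    barycentre s ∉ Set.range fun v => (Pi.single v 1 : Ω → ℝ) := by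
  rintro ⟨v, hv⟩
  obtain ⟨w, hw, hwv⟩ := Finset.exists_mem_ne (by omega : 1 < s.card) v
  refine barycentre_ne_zero hw ?_
  rw [← hv]
  simp [hwv]

end Barycentre

variable [Fintype Ω]

lemma convex_body_singleton (s : Finset Ω) : Convex ℝ (body {s}) := by
  intro x hx y hy a b ha hb hab
  rw [mem_body_single] at *
  exact ⟨convex_stdSimplex ℝ Ω hx.1 hy.1 ha hb hab, fun v hv => by simp [hx.2 v hv, hy.2 v hv]⟩

variable [DecidableEq Ω]

lemma two_le_card_of_notMem_range {x : Ω → ℝ} (hx : x ∈ stdSimplex ℝ Ω)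
    (hxP : x ∉ Set.range fun v => (Pi.single v 1 : Ω → ℝ)) {s : Finset Ω}
    (hs : ∀ v, v ∉ s → x v = 0) : 2 ≤ s.card := by
  by_contra! h
  have hsum : ∑ v ∈ s, x v = 1 := by
    rw [← hx.2]
    exact Finset.sum_subset (Finset.subset_univ _) fun v _ hv => hs v hv
  have h1 : s.card = 1 := by
    have : s.Nonempty := by
      rw [Finset.nonempty_iff_ne_empty]
      rintro rfl
      simp at hsum
    have := this.card_pos
    omega
  obtain ⟨v, rfl⟩ := Finset.card_eq_one.1 h1
  rw [Finset.sum_singleton] at hsum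
  refine hxP ⟨v, funext fun w => ?_⟩
  by_cases hw : w = v
  · subst hw; simp [hsum]
  · simp [hw, hs w (by simpa using hw)]

lemma barycentre_mem_stdSimplex {s : Finset Ω} (hs : s.Nonempty) :
    barycentre s ∈ stdSimplex ℝ Ω := by
  refine ⟨fun v => ?_, ?_⟩
  · unfold barycentre; split_ifs <;> positivity
  · have : (s.card : ℝ) ≠ 0 := by exact_mod_cast hs.card_pos.ne'
    simp [barycentre, this]

lemma exists_vertex_mem {σ : PreAbstractSimplicialComplex Ω} (hσ : IsSphere2 σ) :
    (carrier σ ∩ Set.range fun v => (Pi.single v 1 : Ω → ℝ)).Nonempty := by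
  obtain ⟨e⟩ := hσ
  have : (sphere (0 : EuclideanSpace ℝ (Fin 3)) 1).Nonempty :=
    NormedSpace.sphere_nonempty.2 zero_le_one
  obtain ⟨p, hp⟩ := this
  obtain ⟨x, hx⟩ := e.symm ⟨p, hp⟩
  obtain ⟨hx, s, hs, hxs⟩ := hx
  obtain ⟨v, hv⟩ : s.Nonempty := (σ.isRelLowerSet_faces hs).1
  exact ⟨Pi.single v 1, ⟨single_mem_stdSimplex ℝ v, s, hs, fun w hw => by
    simp [show w ≠ v from fun h => hw (h ▸ hv)]⟩, v, rfl⟩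

/-- A triangulated `2`-sphere is strongly connected. -/
theorem triangles_connected {σ : PreAbstractSimplicialComplex Ω} (hσ : IsSphere2 σ)
    {S : Finset Ω → Prop} (hS : ∃ t ∈ σ, t.card = 3 ∧ S t)
    (hstep : ∀ s ∈ σ, ∀ t ∈ σ, s.card = 3 → t.card = 3 → (s ∩ t).card = 2 → S s → S t)
    {t : Finset Ω} (ht : t ∈ σ) (ht3 : t.card = 3) : S t := by
  by_contra hSt
  obtain ⟨t', ht', ht'3, hSt'⟩ := hS
  have hP := exists_vertex_mem hσ
  obtain ⟨e⟩ := id hσ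
  set P := Set.range fun v => (Pi.single v 1 : Ω → ℝ) with hPdef
  -- Removing the vertices keeps the carrier connected and ensures that simplices with a common
  -- remaining point share an edge.
  have hconn := (isConnected_diff_finite e (Set.finite_range _) hP).isPreconnected
  let T₁ : Set (Finset Ω) := {t | t ∈ σ ∧ t.card = 3 ∧ S t}
  -- The bodies of `T₁` and `T₂` cover the carrier, so they meet off the vertices. A member of `T₂`
  -- meeting a triangle of `T₁` there is a triangle adjacent to it, and `hstep` puts it in `T₁`.
  let T₂ : Set (Finset Ω) := {s | s ∈ σ ∧ ∀ t ∈ T₁, ¬ s ⊆ t}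
  have hbary : ∀ {s : Finset Ω}, s ∈ σ → s.card = 3 → barycentre s ∈ carrier σ \ P := by
    intro s hs hs3
    exact ⟨⟨barycentre_mem_stdSimplex (Finset.card_pos.1 (by omega)), s, hs,
      fun v hv => if_neg hv⟩, barycentre_notMem_range (by omega)⟩
  have hb : ∀ {s : Finset Ω} {T : Set (Finset Ω)}, s ∈ σ → s.card = 3 → s ∈ T →
      (carrier σ \ P ∩ body T).Nonempty := fun {s T} hs hs3 hsT =>
    ⟨barycentre s, hbary hs hs3, (hbary hs hs3).1.1, s, hsT, fun v hv => if_neg hv⟩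
  obtain ⟨x, ⟨hxK, hxP⟩, ⟨hx, s, hs, hxs⟩, -, u, hu, hxu⟩ :=
    isPreconnected_closed_iff.1 hconn (body T₁) (body T₂) (isCompact_body _).isClosed
      (isCompact_body _).isClosed (by
        rintro x ⟨⟨hx, s, hs, hxs⟩, -⟩
        by_cases h : ∃ t ∈ T₁, s ⊆ t
        · obtain ⟨t, ht, hst⟩ := h
          exact Or.inl ⟨hx, t, ht, fun v hv => hxs v fun hv' => hv (hst hv')⟩
        · push Not at h
          exact Or.inr ⟨hx, s, ⟨hs, h⟩, hxs⟩)
      (hb ht' ht'3 ⟨ht', ht'3, hSt'⟩)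
      (hb ht ht3 ⟨ht, fun t'' ht'' hsub => hSt (by
        rw [Finset.eq_of_subset_of_card_le hsub (by rw [ht''.2.1, ht3])]; exact ht''.2.2)⟩)
  have h2 : 2 ≤ (s ∩ u).card := two_le_card_of_notMem_range hx hxP fun v hv => by
    rw [Finset.mem_inter, not_and_or] at hv
    exact hv.elim (hxs v) (hxu v)
  have hsub : ¬ u ⊆ s := hu.2 s hs
  have hlt : (s ∩ u).card < u.card := Finset.card_lt_card
    ⟨Finset.inter_subset_right, fun h => hsub (h.trans Finset.inter_subset_left)⟩
  have hu3 := card_le_three hσ hu.1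
  exact hu.2 u ⟨hu.1, by omega, hstep s hs.1 u hu.1 hs.2.1 (by omega) (by omega) hs.2.2⟩ subset_rfl

/-- A triangulated `2`-sphere has a triangle. -/
theorem exists_triangle {σ : PreAbstractSimplicialComplex Ω} (hσ : IsSphere2 σ) :
    ∃ t ∈ σ, t.card = 3 := by
  by_contra! hno
  have hcard : ∀ s ∈ σ, s.card ≤ 2 := fun s hs => by
    have := card_le_three hσ hs
    have := hno s hs
    omega
  have hP := exists_vertex_mem hσ
  obtain ⟨e⟩ := id hσ
  set P := Set.range fun v => (Pi.single v 1 : Ω → ℝ) with hPdef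
  obtain ⟨y, ⟨hy, s, hs, hys⟩, hyP⟩ :=
    (isConnected_diff_finite e (Set.finite_range _) hP).nonempty
  have hs2 := two_le_card_of_notMem_range hy hyP hys
  obtain ⟨a, b, hab, rfl⟩ := Finset.card_eq_two.1 (le_antisymm (hcard s hs) hs2)
  let p : ℝ → Ω → ℝ := fun r => Pi.single a r + Pi.single b (1 - r)
  have hpa : ∀ r, p r a = r := fun r => by simp [p, hab]
  have hpb : ∀ r, p r b = 1 - r := fun r => by simp [p, hab.symm]
  have hp0 : ∀ r v, v ∉ ({a, b} : Finset Ω) → p r v = 0 := fun r v hv => by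
    simp only [Finset.mem_insert, Finset.mem_singleton, not_or] at hv
    simp [p, hv.1, hv.2]
  have hp : ∀ r, 0 ≤ r → r ≤ 1 → p r ∈ stdSimplex ℝ Ω := fun r h0 h1 => by
    refine ⟨fun v => ?_, ?_⟩
    · by_cases hv : v ∈ ({a, b} : Finset Ω)
      · simp only [Finset.mem_insert, Finset.mem_singleton] at hv
        rcases hv with rfl | rfl
        · rw [hpa]; exact h0
        · rw [hpb]; linarith
      · rw [hp0 r v hv]
    · simp [p, Finset.sum_add_distrib]
  have hpeq : ∀ x ∈ stdSimplex ℝ Ω, (∀ v, v ∉ ({a, b} : Finset Ω) → x v = 0) → x = p (x a) := by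
    intro x hx hxab
    have hsum : ∑ v ∈ ({a, b} : Finset Ω), x v = 1 := by
      rw [← hx.2]
      exact Finset.sum_subset (Finset.subset_univ _) fun v _ hv => hxab v hv
    rw [Finset.sum_pair hab] at hsum
    funext v
    by_cases hv : v ∈ ({a, b} : Finset Ω)
    · simp only [Finset.mem_insert, Finset.mem_singleton] at hv
      rcases hv with rfl | rfl
      · rw [hpa]
      · rw [hpb]; linarith
    · rw [hp0 _ v hv, hxab v hv]
  -- In a complex of dimension one, removing the vertices and the midpoint of the edge `ab` cuts one
  -- half of this edge off from everything else.
  have hconn := (isConnected_diff_finite e (P := insert (p (1 / 2)) P)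
    ((Set.finite_range _).insert _) (hP.mono
      (Set.inter_subset_inter_right _ (Set.subset_insert _ _)))).isPreconnected
  have hpP : ∀ r, 0 < r → r < 1 → r ≠ 1 / 2 → p r ∈ carrier σ \ insert (p (1 / 2)) P := by
    refine fun r h0 h1 hr => ⟨⟨hp r h0.le h1.le, _, hs, hp0 r⟩, ?_⟩
    rintro (h | ⟨v, hv⟩)
    · have := congrFun h a
      rw [hpa, hpa] at this
      exact hr this
    · have h1 := congrFun hv a
      have h2 := congrFun hv b
      simp only [hpa, hpb, Pi.single_apply] at h1 h2
      split_ifs at h1 h2 <;> linarith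
  have hcl : ∀ v : Ω, IsClosed {x : Ω → ℝ | 1 / 2 ≤ x v} := fun v =>
    isClosed_le continuous_const (continuous_apply v)
  have hB := fun T : Set (Finset Ω) => (isCompact_body T).isClosed
  obtain ⟨x, ⟨hxK, hxP⟩, ⟨hx, hxa⟩, hx'⟩ := isPreconnected_closed_iff.1 hconn
      (body {{a, b}} ∩ {x | 1 / 2 ≤ x a})
      ((body {{a, b}} ∩ {x | 1 / 2 ≤ x b}) ∪ body {s | s ∈ σ ∧ s ≠ {a, b}})
      ((hB _).inter (hcl a)) (((hB _).inter (hcl b)).union (hB _)) (by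
        rintro x ⟨⟨hx, s, hs, hxs⟩, -⟩
        by_cases h : s = {a, b}
        · subst h
          have hm : x ∈ body {{a, b}} := ⟨hx, _, rfl, hxs⟩
          by_cases hxa : 1 / 2 ≤ x a
          · exact Or.inl ⟨hm, hxa⟩
          · refine Or.inr (Or.inl ⟨hm, ?_⟩)
            have := congrFun (hpeq x hx hxs) b
            rw [hpb] at this
            simp only [Set.mem_ofPred_eq]
            linarith
        · exact Or.inr (Or.inr ⟨hx, s, ⟨hs, h⟩, hxs⟩))
      ⟨p (3 / 4), hpP _ (by norm_num) (by norm_num) (by norm_num),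
        ⟨hp _ (by norm_num) (by norm_num), _, rfl, hp0 _⟩, by
          simp only [Set.mem_ofPred_eq, hpa]; norm_num⟩
      ⟨p (1 / 4), hpP _ (by norm_num) (by norm_num) (by norm_num),
        Or.inl ⟨⟨hp _ (by norm_num) (by norm_num), _, rfl, hp0 _⟩, by
          simp only [Set.mem_ofPred_eq, hpb]; norm_num⟩⟩
  rw [mem_body_single] at hx
  have hxp := hpeq x hx.1 hx.2
  rcases hx' with ⟨-, hxb⟩ | ⟨-, s, ⟨hs', hsne⟩, hxs⟩
  · refine hxP (Or.inl ?_)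
    have := congrFun hxp b
    rw [hpb] at this
    simp only [Set.mem_ofPred_eq] at hxa hxb
    rw [hxp, show x a = 1 / 2 by linarith]
  · have h2 := two_le_card_of_notMem_range hx.1 (fun h => hxP (Or.inr h)) (s := s ∩ {a, b})
      fun v hv => by
        rw [Finset.mem_inter, not_and_or] at hv
        exact hv.elim (hxs v) (hx.2 v)
    have e1 := Finset.eq_of_subset_of_card_le (Finset.inter_subset_left (s₁ := s) (s₂ := {a, b}))
      ((hcard s hs').trans h2)
    have e2 := Finset.eq_of_subset_of_card_le (Finset.inter_subset_right (s₁ := s) (s₂ := {a, b}))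
      ((hcard _ hs).trans h2)
    exact hsne (e1.symm.trans e2)

/-- The first cohomology of a triangulated `2`-sphere vanishes. -/
theorem exists_potential {σ : PreAbstractSimplicialComplex Ω} (hσ : IsSphere2 σ) {g : Ω → Ω → ℤ}
    (hg : ∀ a b, g b a = - g a b)
    (hc : ∀ a b c, a ≠ b → a ≠ c → b ≠ c → {a, b, c} ∈ σ → g a b + g b c + g c a = 0) :
    ∃ h : Ω → ℤ, ∀ a b, {a, b} ∈ σ → g a b = h b - h a := by
  have hg0 : ∀ a, g a a = 0 := fun a => by have := hg a a; omega
  have hc' : ∀ s ∈ σ, ∀ a ∈ s, ∀ b ∈ s, ∀ c ∈ s, g a b + g b c + g c a = 0 := by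
    intro s hs a ha b hb c hcs
    by_cases hab : a = b
    · subst hab; rw [hg0, hg a c]; omega
    by_cases hac : a = c
    · subst hac; rw [hg0, hg a b]; omega
    by_cases hbc : b = c
    · subst hbc; rw [hg0, hg a b]; omega
    refine hc a b c hab hac hbc ((σ.isRelLowerSet_faces hs).2 ?_ ⟨a, by simp⟩)
    intro v hv
    simp only [Finset.mem_insert, Finset.mem_singleton] at hv
    rcases hv with rfl | rfl | rfl <;> assumption
  -- The cocycle defines a map to the circle, the exponential of `ψ u` for any vertex `u` of the
  -- simplex: by the cocycle condition another choice of `u` changes the exponent by a multiple of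
  -- `2πi`.
  let ψ : Ω → (Ω → ℝ) → ℂ := fun u x => 2 * Real.pi * I * ((∑ v, x v * g u v : ℝ) : ℂ)
  have hψc : ∀ u, Continuous (ψ u) := fun u => by fun_prop
  have hψ : ∀ s ∈ σ, ∀ u ∈ s, ∀ u' ∈ s, ∀ x ∈ body {s}, exp (ψ u x) = exp (ψ u' x) := by
    intro s hs u hu u' hu' x hx
    rw [mem_body_single] at hx
    rw [exp_eq_exp_iff_exists_int]
    refine ⟨g u u', ?_⟩
    have : ∑ v, x v * (g u v : ℝ) = ∑ v, x v * (g u' v : ℝ) + g u u' := by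
      rw [← one_mul (g u u' : ℝ), ← hx.1.2, Finset.sum_mul, ← Finset.sum_add_distrib]
      refine Finset.sum_congr rfl fun v _ => ?_
      by_cases hv : v ∈ s
      · have h1 := hc' s hs u hu v hv u' hu'
        rw [hg u' v, hg u u'] at h1
        have h2 : (g u v : ℝ) = g u' v + g u u' := by
          have : g u v = g u' v + g u u' := by omega
          exact_mod_cast this
        rw [h2]; ring
      · simp [hx.2 v hv]
    simp only [ψ]
    rw [this]
    push_cast
    ring
  have hpos : ∀ x ∈ stdSimplex ℝ Ω, ∃ u, x u ≠ 0 := by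
    intro x hx
    by_contra! h
    have := hx.2
    simp [h] at this
  obtain ⟨t, ht, ht3⟩ := exists_triangle hσ
  obtain ⟨v₀, hv₀⟩ : t.Nonempty := Finset.card_pos.1 (by omega)
  let u : (Ω → ℝ) → Ω := fun x => if h : ∃ u, x u ≠ 0 then h.choose else v₀
  let φ : (Ω → ℝ) → ℂ := fun x => exp (ψ (u x) x)
  have hφ : ∀ s ∈ σ, ∀ a ∈ s, ∀ x ∈ body {s}, φ x = exp (ψ a x) := by
    intro s hs a ha x hx
    refine hψ s hs _ ?_ a ha x hx
    rw [mem_body_single] at hx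
    have h := hpos x hx.1
    simp only [u, dif_pos h]
    by_contra hu
    exact h.choose_spec (hx.2 _ hu)
  have hφc : ContinuousOn φ (carrier σ) := by
    have : carrier σ = ⋃ s : {s // s ∈ σ}, body {s.1} := by
      ext x
      rw [Set.mem_iUnion]
      constructor
      · rintro ⟨hx, s, hs, hxs⟩; exact ⟨⟨s, hs⟩, hx, s, rfl, hxs⟩
      · rintro ⟨s, hx⟩
        rw [mem_body_single] at hx
        exact ⟨hx.1, s, s.2, hx.2⟩
    rw [this]
    refine (locallyFinite_of_finite _).continuousOn_iUnion
      (fun s => (isCompact_body _).isClosed) fun s => ?_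
    obtain ⟨a, ha⟩ : s.1.Nonempty := (σ.isRelLowerSet_faces s.2).1
    exact ((continuous_exp.comp (hψc a)).continuousOn).congr fun x hx => hφ s.1 s.2 a ha x hx
  obtain ⟨e⟩ := id hσ
  -- Removing a point inside a triangle leaves a plane, on which the circle-valued map has a
  -- logarithm, and touches no edge.
  have hq : barycentre t ∈ carrier σ :=
    ⟨barycentre_mem_stdSimplex ⟨v₀, hv₀⟩, t, ht, fun v hv => if_neg hv⟩
  obtain ⟨z, ζ, hz⟩ := exists_isPlaneChart e hq
  obtain ⟨L, hL, hL'⟩ := exists_log_of_starConvex (convex_univ.starConvex (Set.mem_univ (0 : ℂ)))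
    Set.univ_nonempty isOpen_univ (f := fun w => φ (ζ w))
    (hφc.comp hz.cont_inv.continuousOn fun w _ => (hz.mem w).1) fun w _ => exp_ne_zero _
  have hΛc : ContinuousOn (fun x => L (z x)) (carrier σ \ {barycentre t}) :=
    (continuousOn_univ.1 hL).comp_continuousOn hz.cont
  have hΛ : ∀ x ∈ carrier σ \ {barycentre t}, exp (L (z x)) = φ x := fun x hx => by
    rw [hL' _ trivial, hz.left_inv x hx]
  have hseg : ∀ a b, {a, b} ∈ σ → body {{a, b}} ⊆ carrier σ \ {barycentre t} := by
    intro a b hab x hx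
    rw [mem_body_single] at hx
    refine ⟨⟨hx.1, _, hab, hx.2⟩, fun h => ?_⟩
    obtain ⟨w, hw, hw'⟩ := Finset.exists_mem_notMem_of_card_lt_card
      (show ({a, b} : Finset Ω).card < t.card by
        rw [ht3]; exact Finset.card_le_two.trans_lt (by norm_num))
    exact barycentre_ne_zero hw (by rw [← Set.mem_singleton_iff.1 h]; exact hx.2 w hw')
  have hvert : ∀ a b : Ω, (Pi.single a 1 : Ω → ℝ) ∈ body {{a, b}} := fun a b => by
    rw [mem_body_single]
    refine ⟨single_mem_stdSimplex ℝ a, fun v hv => ?_⟩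
    simp only [Finset.mem_insert, not_or] at hv
    simp [hv.1]
  have hψv : ∀ a b, ψ a (Pi.single b 1) = 2 * Real.pi * I * (g a b : ℂ) := fun a b => by
    have : ∑ v, (Pi.single b 1 : Ω → ℝ) v * (g a v : ℝ) = g a b := by simp [Pi.single_apply]
    simp only [ψ, this, ofReal_intCast]
  -- The map is `1` at each vertex, so the logarithm there is an integer multiple of `2πi`; these
  -- integers are the potential.
  have hh : ∀ a, ∃ n : ℤ, {a} ∈ σ → L (z (Pi.single a 1)) = n * (2 * Real.pi * I) := by
    intro a
    by_cases ha : {a} ∈ σ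
    · have ha' : ({a, a} : Finset Ω) ∈ σ := by simpa using ha
      have h1 := hΛ _ (hseg a a ha' (hvert a a))
      rw [hφ _ ha' a (by simp) _ (hvert a a), hψv, hg0, Int.cast_zero, mul_zero, exp_zero,
        exp_eq_one_iff] at h1
      exact h1.imp fun n hn _ => hn
    · exact ⟨0, fun h => absurd h ha⟩
  choose h hh using hh
  refine ⟨h, fun a b hab => ?_⟩
  have hvb : (Pi.single b 1 : Ω → ℝ) ∈ body {{a, b}} := Finset.pair_comm a b ▸ hvert b a
  -- Along the edge the logarithm and `ψ a` differ by a constant; comparing the two ends gives `g a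
  -- b`.
  have h1 := log_sub_eq (convex_body_singleton {a, b}).isPreconnected (hΛc.mono (hseg a b hab))
    (hψc a).continuousOn (fun x hx => by
      rw [hΛ x (hseg a b hab hx), hφ _ hab a (by simp) x hx]) (hvert a b) hvb
  have hla : {a} ∈ σ := (σ.isRelLowerSet_faces hab).2 (by simp) (by simp)
  have hlb : {b} ∈ σ := (σ.isRelLowerSet_faces hab).2 (by simp) (by simp)
  simp only [hψv, hg0, hh a hla, hh b hlb, Int.cast_zero, mul_zero, sub_zero] at h1
  have h2 : ((g a b : ℤ) : ℂ) = h b - h a := by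
    apply mul_right_cancel₀ two_pi_I_ne_zero
    linear_combination h1
  exact_mod_cast h2

end TautFilling

/-! ### From chains to coefficient functions, and conclusion -/

namespace TautFilling

open Equiv

variable {Ω : Type*}

section Coefficients

/-- The coefficient function of a `2`-chain. -/
def coeff₃ (X : Chain Ω 2) (a b c : Ω) : ℤ := X.1 ![a, b, c]

/-- The coefficient function of a `3`-chain. -/
def coeff₄ (M : Chain Ω 3) (a b c d : Ω) : ℤ := M.1 ![a, b, c, d]

lemma vec₃_eta (x : Fin 3 → Ω) : ![x 0, x 1, x 2] = x := by
  funext i; fin_cases i <;> rfl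

lemma vec₄_eta (x : Fin 4 → Ω) : ![x 0, x 1, x 2, x 3] = x := by
  funext i; fin_cases i <;> rfl

lemma coeff₃_apply (X : Chain Ω 2) (x : Fin 3 → Ω) : coeff₃ X (x 0) (x 1) (x 2) = X.1 x := by
  rw [coeff₃, vec₃_eta]

lemma coeff₄_apply (M : Chain Ω 3) (x : Fin 4 → Ω) :
    coeff₄ M (x 0) (x 1) (x 2) (x 3) = M.1 x := by
  rw [coeff₄, vec₄_eta]

lemma isAlt₃_coeff (X : Chain Ω 2) : IsAlt₃ (coeff₃ X) := by
  have key : ∀ (x y : Fin 3 → Ω) (i j : Fin 3), i ≠ j → x ∘ swap i j = y → X.1 y = - X.1 x := by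
    rintro x y i j hij rfl
    rw [X.2 x (swap i j), Perm.sign_swap hij]; simp
  refine ⟨fun a b c => key _ _ 0 1 (by decide) ?_, fun a b c => key _ _ 1 2 (by decide) ?_⟩ <;>
    (funext i; fin_cases i <;> rfl)

lemma isAlt₄_coeff (M : Chain Ω 3) : IsAlt₄ (coeff₄ M) := by
  have key : ∀ (x y : Fin 4 → Ω) (i j : Fin 4), i ≠ j → x ∘ swap i j = y → M.1 y = - M.1 x := by
    rintro x y i j hij rfl
    rw [M.2 x (swap i j), Perm.sign_swap hij]; simp
  refine ⟨fun a b c d => key _ _ 0 1 (by decide) ?_, fun a b c d => key _ _ 1 2 (by decide) ?_,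
    fun a b c d => key _ _ 2 3 (by decide) ?_⟩ <;>
    (funext i; fin_cases i <;> rfl)

/-- Adjacent transpositions generate the symmetric group, so the three swap rules give the sign rule
for all permutations. Every competitor in `Taut` is thus a competitor in `IsTaut`. -/
lemma exists_coeff₄_eq {N : Ω → Ω → Ω → Ω → ℤ} (hN : IsAlt₄ N) : ∃ M : Chain Ω 3, coeff₄ M = N := by
  refine ⟨⟨fun x => N (x 0) (x 1) (x 2) (x 3), fun x π => ?_⟩, rfl⟩
  have hπ : π ∈ Submonoid.closure (Set.range fun i : Fin 3 => swap i.castSucc i.succ) := by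
    rw [Perm.mclosure_swap_castSucc_succ]; trivial
  induction hπ using Submonoid.closure_induction generalizing x with
  | mem π h =>
    obtain ⟨i, rfl⟩ := h
    simp only [Perm.sign_swap i.castSucc_lt_succ.ne, Units.val_neg, Units.val_one, neg_one_mul]
    fin_cases i
    exacts [hN.swap_left _ _ _ _, hN.swap_mid _ _ _ _, hN.swap_right _ _ _ _]
  | one => simp
  | mul π ρ _ _ h₁ h₂ =>
    have := h₂ (x ∘ π)
    rw [h₁ x] at this
    rw [Perm.sign_mul, Units.val_mul, mul_comm (Perm.sign π : ℤ), mul_assoc]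
    exact this

variable [Fintype Ω]

lemma coeff₃_boundary (M : Chain Ω 3) : coeff₃ (boundary M) = bd₃ (coeff₄ M) := rfl

lemma bd₂_coeff₃ (X : Chain Ω 2) (a b : Ω) : bd₂ (coeff₃ X) a b = (boundary X).1 ![a, b] := rfl

variable [DecidableEq Ω]

lemma norm_eq_nrm (M : Chain Ω 3) : norm M = (nrm (coeff₄ M) : ℚ) / (3 + 1).factorial := by
  unfold norm nrm
  congr 1
  let e : (Fin 4 → Ω) ≃ Ω × Ω × Ω × Ω :=
    ⟨fun x => (x 0, x 1, x 2, x 3), fun p => ![p.1, p.2.1, p.2.2.1, p.2.2.2], vec₄_eta,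
      fun _ => rfl⟩
  rw [← e.symm.sum_comp]
  simp only [Fintype.sum_prod_type]
  push_cast
  rfl

lemma IsTaut.taut {M : Chain Ω 3} (hM : IsTaut M) : Taut (coeff₄ M) := by
  intro N hN hbd
  obtain ⟨N, rfl⟩ := exists_coeff₄_eq hN
  have h := hM N (by
    ext x
    have := congrFun (congrFun (congrFun hbd (x 0)) (x 1)) (x 2)
    rwa [← coeff₃_boundary, ← coeff₃_boundary, coeff₃_apply, coeff₃_apply] at this)
  rw [norm_eq_nrm, norm_eq_nrm, div_le_div_iff_of_pos_right (by positivity)] at h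
  exact_mod_cast h

end Coefficients

section Assembly

variable [DecidableEq Ω]

lemma image_vec₃ (x : Fin 3 → Ω) : Finset.univ.image x = {x 0, x 1, x 2} := by
  ext v
  simp [Fin.exists_fin_succ, eq_comm]

lemma image_vec₄ (x : Fin 4 → Ω) : Finset.univ.image x = {x 0, x 1, x 2, x 3} := by
  ext v
  simp [Fin.exists_fin_succ, eq_comm]

lemma supportComplex_eq (M : Chain Ω 3) : supportComplex M = generatedBy (cells (coeff₄ M)) := by
  unfold supportComplex
  congr 1
  ext s
  constructor
  · rintro ⟨x, hx, rfl⟩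
    exact ⟨x 0, x 1, x 2, x 3, by rwa [coeff₄_apply], image_vec₄ x⟩
  · rintro ⟨a, b, c, d, h, rfl⟩
    exact ⟨![a, b, c, d], h, (image_vec₄ ![a, b, c, d]).symm⟩

lemma card_of_mem_cells {M : Ω → Ω → Ω → Ω → ℤ} (hM : IsAlt₄ M) {s : Finset Ω} (hs : s ∈ cells M) :
    s.card = 4 := by
  obtain ⟨a, b, c, d, h, rfl⟩ := hs
  exact card_quad (hM.dist h)

lemma tets_supportComplex (M : Chain Ω 3) : tets (supportComplex M) = cells (coeff₄ M) := by
  rw [supportComplex_eq]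
  ext s
  constructor
  · rintro ⟨⟨-, t, ht, hst⟩, hs⟩
    rwa [Finset.eq_of_subset_of_card_le hst (by rw [hs, card_of_mem_cells (isAlt₄_coeff M) ht])]
  · intro hs
    have h4 := card_of_mem_cells (isAlt₄_coeff M) hs
    exact ⟨⟨Finset.card_pos.1 (by omega), s, hs, subset_rfl⟩, h4⟩

lemma isOrientation_supportComplex {M : Chain Ω 3} (h : ∀ a b c d, |coeff₄ M a b c d| ≤ 1) :
    IsOrientation (supportComplex M) M := by
  intro x hx
  have hcard : (Finset.univ.image x).card = 4 := by
    rw [Finset.card_image_of_injective _ hx]; rfl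
  have hiff : Finset.univ.image x ∈ supportComplex M ↔ M.1 x ≠ 0 := by
    have h1 : Finset.univ.image x ∈ supportComplex M ↔
        Finset.univ.image x ∈ tets (supportComplex M) := ⟨fun h => ⟨h, hcard⟩, fun h => h.1⟩
    rw [h1, tets_supportComplex, image_vec₄, mem_cells_iff (isAlt₄_coeff M), coeff₄_apply]
  have h1 := h (x 0) (x 1) (x 2) (x 3)
  rw [coeff₄_apply] at h1
  rw [hiff]
  exact ⟨fun h0 => le_antisymm h1 (Int.one_le_abs h0), fun h0 => not_not.1 h0⟩

variable [Fintype Ω]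

/-- Lists in `Shells` grow at the head, so the shelling order is the reversed list and its initial
segments are the suffixes handled by `Shells.drop`. -/
lemma isFreelyShellable_supportComplex {M : Chain Ω 3} {F : Set (Finset Ω)}
    (h : Shellable (coeff₄ M) F) : IsFreelyShellable (supportComplex M) := by
  intro t ht
  rw [tets_supportComplex] at ht
  obtain ⟨l, hl, hmem, hlast⟩ := h.2 t ht
  refine ⟨l.reverse, ⟨List.nodup_reverse.2 hl.nodup, fun s => ?_, fun k hk1 hk2 => ?_⟩, ?_⟩
  · rw [List.mem_reverse, tets_supportComplex, hmem]
  · rw [List.length_reverse] at hk2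
    obtain ⟨F', hF'⟩ := hl.drop (l.length - k) (by omega)
    have := hF'.isBall3
    rw [List.take_reverse]
    simpa only [List.mem_reverse] using this
  · rw [List.head?_reverse, hlast]

lemma isBall3_supportComplex {M : Chain Ω 3} {F : Set (Finset Ω)}
    (h : Shellable (coeff₄ M) F) (hne : (cells (coeff₄ M)).Nonempty) :
    IsBall3 (supportComplex M) := by
  obtain ⟨t, ht⟩ := hne
  obtain ⟨l, hl, hmem, -⟩ := h.2 t ht
  rw [supportComplex_eq, ← show {s | s ∈ l} = cells (coeff₄ M) from Set.ext hmem]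
  exact hl.isBall3

/-- The fundamental cycle of a triangulated `2`-sphere. -/
theorem isSph_of_isSphere2 {σ : PreAbstractSimplicialComplex Ω} (hσ : IsSphere2 σ) {X : Chain Ω 2}
    (hXσ : IsOrientation σ X) (hX : boundary X = 0) : IsSph (coeff₃ X) := by
  have halt := isAlt₃_coeff X
  have hor : ∀ a b c, a ≠ b → a ≠ c → b ≠ c →
      ({a, b, c} ∈ σ → |coeff₃ X a b c| = 1) ∧ ({a, b, c} ∉ σ → coeff₃ X a b c = 0) := by
    intro a b c hab hac hbc
    have := hXσ ![a, b, c] (by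
      intro i j hij
      fin_cases i <;> fin_cases j <;> simp_all [eq_comm])
    rwa [image_vec₃] at this
  have hmem : ∀ {a b c}, coeff₃ X a b c ≠ 0 → {a, b, c} ∈ σ := by
    intro a b c h
    obtain ⟨hab, hac, hbc⟩ := halt.dist h
    by_contra hs
    exact h ((hor a b c hab hac hbc).2 hs)
  have hne : ∀ {a b c}, a ≠ b → a ≠ c → b ≠ c → {a, b, c} ∈ σ → coeff₃ X a b c ≠ 0 := by
    intro a b c hab hac hbc hs h
    have := (hor a b c hab hac hbc).1 hs
    simp [h] at this
  refine ⟨halt, fun a b c => ?_, ?_, fun a b c d e hc hd he => ?_, fun S hS hstep a b c h => ?_, ?_,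
    fun g hg hc => ?_⟩
  · by_cases h : coeff₃ X a b c = 0
    · simp [h]
    · obtain ⟨hab, hac, hbc⟩ := halt.dist h
      exact ((hor a b c hab hac hbc).1 (hmem h)).le
  · funext a b
    rw [bd₂_coeff₃, hX]; rfl
  · obtain ⟨hab, hac, hbc⟩ := halt.dist hc
    obtain ⟨-, had, hbd⟩ := halt.dist hd
    obtain ⟨-, hae, hbe⟩ := halt.dist he
    exact eq_or_eq_of_triangles hσ hab hac had hae hbc hbd hbe (hmem hc) (hmem hd) (hmem he)
  · obtain ⟨hab, hac, hbc⟩ := halt.dist h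
    refine triangles_connected hσ ?_ ?_ (hmem h)
      (Finset.card_eq_three.2 ⟨a, b, c, hab, hac, hbc, rfl⟩)
    · obtain ⟨a, b, c, h, hS⟩ := hS
      obtain ⟨hab, hac, hbc⟩ := halt.dist h
      exact ⟨_, hmem h, Finset.card_eq_three.2 ⟨a, b, c, hab, hac, hbc, rfl⟩, hS⟩
    · intro s hs t ht hs3 ht3 hst hSs
      obtain ⟨p, q, hpq, hpq'⟩ := Finset.card_eq_two.1 hst
      obtain ⟨u, rfl⟩ := exists_triple hs3 hpq (hpq' ▸ Finset.inter_subset_left)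
      obtain ⟨w, rfl⟩ := exists_triple ht3 hpq (hpq' ▸ Finset.inter_subset_right)
      have hd : ∀ {r : Ω}, ({p, q, r} : Finset Ω).card = 3 → p ≠ r ∧ q ≠ r := by
        intro r hr
        constructor <;> rintro rfl <;> revert hr
        · rw [Finset.insert_eq_of_mem (by simp)]
          exact fun hr => absurd (hr ▸ Finset.card_le_two) (by norm_num)
        · rw [Finset.pair_eq_singleton]
          exact fun hr => absurd (hr ▸ Finset.card_le_two) (by norm_num)
      exact hstep p q u w (hne hpq (hd hs3).1 (hd hs3).2 hs) (hne hpq (hd ht3).1 (hd ht3).2 ht) hSs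
  · obtain ⟨t, ht, ht3⟩ := exists_triangle hσ
    obtain ⟨a, b, c, hab, hac, hbc, rfl⟩ := Finset.card_eq_three.1 ht3
    exact ⟨a, b, c, hne hab hac hbc ht⟩
  · obtain ⟨h, hh⟩ := exists_potential hσ hg fun a b c hab hac hbc hs =>
      hc a b c (hne hab hac hbc hs)
    refine ⟨h, fun a b c habc => hh a b ((σ.isRelLowerSet_faces (hmem habc)).2 ?_ ⟨a, by simp⟩)⟩
    intro v hv
    simp only [Finset.mem_insert, Finset.mem_singleton] at hv ⊢
    tauto

end Assembly

end TautFilling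

/-- Let `σ` be a simplicial triangulation of `S²`, `X` a 2-cycle obtained by orienting the
2-simplices of `σ`, and `M` a taut filling of `X`. Then `M` is obtained by orienting the tetrahedra
of the complex that they generate, and this complex is a freely shellable simplicial triangulation
of `B³`. -/
theorem theorem3 {Ω : Type*} [Fintype Ω] [DecidableEq Ω]
    (σ : PreAbstractSimplicialComplex Ω) (hσ : TautFilling.IsSphere2 σ)
    (X : TautFilling.Chain Ω 2) (hXσ : TautFilling.IsOrientation σ X)
    (hX : TautFilling.boundary X = 0)
    (M : TautFilling.Chain Ω 3) (hMX : TautFilling.boundary M = X)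
    (hM : TautFilling.IsTaut M) :
    TautFilling.IsOrientation (TautFilling.supportComplex M) M ∧
      TautFilling.IsBall3 (TautFilling.supportComplex M) ∧
      TautFilling.IsFreelyShellable (TautFilling.supportComplex M) := by
  have hbd : TautFilling.bd₃ (TautFilling.coeff₄ M) = TautFilling.coeff₃ X := by
    rw [← TautFilling.coeff₃_boundary, hMX]
  have hsph := TautFilling.isSph_of_isSphere2 hσ hXσ hX
  have hsh := TautFilling.shellable_of_taut (TautFilling.isAlt₄_coeff M) hM.taut (hbd ▸ hsph)
  refine ⟨TautFilling.isOrientation_supportComplex hsh.1,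
    TautFilling.isBall3_supportComplex hsh ?_,
    TautFilling.isFreelyShellable_supportComplex hsh⟩
  obtain ⟨a, b, c, h⟩ := hsph.nonzero
  rw [← hbd] at h
  obtain ⟨w, -, hw⟩ := Finset.exists_ne_zero_of_sum_ne_zero h
  exact ⟨_, w, a, b, c, hw, rfl⟩
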